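/- Let $A=(a_{ij})_{0\le i,j\le n}$ be an irreducible affine Cartan matrix whose affine simple root is short, i.e. one of the types $A_n^{(1)}$ ($n\ge1$), $D_n^{(1)}$ ($n\ge4$), $E_6^{(1)},E_7^{(1)},E_8^{(1)}$, $A_{2n}^{(2)}$ ($n\ge1$), $A_{2n-1}^{(2)}$ ($n\ge3$), $D_{n+1}^{(2)}$ ($n\ge2$), $E_6^{(2)}$, $D_4^{(3)}$, with the nodes of its Dynkin diagram numbered as in Kac's tables, node $0$ being the affine node (for $A_{2n}^{(2)}$, $\alpha_0$ is the shortest and $\alpha_n$ the longest simple root). *Conventions.* Let $\alpha_0,\dots,\alpha_n$ be the simple roots, $(\alpha_j,\alpha_i^\vee)=a_{ij}$, $s_i(x)=x-(x,\alpha_i^\vee)\alpha_i$. Let $a_0,\dots,a_n$ be the coprime positive integers with $\sum_j a_{ij}a_j=0$ for all $i$ (so $a_0=2$ for $A_{2n}^{(2)}$ and $a_0=1$ otherwise), $\delta=\sum_{j} a_j\alpha_j$, $\theta=\delta-a_0\alpha_0$, and let $s_\theta$ be the reflection in $\theta$, an element of the finite Weyl group $\langle s_1,\dots,s_n\rangle$.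 Let $\mathring Q$ be the root lattice $\bigoplus_{i=1}^n\mathbb Z\alpha_i$ of the finite root system, except that for $A_{2n}^{(2)}$ it is the weight lattice of the finite root system. Nodes $i\ne j$ are connected by $a_{ij}a_{ji}$ laces. The braid relation of $x,y$ attached to two distinct nodes is $xyx\cdots=yxy\cdots$ with $2,3,4,6$ factors on each side if the nodes are connected by $0,1,2,3$ laces; there is no relation if there are $4$ laces (which happens only for $A_1^{(1)}$ and $A_2^{(2)}$). The *double affine Artin group* $\mathcal A_{\tilde W}$ is the group generated by $T_0,\dots,T_n$ and $X_\beta$, $\beta\in\mathring Q\oplus\mathbb Z a_0^{-1}\delta$, with the relations: the braid relations for $T_i,T_j$, $i\neq j$; $X_\beta X_\gamma=X_{\beta+\gamma}$; $X_{a_0^{-1}\delta}$ is central; $T_iX_\beta=X_\beta T_i$ if $0\le i\le n$ and $(\beta,\alpha_i^\vee)=0$; and $T_iX_\beta T_i=X_{s_i(\beta)}$ if $0\le i\le n$ and $(\beta,\alpha_i^\vee)=-1$, where for $A_{2n}^{(2)}$ this last relation is not imposed for $i=n$. The *elliptic Artin group* is the quotient of $\mathcal A_{\tilde W}$ by the subgroup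 generated by $X_{a_0^{-1}\delta}$. For a reduced decomposition $s_\theta=s_{j_1}\cdots s_{j_m}$ in the finite Weyl group, put $T_{s_\theta}=T_{j_1}\cdots T_{j_m}$. **Theorem.** Reduced decompositions of $s_\theta$ exist, and for each of them the following holds. The double affine Artin group $\mathcal A_{\tilde W}$ is given by generators and relations as follows. Generators: one generator $T_i$ for each node $i=1,\dots,n$, and three generators $T_{01},T_{02},T_{03}$ for the affine node. Relations: (a) the braid relations for each pair of generators associated to two distinct nodes ($T_{01},T_{02},T_{03}$ all being associated to node $0$); (b) if the affine node is connected by double laces with the node $\alpha$, then $T_{01}T_\alpha^{-1}T_{03}T_\alpha=T_\alpha^{-1}T_{03}T_\alpha T_{01}$; (c) the element $T_{01}T_{02}T_{03}T_{s_\theta}$ is central. More precisely, there is an isomorphism from the group so presented onto $\mathcal A_{\tilde W}$ with $T_i\mapsto T_i$ ($1\le i\le n$), $T_{01}\mapsto T_0$, $T_{02}\mapsto T_0^{-1}X_{\alpha_0}$, $T_{03}\mapsto X_{a_0^{-1}\theta}T_{s_\theta}^{-1}$, under which $T_{01}T_{02}T_{03}T_{s_\theta}\mapsto X_{a_0^{-1}\delta}$.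 The elliptic Artin group has the same description (the isomorphism sending the generators to the classes of the same elements), except that (c) is replaced by $T_{01}T_{02}T_{03}T_{s_\theta}=1$. -/

import Mathlib

namespace TripleArtin

/-- The affine Cartan matrices under consideration: all affine types except
`B_n^(1)`, `C_n^(1)`, `F_4^(1)`, `G_2^(1)`, i.e. those whose affine simple root is short.
The parameter is shifted so that it ranges over all natural numbers. -/
inductive AffineType : Type
  /-- `A_1^(1)` -/
  | A1
  /-- `A_n^(1)`, `n = m + 2` -/
  | A (m : ℕ)
  /-- `D_n^(1)`, `n = m + 4` -/
  | D (m : ℕ)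
  /-- `E_6^(1)` -/
  | E6
  /-- `E_7^(1)` -/
  | E7
  /-- `E_8^(1)` -/
  | E8
  /-- `A_{2n}^(2)`, `n = m + 1` -/
  | A2even (m : ℕ)
  /-- `A_{2n-1}^(2)`, `n = m + 3` -/
  | A2odd (m : ℕ)
  /-- `D_{n+1}^(2)` (also called `B_n^(2)`), `n = m + 2` -/
  | D2 (m : ℕ)
  /-- `E_6^(2)` -/
  | E62
  /-- `D_4^(3)` -/
  | D43

namespace AffineType

/-- The number `n` of non-affine nodes; the nodes are `0, …, n` and `0` is the affine node. -/
def rank : AffineType → ℕ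
  | A1 => 1
  | A m => m + 2
  | D m => m + 4
  | E6 => 6
  | E7 => 7
  | E8 => 8
  | A2even m => m + 1
  | A2odd m => m + 3
  | D2 m => m + 2
  | E62 => 4
  | D43 => 2

/-- The edges `i - j`, `i < j`, of the Dynkin diagram. -/
def Edge : AffineType → ℕ → ℕ → Prop
  | A1, i, j => i + 1 = j
  | A m, i, j => i + 1 = j ∨ (i = 0 ∧ j = m + 2)
  | D m, i, j => (i = 0 ∧ j = 2) ∨ (1 ≤ i ∧ i + 1 = j ∧ j ≤ m + 3) ∨ (i = m + 2 ∧ j = m + 4)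
  | E6, i, j => (1 ≤ i ∧ i + 1 = j ∧ j ≤ 5) ∨ (i = 3 ∧ j = 6) ∨ (i = 0 ∧ j = 6)
  | E7, i, j => (i + 1 = j ∧ j ≤ 6) ∨ (i = 3 ∧ j = 7)
  | E8, i, j => (i + 1 = j ∧ j ≤ 7) ∨ (i = 5 ∧ j = 8)
  | A2even _, i, j => i + 1 = j
  | A2odd _, i, j => (i = 0 ∧ j = 2) ∨ (1 ≤ i ∧ i + 1 = j)
  | D2 _, i, j => i + 1 = j
  | E62, i, j => i + 1 = j
  | D43, i, j => i + 1 = j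

instance (t : AffineType) (i j : ℕ) : Decidable (t.Edge i j) := by
  cases t <;> (dsimp only [Edge]; infer_instance)

/-- `-a_{ij}` for adjacent nodes `i`, `j`. -/
def mult : AffineType → ℕ → ℕ → ℤ
  | A1, _, _ => 2
  | A2even m, i, j =>
      (if i = 0 ∧ j = 1 then 2 else 1) * (if i = m ∧ j = m + 1 then 2 else 1)
  | A2odd m, i, j => if i = m + 2 ∧ j = m + 3 then 2 else 1
  | D2 m, i, j => if (i = 0 ∧ j = 1) ∨ (i = m + 2 ∧ j = m + 1) then 2 else 1
  | E62, i, j => if i = 2 ∧ j = 3 then 2 else 1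
  | D43, i, j => if i = 1 ∧ j = 2 then 3 else 1
  | _, _, _ => 1

/-- The affine Cartan matrix `(a_{ij})`. -/
def cartan (t : AffineType) : Matrix (Fin (t.rank + 1)) (Fin (t.rank + 1)) ℤ :=
  Matrix.of fun i j =>
    if i = j then 2 else if t.Edge i j ∨ t.Edge j i then -(t.mult i j) else 0

/-- The labels `a_0, …, a_n`: the coprime positive integers with `∑ j, a_{ij} a_j = 0`. -/
def label : AffineType → ℕ → ℕ
  | A1, _ => 1
  | A _, _ => 1
  | D m, j => if j ≤ 1 ∨ m + 3 ≤ j then 1 else 2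
  | E6, j => [1, 1, 2, 3, 2, 1, 2].getD j 0
  | E7, j => [1, 2, 3, 4, 3, 2, 1, 2].getD j 0
  | E8, j => [1, 2, 3, 4, 5, 6, 4, 2, 3].getD j 0
  | A2even m, j => if j = m + 1 then 1 else 2
  | A2odd m, j => if j ≤ 1 ∨ j = m + 3 then 1 else 2
  | D2 _, _ => 1
  | E62, j => [1, 2, 3, 2, 1].getD j 0
  | D43, j => [1, 2, 1].getD j 0

/-- The labels `a_0^∨, …, a_n^∨` of the transposed matrix. -/
def dualLabel : AffineType → ℕ → ℕ
  | A2even _, j => if j = 0 then 1 else 2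
  | A2odd _, j => if j ≤ 1 then 1 else 2
  | D2 m, j => if j = 0 ∨ j = m + 2 then 1 else 2
  | E62, j => [1, 2, 3, 4, 2].getD j 0
  | D43, j => [1, 2, 3].getD j 0
  | t, j => t.label j

/-- The number of laces between two nodes. -/
def laces (t : AffineType) (i j : Fin (t.rank + 1)) : ℤ := t.cartan i j * t.cartan j i

/-- The length `m_{ij}` of the braid relation; `0` stands for `∞` (no relation), which occurs only
for the two nodes of `A_1^(1)` and of `A_2^(2)`. -/
def braidLength (t : AffineType) (i j : Fin (t.rank + 1)) : ℕ :=
  if t.laces i j = 0 then 2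
  else if t.laces i j = 1 then 3
  else if t.laces i j = 2 then 4
  else if t.laces i j = 3 then 6
  else 0

/-! ### Roots, lattices, reflections -/

/-- The rational span of the simple roots, in the coordinates given by `α_0, …, α_n`. -/
abbrev V (t : AffineType) : Type := Fin (t.rank + 1) → ℚ

/-- `α_i` -/
def simpleRoot (t : AffineType) (i : Fin (t.rank + 1)) : t.V := Pi.single i 1

/-- `δ = ∑ a_j α_j` -/
def delta (t : AffineType) : t.V := fun j => (t.label j : ℚ)

/-- `θ = δ - a_0 α_0` -/
def theta (t : AffineType) : t.V := t.delta - (t.label 0 : ℚ) • t.simpleRoot 0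

/-- `x ↦ (x, α_i^∨)`, determined by `(α_j, α_i^∨) = a_{ij}`. -/
def coroot (t : AffineType) (i : Fin (t.rank + 1)) : t.V →ₗ[ℚ] ℚ :=
  ∑ j, (t.cartan i j : ℚ) • LinearMap.proj j

/-- The simple reflection `s_i(x) = x - (x, α_i^∨) α_i`. -/
def simpleReflection (t : AffineType) (i : Fin (t.rank + 1)) : Module.End ℚ t.V :=
  Module.preReflection (t.simpleRoot i) (t.coroot i)

/-- The invariant scalar product, `(α_j, α_k) = a_j^∨ a_j⁻¹ a_{jk}`. -/
def form (t : AffineType) : LinearMap.BilinForm ℚ t.V :=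
  Matrix.toBilin' (Matrix.of fun j k =>
    (t.dualLabel j : ℚ) / (t.label j : ℚ) * (t.cartan j k : ℚ))

/-- The reflection `s_θ(x) = x - 2 (θ, x) / (θ, θ) θ`. -/
def thetaReflection (t : AffineType) : Module.End ℚ t.V :=
  Module.preReflection t.theta ((2 / t.form t.theta t.theta) • t.form t.theta)

/-- The product `s_{j_1} ⋯ s_{j_m}` of simple reflections of the finite Weyl group; the letter
`i : Fin n` stands for the non-affine node `i.succ`. -/
def wordReflection (t : AffineType) (w : List (Fin t.rank)) : Module.End ℚ t.V :=
  (w.map fun i => t.simpleReflection i.succ).prod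

/-- `w` is a reduced decomposition of `s_θ` in the finite Weyl group. -/
def IsReducedTheta (t : AffineType) (w : List (Fin t.rank)) : Prop :=
  t.wordReflection w = t.thetaReflection ∧
    ∀ w' : List (Fin t.rank), t.wordReflection w' = t.thetaReflection → w.length ≤ w'.length

/-- The root lattice of the finite root system, spanned by `α_1, …, α_n`. -/
def rootLattice (t : AffineType) : AddSubgroup t.V :=
  AddSubgroup.closure (Set.range fun i : Fin t.rank => t.simpleRoot i.succ)

/-- The weight lattice of the finite root system. -/
def weightLattice (t : AffineType) : AddSubgroup t.V where
  carrier := {x | x 0 = 0 ∧ ∀ i : Fin t.rank, ∃ k : ℤ, t.coroot i.succ x = k}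
  zero_mem' := ⟨rfl, fun _ => ⟨0, by simp⟩⟩
  add_mem' := by
    rintro x y ⟨hx, hx'⟩ ⟨hy, hy'⟩
    refine ⟨by simp [hx, hy], fun i => ?_⟩
    obtain ⟨k, hk⟩ := hx' i
    obtain ⟨l, hl⟩ := hy' i
    exact ⟨k + l, by simp [hk, hl]⟩
  neg_mem' := by
    rintro x ⟨hx, hx'⟩
    refine ⟨by simp [hx], fun i => ?_⟩
    obtain ⟨k, hk⟩ := hx' i
    exact ⟨-k, by simp [hk]⟩

/-- The lattice written `Q` with a ring: the weight lattice of the finite root system for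
`A_{2n}^(2)` and its root lattice for all other types. -/
def finiteLattice (t : AffineType) : AddSubgroup t.V :=
  match t with
  | A2even m => (A2even m).weightLattice
  | t => t.rootLattice

/-- The lattice indexing the elements `X_β`: the finite lattice plus `ℤ a_0⁻¹ δ`. -/
def xLattice (t : AffineType) : AddSubgroup t.V :=
  t.finiteLattice ⊔ AddSubgroup.zmultiples ((t.label 0 : ℚ)⁻¹ • t.delta)

theorem sum_cartan_label_A2even (m : ℕ) (i : Fin (m + 2)) :
    ∑ j : Fin (m + 2), (A2even m).cartan i j * ((A2even m).label j : ℤ) = 0 := by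
  have key : ∀ j : Fin (m + 2), (A2even m).cartan i j * ((A2even m).label j : ℤ) =
      (if (j : ℕ) = i then (if (i : ℕ) = m + 1 then 2 else 4) else 0) +
      (if (j : ℕ) = i + 1 then (if (i : ℕ) = 0 then -4 else -2) else 0) +
      (if (j : ℕ) = i - 1 ∧ (i : ℕ) ≠ 0 then -2 else 0) := by
    intro j
    have hi := i.2
    have hj := j.2
    have hc : (A2even m).cartan i j = if (i : ℕ) = j then 2 else
        if (i : ℕ) + 1 = j ∨ (j : ℕ) + 1 = i then
          -((if (i : ℕ) = 0 ∧ (j : ℕ) = 1 then 2 else 1) *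
            (if (i : ℕ) = m ∧ (j : ℕ) = m + 1 then 2 else 1)) else 0 := by
      simp only [← Fin.ext_iff]
      rfl
    rw [hc]
    simp only [label]
    split_ifs <;> omega
  have h2 : ∀ (a : ℕ) (c : ℤ), ∑ j : Fin (m + 2), (if (j : ℕ) = a then c else 0) =
      if a < m + 2 then c else 0 := by
    intro a c
    rw [Fin.sum_univ_eq_sum_range (fun j => if j = a then c else 0) (m + 2)]
    simp
  simp only [key, Finset.sum_add_distrib, h2, ite_and]
  have hi := i.2
  rcases Nat.eq_zero_or_pos (i : ℕ) with h0 | h0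
  · simp [h0]
  · have h0' : (i : ℕ) ≠ 0 := by omega
    simp only [h0', ne_eq, not_false_eq_true, if_true, if_false]
    split_ifs <;> omega

theorem inv_smul_theta_mem (t : AffineType) :
    (t.label 0 : ℚ)⁻¹ • t.theta ∈ t.finiteLattice := by
  have root : t.theta ∈ t.rootLattice := by
    have h : t.theta = ∑ i : Fin t.rank, t.label i.succ • t.simpleRoot i.succ := by
      ext j
      refine Fin.cases ?_ (fun k => ?_) j
      · simp [theta, delta, simpleRoot, Finset.sum_apply, Fin.succ_ne_zero]
      · simp [theta, delta, simpleRoot, Finset.sum_apply, Pi.single_apply, Fin.succ_ne_zero]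
    rw [h]
    exact sum_mem fun i _ => nsmul_mem
      (AddSubgroup.subset_closure (Set.mem_range_self i)) _
  cases t
  case A2even m =>
    refine ⟨by simp [theta, delta, simpleRoot], fun i => ⟨-(A2even m).cartan i.succ 0, ?_⟩⟩
    have h := sum_cartan_label_A2even m i.succ
    have h' : ∑ j : Fin (m + 2), ((A2even m).cartan i.succ j : ℚ) * ((A2even m).label j : ℚ) = 0 := by
      exact_mod_cast h
    have hδ : (A2even m).coroot i.succ (A2even m).delta = 0 := by
      rw [coroot, LinearMap.sum_apply]
      exact h'
    have h0 : (A2even m).coroot i.succ ((A2even m).simpleRoot 0) =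
        ((A2even m).cartan i.succ 0 : ℚ) := by
      simp [coroot, simpleRoot, LinearMap.sum_apply, Pi.single_apply]
    have hl : ((A2even m).label 0 : ℚ) = 2 := by simp [label]
    rw [map_smul, theta, map_sub, map_smul, hδ, h0, hl]
    push_cast
    simp
  all_goals
    simpa [label, finiteLattice] using root

/-- `a_0⁻¹ δ` as an element of the lattice -/
def xDelta (t : AffineType) : t.xLattice :=
  ⟨(t.label 0 : ℚ)⁻¹ • t.delta,
    AddSubgroup.mem_sup_right (AddSubgroup.mem_zmultiples _)⟩

/-- `a_0⁻¹ θ` as an element of the lattice -/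
def xTheta (t : AffineType) : t.xLattice :=
  ⟨(t.label 0 : ℚ)⁻¹ • t.theta, AddSubgroup.mem_sup_left t.inv_smul_theta_mem⟩

theorem label_zero_pos (t : AffineType) : 0 < t.label 0 := by
  cases t <;> simp [label]

/-- `α_0` as an element of the lattice -/
def xAlphaZero (t : AffineType) : t.xLattice :=
  ⟨t.simpleRoot 0, by
    have h0 : (t.label 0 : ℚ) ≠ 0 := by exact_mod_cast t.label_zero_pos.ne'
    have h : t.simpleRoot 0 = (t.xDelta : t.V) - (t.xTheta : t.V) := by
      simp only [xDelta, xTheta, theta, smul_sub, smul_smul, inv_mul_cancel₀ h0, one_smul]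
      abel
    rw [h]
    exact sub_mem t.xDelta.2 t.xTheta.2⟩

end AffineType

open AffineType

/-- The alternating product `x y x ⋯` with `k` factors. -/
def alternating {G : Type*} [Group G] : ℕ → G → G → G
  | 0, _, _ => 1
  | k + 1, x, y => x * alternating k y x

/-! ### The double affine Artin group -/

/-- Generators: the `T_i` of the affine Artin group and the `X_β`. -/
inductive DAGen (t : AffineType) : Type
  | T (i : Fin (t.rank + 1))
  | X (β : t.xLattice)

/-- In type `A_{2n}^(2)` (where `½ α_n` lies in the weight lattice and is a root of the nonreduced
finite system), `n` is the node at which no relation `T_i X_β T_i = X_{s_i(β)}` is imposed. -/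
def IsDivisibleNode : (t : AffineType) → Fin (t.rank + 1) → Prop
  | A2even m, i => (i : ℕ) = m + 1
  | _, _ => False

/-- The elements set equal to `1` in the double affine Artin group. -/
inductive DARel (t : AffineType) : FreeGroup (DAGen t) → Prop
  /-- the braid relations of the affine Artin group -/
  | braid (i j : Fin (t.rank + 1)) (h : i ≠ j) :
      DARel t (alternating (t.braidLength i j) (.of (.T i)) (.of (.T j)) *
        (alternating (t.braidLength i j) (.of (.T j)) (.of (.T i)))⁻¹)
  /-- `X_β X_γ = X_{β + γ}` -/
  | lattice (β γ : t.xLattice) :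
      DARel t (.of (.X β) * .of (.X γ) * (.of (.X (β + γ)))⁻¹)
  /-- `X_{a_0⁻¹ δ}` is central -/
  | central (g : DAGen t) :
      DARel t (.of (.X t.xDelta) * .of g * (.of g * .of (.X t.xDelta))⁻¹)
  /-- `T_i X_β = X_β T_i` if `(β, α_i^∨) = 0` -/
  | commute (i : Fin (t.rank + 1)) (β : t.xLattice) (h : t.coroot i β = 0) :
      DARel t (.of (.T i) * .of (.X β) * (.of (.X β) * .of (.T i))⁻¹)
  /-- `T_i X_β T_i = X_γ` if `(β, α_i^∨) = -1` and `γ = s_i(β)` -/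
  | reflect (i : Fin (t.rank + 1)) (hi : ¬ IsDivisibleNode t i) (β γ : t.xLattice)
      (h : t.coroot i β = -1) (hγ : (γ : t.V) = t.simpleReflection i β) :
      DARel t (.of (.T i) * .of (.X β) * .of (.T i) * (.of (.X γ))⁻¹)

/-- The double affine Artin group. -/
abbrev DoubleAffineArtin (t : AffineType) : Type := PresentedGroup {r | DARel t r}

namespace DoubleAffineArtin

def T (t : AffineType) (i : Fin (t.rank + 1)) : DoubleAffineArtin t := PresentedGroup.of (.T i)

def X (t : AffineType) (β : t.xLattice) : DoubleAffineArtin t := PresentedGroup.of (.X β)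

/-- `T_{j_1} ⋯ T_{j_m}` for a word in the non-affine nodes -/
def Tword (t : AffineType) (w : List (Fin t.rank)) : DoubleAffineArtin t :=
  (w.map fun i => T t i.succ).prod

theorem X_delta_mem_center (t : AffineType) :
    X t t.xDelta ∈ Subgroup.center (DoubleAffineArtin t) := by
  rw [Subgroup.mem_center_iff]
  intro g
  have hg : g ∈ Subgroup.closure (Set.range (PresentedGroup.of (rels := {r | DARel t r}))) := by
    rw [PresentedGroup.closure_range_of]; trivial
  have hle : Subgroup.closure (Set.range (PresentedGroup.of (rels := {r | DARel t r}))) ≤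
      Subgroup.centralizer {X t t.xDelta} := by
    rw [Subgroup.closure_le]
    rintro _ ⟨a, rfl⟩
    rw [SetLike.mem_coe, Subgroup.mem_centralizer_singleton_iff]
    have h := PresentedGroup.one_of_mem (rels := {r | DARel t r}) (DARel.central a)
    rw [map_mul, map_inv, mul_inv_eq_one, map_mul, map_mul] at h
    exact h.symm
  exact Subgroup.mem_centralizer_singleton_iff.1 (hle hg)

instance (t : AffineType) : (Subgroup.zpowers (X t t.xDelta)).Normal where
  conj_mem := by
    intro n hn g
    have hle : Subgroup.zpowers (X t t.xDelta) ≤ Subgroup.center (DoubleAffineArtin t) :=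
      (Subgroup.zpowers_le).2 (X_delta_mem_center t)
    have h := Subgroup.mem_center_iff.1 (hle hn) g
    rwa [h, mul_inv_cancel_right]

end DoubleAffineArtin

/-- The elliptic Artin group: the quotient of the double affine Artin group by the (central)
subgroup generated by `X_{a_0⁻¹ δ}`. -/
abbrev EllipticArtin (t : AffineType) : Type :=
  DoubleAffineArtin t ⧸ Subgroup.zpowers (DoubleAffineArtin.X t t.xDelta)

/-! ### The presentations with a tripled affine node -/

/-- One generator for each non-affine node and three for the affine node. -/
inductive TripleGen (t : AffineType) : Type
  | T (i : Fin t.rank)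
  | T01
  | T02
  | T03

namespace TripleGen

/-- The node with which a generator is associated. -/
def node {t : AffineType} : TripleGen t → Fin (t.rank + 1)
  | T i => i.succ
  | _ => 0

/-- `T_01 T_02 T_03 T_{j_1} ⋯ T_{j_m}`, where `w = (j_1, …, j_m)` -/
def central {t : AffineType} (w : List (Fin t.rank)) : FreeGroup (TripleGen t) :=
  .of T01 * .of T02 * .of T03 * (w.map fun i => FreeGroup.of (T i)).prod

end TripleGen

/-- The relations common to both presentations. -/
inductive TripleRel (t : AffineType) : FreeGroup (TripleGen t) → Prop
  /-- braid relations for generators associated with distinct nodes -/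
  | braid (g h : TripleGen t) (hgh : g.node ≠ h.node) :
      TripleRel t (alternating (t.braidLength g.node h.node) (.of g) (.of h) *
        (alternating (t.braidLength g.node h.node) (.of h) (.of g))⁻¹)
  /-- `T_01 T_α⁻¹ T_03 T_α = T_α⁻¹ T_03 T_α T_01` if double laces connect `α` with the affine
  node -/
  | double (i : Fin t.rank) (hi : t.laces 0 i.succ = 2) :
      TripleRel t
        (.of .T01 * (.of (.T i))⁻¹ * .of .T03 * .of (.T i) *
          ((.of (.T i))⁻¹ * .of .T03 * .of (.T i) * .of .T01)⁻¹)

/-- Relations: those above, and `T_01 T_02 T_03 T_{s_θ}` is central (`w` is a reduced decomposition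
of `s_θ`). -/
def doubleRels (t : AffineType) (w : List (Fin t.rank)) : Set (FreeGroup (TripleGen t)) :=
  {r | TripleRel t r} ∪
    {r | ∃ g : TripleGen t,
      r = TripleGen.central w * .of g * (.of g * TripleGen.central w)⁻¹}

/-- Relations: those above, and `T_01 T_02 T_03 T_{s_θ} = 1`. -/
def ellipticRels (t : AffineType) (w : List (Fin t.rank)) : Set (FreeGroup (TripleGen t)) :=
  {r | TripleRel t r} ∪ {TripleGen.central w}

end TripleArtin

namespace TripleArtin
namespace AffineType

/-- The entries of the affine Cartan matrix, as a function of natural numbers. -/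
def entry (t : AffineType) (i j : ℕ) : ℤ :=
  if i = j then 2 else if t.Edge i j ∨ t.Edge j i then -(t.mult i j) else 0

theorem cartan_eq_entry (t : AffineType) (i j : Fin (t.rank + 1)) :
    t.cartan i j = t.entry i j := by
  simp only [cartan, Matrix.of_apply, entry, Fin.ext_iff]

/-- The integers `d_i = a_0 a_i^∨ a_i⁻¹`, which symmetrize the Cartan matrix. -/
def sym : AffineType → ℕ → ℤ
  | A2even m, i => if i = 0 then 1 else if i = m + 1 then 4 else 2
  | A2odd m, i => if i = m + 3 then 2 else 1
  | D2 m, i => if i = 0 ∨ i = m + 2 then 1 else 2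
  | E62, i => if 3 ≤ i then 2 else 1
  | D43, i => if i = 2 then 3 else 1
  | _, _ => 1

theorem sym_pos (t : AffineType) (i : ℕ) : 0 < t.sym i := by
  cases t <;> simp only [sym] <;> (try split_ifs) <;> norm_num

theorem sym_zero (t : AffineType) : t.sym 0 = 1 := by
  cases t <;> simp [sym]

theorem entry_self (t : AffineType) (i : ℕ) : t.entry i i = 2 := if_pos rfl

theorem entry_of_edge (t : AffineType) {i j : ℕ} (h : i ≠ j) (he : t.Edge i j ∨ t.Edge j i) :
    t.entry i j = -t.mult i j := by
  rw [entry, if_neg h, if_pos he]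

theorem entry_of_not_edge (t : AffineType) {i j : ℕ} (h : i ≠ j)
    (he : ¬ (t.Edge i j ∨ t.Edge j i)) : t.entry i j = 0 := by
  rw [entry, if_neg h, if_neg he]

theorem mult_pos (t : AffineType) (i j : ℕ) : 0 < t.mult i j := by
  cases t <;> simp only [mult] <;> (try split_ifs) <;> norm_num

theorem entry_nonpos (t : AffineType) {i j : ℕ} (h : i ≠ j) : t.entry i j ≤ 0 := by
  have := t.mult_pos i j
  rw [entry, if_neg h]
  split_ifs <;> omega

theorem sym_mul_mult (t : AffineType) {i j : ℕ} (hi : i ≤ t.rank) (hj : j ≤ t.rank)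
    (h : t.Edge i j ∨ t.Edge j i) : t.sym i * t.mult i j = t.sym j * t.mult j i := by
  cases t <;> simp only [sym, Edge, mult, rank] at *
  case A2even m =>
    rcases h with rfl | rfl
    · rcases Nat.eq_zero_or_pos i with rfl | h0
      · rcases Nat.eq_zero_or_pos m with rfl | hm
        · norm_num
        · have : m ≠ 0 := by omega
          simp [this, this.symm]
      · have h1 : i ≠ 0 := by omega
        by_cases h2 : i = m
        · subst h2; simp [h1]
        · have h3 : i ≠ m + 1 := by omega
          simp [h1, h2, h3]
    · rcases Nat.eq_zero_or_pos j with rfl | h0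
      · rcases Nat.eq_zero_or_pos m with rfl | hm
        · norm_num
        · have : m ≠ 0 := by omega
          simp [this, this.symm]
      · have h1 : j ≠ 0 := by omega
        by_cases h2 : j = m
        · subst h2; simp [h1]
        · have h3 : j ≠ m + 1 := by omega
          simp [h1, h2, h3]
  all_goals (try split_ifs) <;> omega

theorem sym_mul_entry (t : AffineType) {i j : ℕ} (hi : i ≤ t.rank) (hj : j ≤ t.rank) :
    t.sym i * t.entry i j = t.sym j * t.entry j i := by
  rcases eq_or_ne i j with rfl | h
  · rfl
  · by_cases he : t.Edge i j ∨ t.Edge j i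
    · rw [t.entry_of_edge h he, t.entry_of_edge h.symm he.symm, mul_neg, mul_neg,
        t.sym_mul_mult hi hj he]
    · rw [t.entry_of_not_edge h he, t.entry_of_not_edge h.symm (by tauto), mul_zero, mul_zero]

theorem label_pos (t : AffineType) (i : Fin (t.rank + 1)) : 0 < t.label i := by
  cases t
  case E6 | E7 | E8 | E62 | D43 => revert i; decide
  all_goals simp only [label]; (try split_ifs) <;> norm_num

theorem sym_mul_label (t : AffineType) (i : Fin (t.rank + 1)) :
    t.sym i * t.label i = t.label 0 * t.dualLabel i := by
  cases t
  case E6 | E7 | E8 | E62 | D43 => revert i; decide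
  all_goals
    have := i.2
    simp only [label, dualLabel, sym, rank] at *
    (try split_ifs) <;> simp_all

theorem rank_two_cases (t : AffineType) {i j : ℕ} (hi : i ≤ t.rank) (hj : j ≤ t.rank)
    (h : i ≠ j) :
    (t.entry i j = 0 ∧ t.entry j i = 0) ∨ (t.entry i j = -1 ∧ t.entry j i = -1) ∨
    (t.entry i j = -1 ∧ t.entry j i = -2) ∨ (t.entry i j = -2 ∧ t.entry j i = -1) ∨
    (t.entry i j = -1 ∧ t.entry j i = -3) ∨ (t.entry i j = -3 ∧ t.entry j i = -1) ∨
    (t.entry i j * t.entry j i = 4 ∧ t.rank = 1) := by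
  by_cases he : t.Edge i j ∨ t.Edge j i
  · rw [t.entry_of_edge h he, t.entry_of_edge h.symm he.symm]
    cases t <;> simp only [Edge, mult, rank] at *
    case A2even m =>
      rcases Nat.eq_zero_or_pos m with rfl | hm
      · have : (i = 0 ∧ j = 1) ∨ (i = 1 ∧ j = 0) := by omega
        rcases this with ⟨rfl, rfl⟩ | ⟨rfl, rfl⟩ <;> norm_num
      · split_ifs <;> omega
    all_goals (try split_ifs) <;> first | omega | norm_num
  · exact Or.inl ⟨t.entry_of_not_edge h he, t.entry_of_not_edge h.symm (by tauto)⟩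

theorem zero_node_cases (t : AffineType) {j : ℕ} (hj : j ≤ t.rank) (h : j ≠ 0) :
    (t.entry 0 j = 0 ∧ t.entry j 0 = 0) ∨
    (t.entry 0 j = -1 ∧ t.entry j 0 = -1) ∨
    (t.entry 0 j = -2 ∧ t.entry j 0 = -1) ∨
    (t.entry 0 j * t.entry j 0 = 4 ∧ t.rank = 1) := by
  have hs := t.sym_mul_entry (Nat.zero_le _) hj
  rw [sym_zero, one_mul] at hs
  rcases t.rank_two_cases (Nat.zero_le _) hj h.symm with
    h' | h' | ⟨h1, h2⟩ | h' | ⟨h1, h2⟩ | ⟨h1, h2⟩ | h'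
  · exact Or.inl h'
  · exact Or.inr (Or.inl h')
  · rw [h1, h2] at hs; omega
  · exact Or.inr (Or.inr (Or.inl h'))
  · rw [h1, h2] at hs; omega
  · exfalso
    rw [h1, h2] at hs
    have h3 : t.sym j = 3 := by omega
    cases t <;> simp only [sym] at h3 <;> (try split_ifs at h3) <;> (try omega)
    subst j
    exact absurd h1 (by decide)
  · exact Or.inr (Or.inr (Or.inr h'))

end AffineType
end TripleArtin

namespace TripleArtin
namespace AffineType

theorem sum_range_ite (n a : ℕ) (p : Prop) [Decidable p] (c : ℤ) :
    ∑ k ∈ Finset.range n, (if k = a ∧ p then c else 0) = if a < n ∧ p then c else 0 := by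
  by_cases hp : p <;> simp [hp]

set_option maxHeartbeats 2000000 in
theorem sum_entry_label_D (m : ℕ) {i : ℕ} (hi : i ≤ (D m).rank) :
    ∑ k ∈ Finset.range ((D m).rank + 1), (D m).entry i k * ((D m).label k : ℤ) = 0 := by
    simp only [rank] at *
    have hsum : ∀ k ∈ Finset.range (m + 4 + 1), (D m).entry i k * ((D m).label k : ℤ) =
        (if k = i ∧ 0 ≤ i then (if i ≤ 1 ∨ m + 3 ≤ i then 2 else 4) else 0) +
        (if k = i + 1 ∧ (1 ≤ i ∧ i ≤ m + 2) then (if i = m + 2 then -1 else -2) else 0) +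
        (if k = i - 1 ∧ (2 ≤ i ∧ i ≤ m + 3) then (if i = 2 then -1 else -2) else 0) +
        (if k = 2 ∧ i = 0 then -2 else 0) + (if k = 0 ∧ i = 2 then -1 else 0) +
        (if k = m + 4 ∧ i = m + 2 then -1 else 0) +
        (if k = m + 2 ∧ i = m + 4 then -2 else 0) := by
      intro k hk
      rw [Finset.mem_range] at hk
      rcases eq_or_ne i k with rfl | h
      · rw [entry_self]
        simp only [label, true_and, Nat.cast_ite]
        split_ifs <;> omega
      · by_cases he : (D m).Edge i k ∨ (D m).Edge k i
        · rw [entry_of_edge _ h he]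
          have hl : ((D m).label k : ℤ) = if k ≤ 1 ∨ m + 3 ≤ k then 1 else 2 := by
            simp only [label]; split_ifs <;> rfl
          rw [hl]
          simp only [mult, Edge] at *
          clear hl
          rcases he with (he | he | he) | (he | he | he) <;> omega
        · rw [entry_of_not_edge _ h he]
          rw [zero_mul]
          simp only [Edge] at he
          rw [if_neg (by omega), if_neg (by omega), if_neg (by omega), if_neg (by omega),
            if_neg (by omega), if_neg (by omega), if_neg (by omega)]
          rfl
    rw [Finset.sum_congr rfl hsum]
    simp only [Finset.sum_add_distrib, sum_range_ite]
    omega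

set_option maxHeartbeats 1000000 in
theorem sum_entry_label (t : AffineType) {i : ℕ} (hi : i ≤ t.rank) :
    ∑ k ∈ Finset.range (t.rank + 1), t.entry i k * (t.label k : ℤ) = 0 := by
  cases t
  case A2even m =>
    have h := sum_cartan_label_A2even m ⟨i, Nat.lt_succ_of_le hi⟩
    rw [← h]
    exact (Fin.sum_univ_eq_sum_range (fun k => (A2even m).entry i k * ((A2even m).label k : ℤ))
      (m + 2)).symm.trans (Finset.sum_congr rfl fun j _ => by
        rw [← cartan_eq_entry _ ⟨i, Nat.lt_succ_of_le hi⟩ j]; rfl)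
  case A1 | E6 | E7 | E8 | E62 | D43 =>
    simp only [rank] at hi ⊢
    interval_cases i <;> decide
  case A m =>
    simp only [rank] at *
    have hsum : ∀ k ∈ Finset.range (m + 2 + 1), (A m).entry i k * ((A m).label k : ℤ) =
        (if k = i ∧ 0 ≤ i then 2 else 0) + (if k = i + 1 ∧ i < m + 2 then -1 else 0) +
        (if k = 0 ∧ i = m + 2 then -1 else 0) + (if k = m + 2 ∧ i = 0 then -1 else 0) +
        (if k = i - 1 ∧ 0 < i then -1 else 0) := by
      intro k hk
      rw [Finset.mem_range] at hk
      rcases eq_or_ne i k with rfl | h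
      · rw [entry_self]
        simp only [label, true_and]
        split_ifs <;> omega
      · by_cases he : (A m).Edge i k ∨ (A m).Edge k i
        · rw [entry_of_edge _ h he]
          simp only [label, mult, Edge] at *
          split_ifs <;> omega
        · rw [entry_of_not_edge _ h he]
          simp only [label, Edge] at *
          split_ifs <;> omega
    rw [Finset.sum_congr rfl hsum]
    simp only [Finset.sum_add_distrib, sum_range_ite]
    split_ifs <;> omega
  case D m => exact sum_entry_label_D m hi
  case A2odd m =>
    simp only [rank] at *
    have hsum : ∀ k ∈ Finset.range (m + 3 + 1), (A2odd m).entry i k * ((A2odd m).label k : ℤ) =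
        (if k = i ∧ 0 ≤ i then (if i ≤ 1 ∨ i = m + 3 then 2 else 4) else 0) +
        (if k = i + 1 ∧ (1 ≤ i ∧ i ≤ m + 2) then -2 else 0) +
        (if k = i - 1 ∧ 2 ≤ i then (if i = 2 then -1 else -2) else 0) +
        (if k = 2 ∧ i = 0 then -2 else 0) + (if k = 0 ∧ i = 2 then -1 else 0) := by
      intro k hk
      rw [Finset.mem_range] at hk
      rcases eq_or_ne i k with rfl | h
      · rw [entry_self]
        simp only [label, true_and, Nat.cast_ite]
        split_ifs <;> omega
      · by_cases he : (A2odd m).Edge i k ∨ (A2odd m).Edge k i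
        · rw [entry_of_edge _ h he]
          simp only [label, mult, Edge, Nat.cast_ite] at *
          rcases he with (he | he) | (he | he) <;> split_ifs <;> omega
        · rw [entry_of_not_edge _ h he]
          simp only [label, Edge, Nat.cast_ite] at *
          omega
    rw [Finset.sum_congr rfl hsum]
    simp only [Finset.sum_add_distrib, sum_range_ite]
    omega
  case D2 m =>
    simp only [rank] at *
    have hsum : ∀ k ∈ Finset.range (m + 2 + 1), (D2 m).entry i k * ((D2 m).label k : ℤ) =
        (if k = i ∧ 0 ≤ i then 2 else 0) +
        (if k = i + 1 ∧ i ≤ m + 1 then (if i = 0 then -2 else -1) else 0) +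
        (if k = i - 1 ∧ 1 ≤ i then (if i = m + 2 then -2 else -1) else 0) := by
      intro k hk
      rw [Finset.mem_range] at hk
      rcases eq_or_ne i k with rfl | h
      · rw [entry_self]
        simp only [label, true_and]
        split_ifs <;> omega
      · by_cases he : (D2 m).Edge i k ∨ (D2 m).Edge k i
        · rw [entry_of_edge _ h he]
          simp only [label, mult, Edge] at *
          split_ifs <;> omega
        · rw [entry_of_not_edge _ h he]
          simp only [label, Edge] at *
          split_ifs <;> omega
    rw [Finset.sum_congr rfl hsum]
    simp only [Finset.sum_add_distrib, sum_range_ite]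
    split_ifs <;> omega

/-- The node numbered `n` in the types `A_1^(1)`, `A_{2n}^(2)`, `D_{n+1}^(2)`. -/
def IsLastNode : AffineType → ℕ → Prop
  | A1, j => j = 1
  | A2even m, j => j = m + 1
  | D2 m, j => j = m + 2
  | _, _ => False

/-- All nodes but `IsLastNode` are reached from the affine node through steps `i → j` with
`a_{ji} = -1`. -/
theorem node_induction (t : AffineType) {P : ℕ → Prop} (h0 : P 0)
    (step : ∀ i j, i ≤ t.rank → j ≤ t.rank → j ≠ 0 → ¬ t.IsLastNode j → t.entry j i = -1 →
      P i → P j)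
    (last : ∀ j, j ≤ t.rank → t.IsLastNode j → (∀ k, k ≤ t.rank → k ≠ j → P k) → P j) :
    ∀ j, j ≤ t.rank → P j := by
  have path : ∀ a b, b ≤ t.rank →
      (∀ k, a ≤ k → k < b → ¬ t.IsLastNode (k + 1) ∧ t.entry (k + 1) k = -1) → P a →
      ∀ k, a ≤ k → k ≤ b → P k := by
    intro a b hb hs ha k hak
    induction k, hak using Nat.le_induction with
    | base => exact fun _ => ha
    | succ k hk ih =>
      intro hkb
      have := hs k hk (by omega)
      exact step k (k + 1) (by omega) (by omega) (by omega) this.1 this.2 (ih (by omega))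
  have lastStep : ∀ b, b + 1 = t.rank → t.IsLastNode (b + 1) → (∀ k ≤ b, P k) →
      ∀ j, j ≤ t.rank → P j := by
    intro b hb hl hP j hj
    rcases Nat.lt_or_ge b j with h | h
    · have : j = b + 1 := by omega
      subst this
      exact last _ hj hl fun k hk hk' => hP k (by omega)
    · exact hP j h
  cases t
  case A1 =>
    refine lastStep 0 rfl rfl fun k hk => ?_
    obtain rfl : k = 0 := by omega
    exact h0
  case A m =>
    intro j hj
    refine path 0 (m + 2) le_rfl (fun k _ hk => ⟨id, ?_⟩) h0 j (by omega) hj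
    simp [entry, Edge, mult]
  case D m =>
    simp only [rank] at *
    have h2 : P 2 := step 0 2 (by omega) (by omega) (by omega) id (by simp [entry, Edge, mult]) h0
    have h1 : P 1 := step 2 1 (by omega) (by omega) (by omega) id (by simp [entry, Edge, mult]) h2
    have h3 := path 1 (m + 3) (by omega) (fun k _ hk => ⟨id, by
      have : k + 1 ≤ m + 3 := by omega
      have : 1 ≤ k := by omega
      simp [entry, Edge, mult, *]⟩) h1
    have h4 : P (m + 4) := step (m + 2) (m + 4) (by omega) (by omega) (by omega) id
      (by simp [entry, Edge, mult]) (h3 _ (by omega) (by omega))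
    intro j hj
    rcases Nat.eq_zero_or_pos j with rfl | hj0
    · exact h0
    · rcases Nat.lt_or_ge j (m + 4) with h | h
      · exact h3 j hj0 (by omega)
      · obtain rfl : j = m + 4 := by omega
        exact h4
  case E6 =>
    have s := fun i j hi hj h0 => step i j hi hj h0 id
    have h6 := s 0 6 (by decide) (by decide) (by decide) (by decide) h0
    have h3 := s 6 3 (by decide) (by decide) (by decide) (by decide) h6
    have h2 := s 3 2 (by decide) (by decide) (by decide) (by decide) h3
    have h1 := s 2 1 (by decide) (by decide) (by decide) (by decide) h2
    have h4 := s 3 4 (by decide) (by decide) (by decide) (by decide) h3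
    have h5 := s 4 5 (by decide) (by decide) (by decide) (by decide) h4
    intro j hj
    simp only [rank] at hj
    interval_cases j <;> assumption
  case E7 =>
    have s := fun i j hi hj h0 => step i j hi hj h0 id
    have h1 := path 0 6 (by decide) (fun k _ hk => ⟨id, by interval_cases k <;> decide⟩) h0
    have h7 := s 3 7 (by decide) (by decide) (by decide) (by decide) (h1 3 (by decide) (by decide))
    intro j hj
    simp only [rank] at hj
    rcases Nat.lt_or_ge j 7 with h | h
    · exact h1 j (by omega) (by omega)
    · obtain rfl : j = 7 := by omega
      exact h7
  case E8 =>
    have s := fun i j hi hj h0 => step i j hi hj h0 id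
    have h1 := path 0 7 (by decide) (fun k _ hk => ⟨id, by interval_cases k <;> decide⟩) h0
    have h8 := s 5 8 (by decide) (by decide) (by decide) (by decide) (h1 5 (by decide) (by decide))
    intro j hj
    simp only [rank] at hj
    rcases Nat.lt_or_ge j 8 with h | h
    · exact h1 j (by omega) (by omega)
    · obtain rfl : j = 8 := by omega
      exact h8
  case A2even m =>
    refine lastStep m rfl rfl fun k hk => ?_
    refine path 0 m (Nat.le_succ m) (fun k _ hk => ⟨?_, ?_⟩) h0 k (by omega) hk
    · simp only [IsLastNode]; omega
    · have : k + 1 ≠ m + 1 := by omega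
      have : k + 1 ≠ m ∨ k ≠ m + 1 := by omega
      simp [entry, Edge, mult]; omega
  case A2odd m =>
    simp only [rank] at *
    have h2 : P 2 := step 0 2 (by omega) (by omega) (by omega) id (by simp [entry, Edge, mult]) h0
    have h1 : P 1 := step 2 1 (by omega) (by omega) (by omega) id (by simp [entry, Edge, mult]) h2
    have h3 := path 1 (m + 3) (by omega) (fun k _ hk => ⟨id, by
      have : 1 ≤ k := by omega
      simp [entry, Edge, mult, *]; omega⟩) h1
    intro j hj
    rcases Nat.eq_zero_or_pos j with rfl | hj0
    · exact h0
    · exact h3 j hj0 (by omega)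
  case D2 m =>
    refine lastStep (m + 1) rfl rfl fun k hk => ?_
    refine path 0 (m + 1) (Nat.le_succ _) (fun k _ hk => ⟨?_, ?_⟩) h0 k (by omega) hk
    · simp only [IsLastNode]; omega
    · simp [entry, Edge, mult]; omega
  case E62 =>
    have h1 := path 0 4 (by decide) (fun k _ hk => ⟨id, by interval_cases k <;> decide⟩) h0
    exact fun j hj => h1 j (by omega) hj
  case D43 =>
    have h1 := path 0 2 (by decide) (fun k _ hk => ⟨id, by interval_cases k <;> decide⟩) h0
    exact fun j hj => h1 j (by omega) hj

theorem rank_pos (t : AffineType) : 0 < t.rank := by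
  cases t <;> simp [rank]

theorem isLastNode_of_sym_eq_four (t : AffineType) {j : ℕ} (h : t.sym j = 4) :
    t.IsLastNode j := by
  cases t <;> simp only [sym, IsLastNode] at * <;> (try split_ifs at h) <;> omega

theorem isDivisibleNode_iff (t : AffineType) (j : Fin (t.rank + 1)) :
    IsDivisibleNode t j ↔ t.sym j = 4 := by
  cases t <;> simp only [sym, IsDivisibleNode] <;> (try split_ifs) <;> first | omega | simp_all

theorem label_last (t : AffineType) {j : ℕ} (h : t.IsLastNode j) : t.label j = 1 := by
  cases t <;> simp_all [IsLastNode, label]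

theorem sym_eq_of_sq (t : AffineType) {i : Fin (t.rank + 1)} (j : Fin (t.rank + 1)) (hi : i ≠ 0)
    (hd : ¬ IsDivisibleNode t i) {x : ℚ} (h : (t.sym j : ℚ) = x ^ 2 * t.sym i) :
    t.sym j = t.sym i := by
  have aux : ∀ p : ℕ, p.Prime → ∀ x : ℚ, (p : ℚ) ≠ x ^ 2 := by
    intro p hp x hx
    have : IsSquare (p : ℚ) := ⟨x, by rw [hx, sq]⟩
    rw [Rat.isSquare_natCast_iff] at this
    exact hp.not_isSquare this
  have k2 := aux 2 Nat.prime_two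
  have k3 := aux 3 Nat.prime_three
  have hi' : (i : ℕ) ≠ 0 := fun h => hi (Fin.ext h)
  have inv : ∀ c x : ℚ, c ≠ 0 → 1 = x ^ 2 * c → c = x⁻¹ ^ 2 := by
    intro c x hc h
    have hx : x ≠ 0 := by rintro rfl; norm_num at h
    field_simp
    linarith
  have hc : (t.sym j = t.sym i) ∨ (t.sym j = 1 ∧ (t.sym i = 2 ∨ t.sym i = 3)) ∨
      (t.sym i = 1 ∧ (t.sym j = 2 ∨ t.sym j = 3)) ∨ (t.sym i = 2 ∧ t.sym j = 4) := by
    cases t <;> simp only [sym, IsDivisibleNode] at * <;> (try split_ifs) <;> first | omega | simp_all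
  rcases hc with hc | ⟨h1, h2 | h2⟩ | ⟨h1, h2 | h2⟩ | ⟨h1, h2⟩
  · exact hc
  all_goals
    rw [h1, h2] at h
    exfalso
  · exact k2 x⁻¹ (inv 2 x (by norm_num) (by exact_mod_cast h))
  · exact k3 x⁻¹ (inv 3 x (by norm_num) (by exact_mod_cast h))
  · exact k2 x (by push_cast at h ⊢; linarith)
  · exact k3 x (by push_cast at h ⊢; linarith)
  · exact k2 x (by push_cast at h ⊢; linarith)

/-- `a_0² ∣ a_i d_i` for `i ≠ 0`. -/
theorem label_zero_sq_dvd (t : AffineType) (i : Fin (t.rank + 1)) (hi : i ≠ 0) :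
    ((t.label 0 : ℤ)) ^ 2 ∣ t.label i * t.sym i := by
  have hi' : (i : ℕ) ≠ 0 := fun h => hi (Fin.ext h)
  cases t
  case A2even m =>
    simp only [label, sym, if_neg hi']
    split_ifs <;> norm_num
  case D m => simp [label]
  case A2odd m => simp [label]
  all_goals simp [label]

end AffineType
end TripleArtin

namespace TripleArtin
namespace AffineType

variable (t : AffineType)

/-! ### The normalized form -/

/-- The invariant form normalized by `(α_0, α_0) = 2`. -/
def bil : LinearMap.BilinForm ℚ t.V := (t.label 0 : ℚ) • t.form

theorem coroot_apply (i : Fin (t.rank + 1)) (x : t.V) :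
    t.coroot i x = ∑ j, (t.cartan i j : ℚ) * x j := by
  simp [coroot, LinearMap.sum_apply]

theorem coroot_simpleRoot (i j : Fin (t.rank + 1)) :
    t.coroot i (t.simpleRoot j) = t.cartan i j := by
  simp [coroot_apply, simpleRoot, Pi.single_apply]

theorem cartan_self (i : Fin (t.rank + 1)) : t.cartan i i = 2 := by
  rw [cartan_eq_entry, entry_self]

theorem cartan_nonpos {i j : Fin (t.rank + 1)} (h : i ≠ j) : t.cartan i j ≤ 0 := by
  rw [cartan_eq_entry]; exact t.entry_nonpos fun h' => h (Fin.ext h')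

theorem sym_mul_cartan (i j : Fin (t.rank + 1)) :
    t.sym i * t.cartan i j = t.sym j * t.cartan j i := by
  rw [cartan_eq_entry, cartan_eq_entry]
  exact t.sym_mul_entry (Nat.lt_succ_iff.1 i.2) (Nat.lt_succ_iff.1 j.2)

theorem sum_cartan_label (i : Fin (t.rank + 1)) :
    ∑ j : Fin (t.rank + 1), t.cartan i j * (t.label j : ℤ) = 0 := by
  rw [← t.sum_entry_label (Nat.lt_succ_iff.1 i.2),
    ← Fin.sum_univ_eq_sum_range (fun k => t.entry i k * (t.label k : ℤ))]
  simp only [cartan_eq_entry]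

theorem coroot_delta (i : Fin (t.rank + 1)) : t.coroot i t.delta = 0 := by
  rw [coroot_apply]
  have : ∑ j : Fin (t.rank + 1), (t.cartan i j : ℚ) * (t.label j : ℚ) = 0 := by
    exact_mod_cast t.sum_cartan_label i
  exact this

theorem bil_apply (x y : t.V) : t.bil x y = ∑ j : Fin (t.rank + 1), x j * t.sym j * t.coroot j y := by
  rw [bil, LinearMap.smul_apply, LinearMap.smul_apply, form, Matrix.toBilin'_apply, smul_eq_mul,
    Finset.mul_sum]
  refine Finset.sum_congr rfl fun j _ => ?_
  rw [coroot_apply, Finset.mul_sum, Finset.mul_sum]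
  refine Finset.sum_congr rfl fun k _ => ?_
  have hl : (t.label j : ℚ) ≠ 0 := by exact_mod_cast (t.label_pos j).ne'
  have h : (t.sym j : ℚ) * t.label j = t.label 0 * t.dualLabel j := by
    exact_mod_cast t.sym_mul_label j
  have h' : (t.sym j : ℚ) = t.label 0 * t.dualLabel j / t.label j := by
    rw [eq_div_iff hl, h]
  rw [h', Matrix.of_apply]
  field_simp

theorem bil_apply' (x y : t.V) :
    t.bil x y = ∑ j : Fin (t.rank + 1), ∑ k : Fin (t.rank + 1), ((t.sym j * t.cartan j k : ℤ) : ℚ) * x j * y k := by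
  rw [bil_apply]
  refine Finset.sum_congr rfl fun j _ => ?_
  rw [coroot_apply, Finset.mul_sum]
  refine Finset.sum_congr rfl fun k _ => ?_
  push_cast; ring

theorem bil_comm (x y : t.V) : t.bil x y = t.bil y x := by
  rw [bil_apply', bil_apply', Finset.sum_comm]
  refine Finset.sum_congr rfl fun j _ => Finset.sum_congr rfl fun k _ => ?_
  rw [sym_mul_cartan]; ring

theorem bil_simpleRoot_left (i : Fin (t.rank + 1)) (x : t.V) :
    t.bil (t.simpleRoot i) x = t.sym i * t.coroot i x := by
  simp [bil_apply, simpleRoot, Pi.single_apply]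

theorem bil_simpleRoot_right (i : Fin (t.rank + 1)) (x : t.V) :
    t.bil x (t.simpleRoot i) = t.sym i * t.coroot i x := by
  rw [bil_comm, bil_simpleRoot_left]

theorem bil_delta_right (x : t.V) : t.bil x t.delta = 0 := by
  simp [bil_apply, coroot_delta]

theorem label_ne_zero (i : Fin (t.rank + 1)) : (t.label i : ℚ) ≠ 0 := by
  exact_mod_cast (t.label_pos i).ne'

theorem bil_self_eq (x : t.V) : t.bil x x = ∑ i : Fin (t.rank + 1), ∑ j : Fin (t.rank + 1),
    ((-(t.sym i * t.cartan i j) : ℤ) : ℚ) * t.label i * t.label j / 2 *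
      (x i / t.label i - x j / t.label j) ^ 2 := by
  have h1 : ∑ i : Fin (t.rank + 1), ∑ j : Fin (t.rank + 1), ((t.sym i * t.cartan i j : ℤ) : ℚ) * t.label i * t.label j *
      (x i / t.label i) ^ 2 = 0 := by
    refine Finset.sum_eq_zero fun i _ => ?_
    have : ∑ j : Fin (t.rank + 1), (t.cartan i j : ℚ) * (t.label j : ℚ) = 0 := by
      exact_mod_cast t.sum_cartan_label i
    calc _ = (t.sym i : ℚ) * t.label i * (x i / t.label i) ^ 2 *
        ∑ j : Fin (t.rank + 1), (t.cartan i j : ℚ) * (t.label j : ℚ) := by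
          rw [Finset.mul_sum]; refine Finset.sum_congr rfl fun j _ => ?_; push_cast; ring
      _ = 0 := by rw [this, mul_zero]
  have h2 : ∑ i : Fin (t.rank + 1), ∑ j : Fin (t.rank + 1), ((t.sym i * t.cartan i j : ℤ) : ℚ) * t.label i * t.label j *
      (x j / t.label j) ^ 2 = 0 := by
    rw [Finset.sum_comm, ← h1]
    refine Finset.sum_congr rfl fun j _ => Finset.sum_congr rfl fun k _ => ?_
    rw [sym_mul_cartan]; ring
  have h3 : ∑ i : Fin (t.rank + 1), ∑ j : Fin (t.rank + 1), ((-(t.sym i * t.cartan i j) : ℤ) : ℚ) * t.label i * t.label j / 2 *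
      (x i / t.label i - x j / t.label j) ^ 2 =
      -(1/2) * ∑ i : Fin (t.rank + 1), ∑ j : Fin (t.rank + 1), ((t.sym i * t.cartan i j : ℤ) : ℚ) * t.label i * t.label j *
      (x i / t.label i) ^ 2 - (1/2) * ∑ i : Fin (t.rank + 1), ∑ j : Fin (t.rank + 1), ((t.sym i * t.cartan i j : ℤ) : ℚ) * t.label i * t.label j *
      (x j / t.label j) ^ 2 + t.bil x x := by
    rw [bil_apply', Finset.mul_sum, Finset.mul_sum, ← Finset.sum_sub_distrib,
      ← Finset.sum_add_distrib]
    refine Finset.sum_congr rfl fun i _ => ?_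
    rw [Finset.mul_sum, Finset.mul_sum, ← Finset.sum_sub_distrib, ← Finset.sum_add_distrib]
    refine Finset.sum_congr rfl fun j _ => ?_
    have := t.label_ne_zero i
    have := t.label_ne_zero j
    push_cast
    field_simp
    ring
  rw [h3, h1, h2]; ring

theorem bil_self_term_nonneg (x : t.V) (i j : Fin (t.rank + 1)) :
    0 ≤ ((-(t.sym i * t.cartan i j) : ℤ) : ℚ) * t.label i * t.label j / 2 *
      (x i / t.label i - x j / t.label j) ^ 2 := by
  rcases eq_or_ne i j with rfl | h
  · simp
  · have h1 : (0 : ℤ) ≤ -(t.sym i * t.cartan i j) := by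
      have := t.cartan_nonpos h
      have := t.sym_pos i
      nlinarith
    have h2 : (0 : ℚ) ≤ ((-(t.sym i * t.cartan i j) : ℤ) : ℚ) := by exact_mod_cast h1
    positivity

theorem bil_self_nonneg (x : t.V) : 0 ≤ t.bil x x := by
  rw [bil_self_eq]
  exact Finset.sum_nonneg fun i _ => Finset.sum_nonneg fun j _ => t.bil_self_term_nonneg x i j

theorem exists_adjacent (j : Fin (t.rank + 1)) : ∃ k, k ≠ j ∧ t.cartan j k ≠ 0 := by
  by_contra h
  push Not at h
  have h1 := t.sum_cartan_label j
  rw [Finset.sum_eq_single j (fun k _ hk => by rw [h k hk, zero_mul]) (by simp), cartan_self] at h1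
  have := t.label_pos j
  omega

theorem eq_smul_delta_of_bil_self (x : t.V) (h : t.bil x x = 0) :
    x = (x 0 / t.label 0) • t.delta := by
  have step : ∀ i j : Fin (t.rank + 1), t.cartan j i ≠ 0 → x i / t.label i = x j / t.label j := by
    intro i j hij
    rw [bil_self_eq] at h
    have h1 := (Finset.sum_eq_zero_iff_of_nonneg fun i _ => Finset.sum_nonneg fun j _ =>
      t.bil_self_term_nonneg x i j).1 h j (Finset.mem_univ _)
    have h2 := (Finset.sum_eq_zero_iff_of_nonneg fun i _ =>
      t.bil_self_term_nonneg x j i).1 h1 i (Finset.mem_univ _)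
    have h3 : ((-(t.sym j * t.cartan j i) : ℤ) : ℚ) ≠ 0 := by
      exact_mod_cast neg_ne_zero.2 (mul_ne_zero (t.sym_pos j).ne' hij)
    have := t.label_ne_zero i
    have := t.label_ne_zero j
    rw [mul_eq_zero, or_iff_right (by positivity), sq_eq_zero_iff, sub_eq_zero] at h2
    exact h2.symm
  have aux : ∀ j, (hj : j ≤ t.rank) →
      x ⟨j, Nat.lt_succ_of_le hj⟩ / t.label j = x 0 / t.label 0 := by
    have := t.node_induction (P := fun j => ∀ hj : j ≤ t.rank,
      x ⟨j, Nat.lt_succ_of_le hj⟩ / t.label j = x 0 / t.label 0) ?_ ?_ ?_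
    · exact fun j hj => this j hj hj
    · exact fun _ => rfl
    · intro i j hi hj _ _ ha hP _
      rw [← hP hi]
      refine (step ⟨i, Nat.lt_succ_of_le hi⟩ ⟨j, Nat.lt_succ_of_le hj⟩ ?_).symm
      rw [cartan_eq_entry]; simp only; rw [ha]; norm_num
    · intro j hj _ hP _
      obtain ⟨k, hk, hk'⟩ := t.exists_adjacent ⟨j, Nat.lt_succ_of_le hj⟩
      have hkj : (k : ℕ) ≠ j := fun h => hk (Fin.ext h)
      have := hP k (Nat.lt_succ_iff.1 k.2) hkj (Nat.lt_succ_iff.1 k.2)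
      rw [← this]
      exact (step _ _ hk').symm
  ext j
  have := aux j (Nat.lt_succ_iff.1 j.2)
  rw [Pi.smul_apply, ← this, delta, smul_eq_mul, div_mul_cancel₀ _ (t.label_ne_zero j)]

theorem eq_zero_of_bil_self (x : t.V) (h : t.bil x x = 0) (h0 : x 0 = 0) : x = 0 := by
  rw [t.eq_smul_delta_of_bil_self x h, h0, zero_div, zero_smul]

/-! ### Simple reflections and the affine Weyl group -/

theorem coroot_simpleRoot_self (i : Fin (t.rank + 1)) : t.coroot i (t.simpleRoot i) = 2 := by
  rw [coroot_simpleRoot, cartan_self]; norm_num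

/-- The simple reflection as an automorphism. -/
def s (i : Fin (t.rank + 1)) : t.V ≃ₗ[ℚ] t.V := Module.reflection (t.coroot_simpleRoot_self i)

theorem s_apply (i : Fin (t.rank + 1)) (x : t.V) :
    t.s i x = x - t.coroot i x • t.simpleRoot i := Module.reflection_apply _ _

theorem s_mul_s (i : Fin (t.rank + 1)) : t.s i * t.s i = 1 := by
  ext1 x; exact Module.involutive_reflection (t.coroot_simpleRoot_self i) x

theorem s_inv (i : Fin (t.rank + 1)) : (t.s i)⁻¹ = t.s i :=
  inv_eq_of_mul_eq_one_left (t.s_mul_s i)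

theorem s_s_apply (i : Fin (t.rank + 1)) (x : t.V) : t.s i (t.s i x) = x :=
  Module.involutive_reflection (t.coroot_simpleRoot_self i) x

theorem s_simpleRoot_self (i : Fin (t.rank + 1)) : t.s i (t.simpleRoot i) = -t.simpleRoot i := by
  rw [s_apply, coroot_simpleRoot_self, two_smul]; abel

theorem s_delta (i : Fin (t.rank + 1)) : t.s i t.delta = t.delta := by
  rw [s_apply, coroot_delta, zero_smul, sub_zero]

theorem s_apply_of_ne {i k : Fin (t.rank + 1)} (h : k ≠ i) (x : t.V) : t.s i x k = x k := by
  simp [s_apply, simpleRoot, h]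

theorem bil_s (i : Fin (t.rank + 1)) (x y : t.V) : t.bil (t.s i x) (t.s i y) = t.bil x y := by
  simp only [s_apply, map_sub, LinearMap.sub_apply, map_smul, LinearMap.smul_apply,
    bil_simpleRoot_left, bil_simpleRoot_right, coroot_simpleRoot_self, smul_eq_mul]
  ring

/-- The affine Weyl group. -/
def W : Subgroup (t.V ≃ₗ[ℚ] t.V) := Subgroup.closure (Set.range t.s)

theorem s_mem_W (i : Fin (t.rank + 1)) : t.s i ∈ t.W := Subgroup.subset_closure ⟨i, rfl⟩

theorem W_induction {P : (t.V ≃ₗ[ℚ] t.V) → Prop} (h1 : P 1) (hs : ∀ i x, x ∈ t.W → P x → P (t.s i * x))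
    {x : t.V ≃ₗ[ℚ] t.V} (hx : x ∈ t.W) : P x := by
  induction hx using Subgroup.closure_induction_left with
  | one => exact h1
  | mul_left x hx y hy ih => obtain ⟨i, rfl⟩ := hx; exact hs i y hy ih
  | inv_mul_cancel x hx y hy ih => obtain ⟨i, rfl⟩ := hx; rw [s_inv]; exact hs i y hy ih

theorem W_delta {x : t.V ≃ₗ[ℚ] t.V} (hx : x ∈ t.W) : x t.delta = t.delta :=
  t.W_induction (P := fun x => x t.delta = t.delta) rfl
    (fun i y _ ih => by rw [LinearEquiv.mul_apply, ih, s_delta]) hx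

theorem W_bil {x : t.V ≃ₗ[ℚ] t.V} (hx : x ∈ t.W) (u v : t.V) : t.bil (x u) (x v) = t.bil u v :=
  t.W_induction (P := fun x => t.bil (x u) (x v) = t.bil u v) rfl
    (fun i y _ ih => by rw [LinearEquiv.mul_apply, LinearEquiv.mul_apply, bil_s, ih]) hx

/-- Integral vectors `v` such that `d_k v_k` is divisible by `d` for all `k`. -/
def lat (d : ℤ) : AddSubgroup t.V where
  carrier := {v | (∀ k : Fin (t.rank + 1), ∃ z : ℤ, v k = z) ∧ ∀ k : Fin (t.rank + 1), ∃ z : ℤ, t.sym k * v k = d * z}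
  zero_mem' := ⟨fun _ => ⟨0, by simp⟩, fun _ => ⟨0, by simp⟩⟩
  add_mem' := by
    rintro x y ⟨hx, hx'⟩ ⟨hy, hy'⟩
    refine ⟨fun k => ?_, fun k => ?_⟩
    · obtain ⟨a, ha⟩ := hx k
      obtain ⟨b, hb⟩ := hy k
      exact ⟨a + b, by simp [ha, hb]⟩
    · obtain ⟨a, ha⟩ := hx' k
      obtain ⟨b, hb⟩ := hy' k
      exact ⟨a + b, by simp [mul_add, ha, hb]⟩
  neg_mem' := by
    rintro x ⟨hx, hx'⟩
    refine ⟨fun k => ?_, fun k => ?_⟩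
    · obtain ⟨a, ha⟩ := hx k
      exact ⟨-a, by simp [ha]⟩
    · obtain ⟨a, ha⟩ := hx' k
      exact ⟨-a, by simp [ha]⟩

theorem mem_lat {d : ℤ} {v : t.V} : v ∈ t.lat d ↔
    (∀ k : Fin (t.rank + 1), ∃ z : ℤ, v k = z) ∧ ∀ k : Fin (t.rank + 1), ∃ z : ℤ, (t.sym k : ℚ) * v k = d * z := Iff.rfl

theorem simpleRoot_mem_lat (i : Fin (t.rank + 1)) : t.simpleRoot i ∈ t.lat (t.sym i) := by
  refine t.mem_lat.2 ⟨fun k => ?_, fun k => ?_⟩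
  · rcases eq_or_ne k i with rfl | h
    · exact ⟨1, by simp [simpleRoot]⟩
    · exact ⟨0, by simp [simpleRoot, h]⟩
  · rcases eq_or_ne k i with rfl | h
    · exact ⟨1, by simp [simpleRoot]⟩
    · exact ⟨0, by simp [simpleRoot, h]⟩

theorem exists_sum_int {ι : Type*} (S : Finset ι) (f : ι → ℚ) (c : ℚ)
    (h : ∀ i ∈ S, ∃ z : ℤ, f i = c * z) : ∃ z : ℤ, ∑ i ∈ S, f i = c * z := by
  classical
  induction S using Finset.induction_on with
  | empty => exact ⟨0, by simp⟩
  | insert a S ha ih =>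
    obtain ⟨z, hz⟩ := ih fun i hi => h i (Finset.mem_insert_of_mem hi)
    obtain ⟨y, hy⟩ := h a (Finset.mem_insert_self _ _)
    exact ⟨y + z, by rw [Finset.sum_insert ha, hy, hz]; push_cast; ring⟩

theorem exists_coroot_int {d : ℤ} {v : t.V} (hv : v ∈ t.lat d) (i : Fin (t.rank + 1)) :
    ∃ z : ℤ, t.coroot i v = z := by
  obtain ⟨z, hz⟩ := exists_sum_int Finset.univ (fun j => (t.cartan i j : ℚ) * v j) 1 fun j _ => by
    obtain ⟨z, hz⟩ := (t.mem_lat.1 hv).1 j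
    exact ⟨t.cartan i j * z, by rw [hz]; push_cast; ring⟩
  exact ⟨z, by rw [coroot_apply, hz, one_mul]⟩

theorem exists_sym_mul_coroot {d : ℤ} {v : t.V} (hv : v ∈ t.lat d) (i : Fin (t.rank + 1)) :
    ∃ z : ℤ, (t.sym i : ℚ) * t.coroot i v = d * z := by
  rw [coroot_apply, Finset.mul_sum]
  refine exists_sum_int _ _ _ fun j _ => ?_
  obtain ⟨z, hz⟩ := (t.mem_lat.1 hv).2 j
  refine ⟨t.cartan j i * z, ?_⟩
  have : (t.sym i : ℚ) * t.cartan i j = t.sym j * t.cartan j i := by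
    exact_mod_cast t.sym_mul_cartan i j
  rw [← mul_assoc, this]
  push_cast
  linear_combination (t.cartan j i : ℚ) * hz

theorem s_mem_lat {d : ℤ} {v : t.V} (hv : v ∈ t.lat d) (i : Fin (t.rank + 1)) :
    t.s i v ∈ t.lat d := by
  refine t.mem_lat.2 ⟨fun k => ?_, fun k => ?_⟩
  · obtain ⟨a, ha⟩ := (t.mem_lat.1 hv).1 k
    rcases eq_or_ne k i with rfl | h
    · obtain ⟨b, hb⟩ := t.exists_coroot_int hv k
      exact ⟨a - b, by simp [s_apply, simpleRoot, ha, hb]⟩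
    · exact ⟨a, by rw [s_apply_of_ne t h, ha]⟩
  · obtain ⟨a, ha⟩ := (t.mem_lat.1 hv).2 k
    rcases eq_or_ne k i with rfl | h
    · obtain ⟨b, hb⟩ := t.exists_sym_mul_coroot hv k
      exact ⟨a - b, by simp [s_apply, simpleRoot, mul_sub, ha, hb]⟩
    · exact ⟨a, by rw [s_apply_of_ne t h, ha]⟩

theorem W_mem_lat {d : ℤ} {v : t.V} (hv : v ∈ t.lat d) {x : t.V ≃ₗ[ℚ] t.V} (hx : x ∈ t.W) :
    x v ∈ t.lat d :=
  t.W_induction (P := fun x => x v ∈ t.lat d) hv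
    (fun i y _ ih => by rw [LinearEquiv.mul_apply]; exact t.s_mem_lat ih i) hx

theorem exists_bil_self {d : ℤ} {v : t.V} (hv : v ∈ t.lat d) :
    ∃ z : ℤ, t.bil v v = 2 * d * z := by
  have hs : ∀ k, v k • t.simpleRoot k ∈ t.lat d := by
    intro k
    refine t.mem_lat.2 ⟨fun j => ?_, fun j => ?_⟩ <;> rcases eq_or_ne j k with rfl | h
    · simpa [simpleRoot] using (t.mem_lat.1 hv).1 j
    · exact ⟨0, by simp [simpleRoot, h]⟩
    · simpa [simpleRoot] using (t.mem_lat.1 hv).2 j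
    · exact ⟨0, by simp [simpleRoot, h]⟩
  have aux : ∀ S : Finset (Fin (t.rank + 1)), ∃ z : ℤ,
      t.bil (∑ k ∈ S, v k • t.simpleRoot k) (∑ k ∈ S, v k • t.simpleRoot k) = 2 * d * z := by
    intro S
    induction S using Finset.induction_on with
    | empty => exact ⟨0, by simp⟩
    | insert a S ha ih =>
      obtain ⟨z, hz⟩ := ih
      obtain ⟨y, hy⟩ := (t.mem_lat.1 hv).2 a
      obtain ⟨q, hq⟩ := (t.mem_lat.1 hv).1 a
      obtain ⟨p, hp⟩ := t.exists_coroot_int (sum_mem fun k (_ : k ∈ S) => hs k) a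
      refine ⟨y * q + y * p + z, ?_⟩
      rw [Finset.sum_insert ha]
      generalize ∑ k ∈ S, v k • t.simpleRoot k = u at hz hp
      have e : t.bil (v a • t.simpleRoot a + u) (v a • t.simpleRoot a + u) =
          t.bil (v a • t.simpleRoot a) (v a • t.simpleRoot a) +
          2 * t.bil (v a • t.simpleRoot a) u + t.bil u u := by
        simp only [map_add, LinearMap.add_apply]
        rw [t.bil_comm u]; ring
      rw [e, hz]
      simp only [map_smul, LinearMap.smul_apply, bil_simpleRoot_left, coroot_simpleRoot_self, hp,
        smul_eq_mul]
      push_cast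
      rw [hq] at hy ⊢
      linear_combination (2 * (q : ℚ) + 2 * p) * hy
  obtain ⟨z, hz⟩ := aux Finset.univ
  have : ∑ k, v k • t.simpleRoot k = v := by
    ext j; simp [simpleRoot, Finset.sum_apply, Pi.single_apply]
  rw [this] at hz
  exact ⟨z, hz⟩

/-! ### Positivity -/

/-- Nonzero with nonnegative coordinates. -/
def Pos (v : t.V) : Prop := v ≠ 0 ∧ ∀ k, 0 ≤ v k

variable {t}

theorem Pos.not_neg {v : t.V} (h : t.Pos v) : ¬ t.Pos (-v) := fun h' =>
  h.1 (funext fun k => le_antisymm (by have := h'.2 k; simpa using this) (h.2 k))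

theorem Pos.add {v w : t.V} (h : t.Pos v) (h' : t.Pos w) : t.Pos (v + w) := by
  refine ⟨fun h0 => h.1 (funext fun k => ?_), fun k => add_nonneg (h.2 k) (h'.2 k)⟩
  have : v k + w k = 0 := congrFun h0 k
  have := h.2 k
  have := h'.2 k
  simp only [Pi.zero_apply]; linarith

theorem Pos.smul {v : t.V} (h : t.Pos v) {c : ℚ} (hc : 0 < c) : t.Pos (c • v) :=
  ⟨smul_ne_zero hc.ne' h.1, fun k => mul_nonneg hc.le (h.2 k)⟩

theorem Pos.of_smul {v : t.V} {c : ℚ} (hc : 0 < c) (h : t.Pos (c • v)) : t.Pos v := by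
  simpa [smul_smul, inv_mul_cancel₀ hc.ne'] using h.smul (inv_pos.2 hc)

variable (t)

theorem pos_simpleRoot (i : Fin (t.rank + 1)) : t.Pos (t.simpleRoot i) := by
  refine ⟨fun h => ?_, fun k => ?_⟩
  · have := congrFun h i
    simp [simpleRoot] at this
  · simp only [simpleRoot, Pi.single_apply]; split_ifs <;> norm_num

theorem bil_nonpos_of_disjoint {v w : t.V} (hv : ∀ k, 0 ≤ v k) (hw : ∀ k, 0 ≤ w k)
    (h : ∀ k, v k * w k = 0) : t.bil v w ≤ 0 := by
  rw [bil_apply']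
  refine Finset.sum_nonpos fun j _ => Finset.sum_nonpos fun k _ => ?_
  rcases eq_or_ne j k with rfl | hjk
  · rw [mul_assoc, h, mul_zero]
  · have h1 : ((t.sym j * t.cartan j k : ℤ) : ℚ) ≤ 0 := by
      have := t.cartan_nonpos hjk
      have := t.sym_pos j
      have : t.sym j * t.cartan j k ≤ 0 := by nlinarith
      exact_mod_cast this
    have := mul_nonneg (hv j) (hw k)
    rw [mul_assoc]
    exact mul_nonpos_of_nonpos_of_nonneg h1 this

theorem le_bil_self {d : ℤ} (hd : 0 < d) {v : t.V} (hv : v ∈ t.lat d) (h : t.bil v v ≠ 0) :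
    2 * (d : ℚ) ≤ t.bil v v := by
  obtain ⟨z, hz⟩ := t.exists_bil_self hv
  have h0 := t.bil_self_nonneg v
  have hd' : (0 : ℚ) < d := by exact_mod_cast hd
  have hz0 : (0 : ℚ) < z := by
    by_contra hz0
    push Not at hz0
    apply h
    refine le_antisymm ?_ h0
    rw [hz]; nlinarith
  have : (1 : ℚ) ≤ z := by
    have : 0 < z := by exact_mod_cast hz0
    exact_mod_cast this
  rw [hz]; nlinarith

/-- A lattice vector of minimal norm does not have coordinates of both signs. -/
theorem pos_or_pos_neg {d : ℤ} (hd : 0 < d) {v : t.V} (hv : v ∈ t.lat d) (h : t.bil v v = 2 * d) :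
    t.Pos v ∨ t.Pos (-v) := by
  set p : t.V := fun k => max (v k) 0 with hp
  set q : t.V := fun k => max (-v k) 0 with hq
  have hvpq : v = p - q := by
    ext k
    simp only [hp, hq, Pi.sub_apply]
    rcases le_total 0 (v k) with h' | h'
    · rw [max_eq_left h', max_eq_right (by linarith), sub_zero]
    · rw [max_eq_right h', max_eq_left (by linarith)]; ring
  have hdis : ∀ k, p k * q k = 0 := by
    intro k
    simp only [hp, hq]
    rcases le_total 0 (v k) with h' | h'
    · rw [max_eq_right (a := -v k) (by linarith), mul_zero]
    · rw [max_eq_right h', zero_mul]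
  have hp0 : ∀ k, 0 ≤ p k := fun k => le_max_right _ _
  have hq0 : ∀ k, 0 ≤ q k := fun k => le_max_right _ _
  have hpl : p ∈ t.lat d := by
    refine t.mem_lat.2 ⟨fun k => ?_, fun k => ?_⟩ <;> simp only [hp] <;>
      rcases le_total 0 (v k) with h' | h'
    · rw [max_eq_left h']; exact (t.mem_lat.1 hv).1 k
    · rw [max_eq_right h']; exact ⟨0, by simp⟩
    · rw [max_eq_left h']; exact (t.mem_lat.1 hv).2 k
    · rw [max_eq_right h']; exact ⟨0, by simp⟩
  have hql : q ∈ t.lat d := by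
    have : q = p - v := by rw [hvpq]; abel
    rw [this]; exact sub_mem hpl hv
  have full : ∀ {a b : t.V}, (∀ k, a k * b k = 0) → a ≠ 0 → b ≠ 0 → t.bil a a ≠ 0 := by
    intro a b hab ha hb h0
    have := t.eq_smul_delta_of_bil_self a h0
    refine hb (funext fun k => ?_)
    have hc : a 0 / t.label 0 ≠ 0 := by
      intro hc; rw [hc, zero_smul] at this; exact ha this
    have hk : a k ≠ 0 := by
      rw [this]; exact mul_ne_zero hc (t.label_ne_zero k)
    exact (mul_eq_zero.1 (hab k)).resolve_left hk
  by_cases hq' : q = 0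
  · left
    refine ⟨?_, fun k => ?_⟩
    · rintro rfl
      have : (d : ℚ) = 0 := by simpa using h
      exact hd.ne' (by exact_mod_cast this)
    · rw [hvpq, hq', sub_zero]; exact hp0 k
  by_cases hp' : p = 0
  · right
    rw [hvpq, hp', zero_sub, neg_neg]
    exact ⟨hq', hq0⟩
  exfalso
  have h1 := t.le_bil_self hd hpl (full hdis hp' hq')
  have h2 := t.le_bil_self hd hql (full (fun k => by rw [mul_comm]; exact hdis k) hq' hp')
  have h3 := t.bil_nonpos_of_disjoint hp0 hq0 hdis
  rw [hvpq] at h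
  simp only [map_sub, LinearMap.sub_apply] at h
  rw [t.bil_comm q p] at h
  have hd' : (0 : ℚ) < d := by exact_mod_cast hd
  linarith

/-- The real roots. -/
def IsRoot (v : t.V) : Prop := ∃ x ∈ t.W, ∃ i, v = x (t.simpleRoot i)

variable {t}

theorem isRoot_simpleRoot (i : Fin (t.rank + 1)) : t.IsRoot (t.simpleRoot i) :=
  ⟨1, one_mem _, i, rfl⟩

theorem IsRoot.map {v : t.V} (h : t.IsRoot v) {x : t.V ≃ₗ[ℚ] t.V} (hx : x ∈ t.W) :
    t.IsRoot (x v) := by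
  obtain ⟨y, hy, i, rfl⟩ := h
  exact ⟨x * y, mul_mem hx hy, i, rfl⟩

theorem IsRoot.neg {v : t.V} (h : t.IsRoot v) : t.IsRoot (-v) := by
  obtain ⟨y, hy, i, rfl⟩ := h
  exact ⟨y * t.s i, mul_mem hy (t.s_mem_W i), i, by
    rw [LinearEquiv.mul_apply, s_simpleRoot_self, map_neg]⟩

theorem IsRoot.exists_norm {v : t.V} (h : t.IsRoot v) :
    ∃ j : Fin (t.rank + 1), v ∈ t.lat (t.sym j) ∧ t.bil v v = 2 * t.sym j := by
  obtain ⟨y, hy, j, rfl⟩ := h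
  refine ⟨j, t.W_mem_lat (t.simpleRoot_mem_lat j) hy, ?_⟩
  rw [W_bil t hy, bil_simpleRoot_left, coroot_simpleRoot_self, mul_comm]

theorem IsRoot.pos_or {v : t.V} (h : t.IsRoot v) : t.Pos v ∨ t.Pos (-v) := by
  obtain ⟨j, hj, hj'⟩ := h.exists_norm
  exact t.pos_or_pos_neg (t.sym_pos j) hj hj'

theorem IsRoot.pos_of_coord {v : t.V} (h : t.IsRoot v) {k : Fin (t.rank + 1)} (hk : 0 < v k) :
    t.Pos v :=
  h.pos_or.resolve_right fun h' => by have := h'.2 k; simp at this; linarith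

theorem IsRoot.pos_neg_iff {v : t.V} (h : t.IsRoot v) : t.Pos (-v) ↔ ¬ t.Pos v :=
  ⟨fun h1 h2 => h2.not_neg h1, fun h1 => h.pos_or.resolve_left h1⟩

/-- A vector of minimal norm proportional to a simple root is plus or minus that root. -/
theorem eq_one_of_smul_mem_lat {i : Fin (t.rank + 1)} {c : ℚ} {d : ℤ}
    (hj : c • t.simpleRoot i ∈ t.lat d)
    (hj' : t.bil (c • t.simpleRoot i) (c • t.simpleRoot i) = 2 * d) (hc : 0 < c) : c = 1 := by
  simp only [map_smul, LinearMap.smul_apply, bil_simpleRoot_left, coroot_simpleRoot_self,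
    smul_eq_mul] at hj'
  obtain ⟨z, hz⟩ := (t.mem_lat.1 hj).1 i
  obtain ⟨y, hy⟩ := (t.mem_lat.1 hj).2 i
  simp only [simpleRoot, Pi.smul_apply, Pi.single_eq_same, smul_eq_mul, mul_one] at hz hy
  have h1 : (d : ℚ) = c * c * t.sym i := by linarith
  have hi : (t.sym i : ℚ) ≠ 0 := by exact_mod_cast (t.sym_pos i).ne'
  have h2 : c * (y : ℚ) = 1 := by
    have : (t.sym i : ℚ) * c * (c * y - 1) = 0 := by
      rw [h1] at hy; linear_combination -hy
    have h3 : (t.sym i : ℚ) * c ≠ 0 := mul_ne_zero hi hc.ne'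
    have := (mul_eq_zero.1 this).resolve_left h3
    linarith
  rw [hz] at h2 hc ⊢
  have h3 : z * y = 1 := by exact_mod_cast h2
  have h4 : 0 < z := by exact_mod_cast hc
  have : z = 1 := by
    rcases Int.eq_one_or_neg_one_of_mul_eq_one h3 with h | h <;> omega
  exact_mod_cast this

theorem IsRoot.eq_of_smul {i : Fin (t.rank + 1)} {c : ℚ} (h : t.IsRoot (c • t.simpleRoot i))
    (hc : 0 < c) : c = 1 := by
  obtain ⟨j, hj, hj'⟩ := h.exists_norm
  exact eq_one_of_smul_mem_lat hj hj' hc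

/-- `s_i` permutes the positive roots different from `α_i`. -/
theorem IsRoot.pos_s {v : t.V} (h : t.IsRoot v) (hp : t.Pos v) {i : Fin (t.rank + 1)}
    (hv : v ≠ t.simpleRoot i) : t.Pos (t.s i v) := by
  by_cases h' : ∃ k, k ≠ i ∧ v k ≠ 0
  · obtain ⟨k, hk, hk'⟩ := h'
    refine (h.map (t.s_mem_W i)).pos_of_coord (k := k) ?_
    rw [s_apply_of_ne t hk]
    exact lt_of_le_of_ne (hp.2 k) hk'.symm
  · push Not at h'
    exfalso
    have hvi : v = v i • t.simpleRoot i := by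
      ext k
      rcases eq_or_ne k i with rfl | hk
      · simp [simpleRoot]
      · simp [simpleRoot, hk, h' k hk]
    have hc : 0 < v i := by
      refine lt_of_le_of_ne (hp.2 i) fun h0 => hp.1 ?_
      rw [hvi, ← h0, zero_smul]
    rw [hvi] at h
    have := h.eq_of_smul hc
    rw [this, one_smul] at hvi
    exact hv hvi

/-- A conjugate of a simple reflection is determined by the image of the simple root. -/
theorem conj_s {x : t.V ≃ₗ[ℚ] t.V} (hx : x ∈ t.W) {i j : Fin (t.rank + 1)}
    (h : x (t.simpleRoot i) = t.simpleRoot j) : x * t.s i = t.s j * x := by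
  ext1 v
  have hd : (t.sym i : ℚ) = t.sym j := by
    have h1 := W_bil t hx (t.simpleRoot i) (t.simpleRoot i)
    rw [h, bil_simpleRoot_left, bil_simpleRoot_left, coroot_simpleRoot_self,
      coroot_simpleRoot_self] at h1
    linarith
  have hj : (t.sym j : ℚ) ≠ 0 := by exact_mod_cast (t.sym_pos j).ne'
  have h2 : t.coroot i v = t.coroot j (x v) := by
    have h1 := W_bil t hx (t.simpleRoot i) v
    rw [h, bil_simpleRoot_left, bil_simpleRoot_left, hd] at h1
    exact (mul_left_cancel₀ hj h1).symm
  rw [LinearEquiv.mul_apply, LinearEquiv.mul_apply, s_apply, s_apply, map_sub, map_smul, h, h2]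

end AffineType
end TripleArtin

namespace TripleArtin

/-- The alternating word `i j i ⋯` with `k` letters. -/
def altWord {α : Type*} : ℕ → α → α → List α
  | 0, _, _ => []
  | k + 1, i, j => i :: altWord k j i

theorem length_altWord {α : Type*} (k : ℕ) (i j : α) : (altWord k i j).length = k := by
  induction k generalizing i j with
  | zero => rfl
  | succ k ih => simp [altWord, ih]

theorem prod_map_altWord {α G : Type*} [Group G] (f : α → G) (k : ℕ) (i j : α) :
    ((altWord k i j).map f).prod = alternating k (f i) (f j) := by
  induction k generalizing i j with
  | zero => rfl
  | succ k ih => simp [altWord, alternating, ih]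

namespace AffineType

variable (t : AffineType)

/-- The product of the simple reflections of a word. -/
def wordProd (w : List (Fin (t.rank + 1))) : t.V ≃ₗ[ℚ] t.V := (w.map t.s).prod

@[simp] theorem wordProd_nil : t.wordProd [] = 1 := rfl

@[simp] theorem wordProd_cons (i : Fin (t.rank + 1)) (w : List (Fin (t.rank + 1))) :
    t.wordProd (i :: w) = t.s i * t.wordProd w := by simp [wordProd]

theorem wordProd_append (v w : List (Fin (t.rank + 1))) :
    t.wordProd (v ++ w) = t.wordProd v * t.wordProd w := by simp [wordProd]

theorem wordProd_mem_W (w : List (Fin (t.rank + 1))) : t.wordProd w ∈ t.W := by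
  induction w with
  | nil => exact one_mem _
  | cons i w ih => rw [wordProd_cons]; exact mul_mem (t.s_mem_W i) ih

/-- Reduced words, through the positivity of the roots they define. -/
def Red : List (Fin (t.rank + 1)) → Prop
  | [] => True
  | i :: w => Red w ∧ t.Pos ((t.wordProd w)⁻¹ (t.simpleRoot i))

variable {t}

theorem inv_root {x : t.V ≃ₗ[ℚ] t.V} (hx : x ∈ t.W) (i : Fin (t.rank + 1)) :
    t.IsRoot (x⁻¹ (t.simpleRoot i)) := (isRoot_simpleRoot i).map (inv_mem hx)

theorem aut_inv_apply (x : t.V ≃ₗ[ℚ] t.V) (v : t.V) : x⁻¹ (x v) = v := x.symm_apply_apply v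

theorem aut_apply_inv (x : t.V ≃ₗ[ℚ] t.V) (v : t.V) : x (x⁻¹ v) = v := x.apply_symm_apply v

theorem inv_s_mul_apply (x : t.V ≃ₗ[ℚ] t.V) (i : Fin (t.rank + 1)) (v : t.V) :
    (t.s i * x)⁻¹ v = x⁻¹ (t.s i v) := by
  rw [mul_inv_rev, s_inv, LinearEquiv.mul_apply]

theorem exchange_aux (w : List (Fin (t.rank + 1))) :
    ∀ y ∈ t.W, ∀ i, t.Pos (y (t.simpleRoot i)) →
      ¬ t.Pos ((t.wordProd w)⁻¹ (y (t.simpleRoot i))) →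
      ∃ w', w'.Sublist w ∧ w'.length + 1 = w.length ∧
        t.wordProd w = y * t.s i * y⁻¹ * t.wordProd w' := by
  induction w with
  | nil =>
    intro y _ i hp hn
    rw [wordProd_nil, inv_one] at hn
    exact absurd hp hn
  | cons j u ih =>
    intro y hy i hp hn
    by_cases hj : y (t.simpleRoot i) = t.simpleRoot j
    · refine ⟨u, List.sublist_cons_self _ _, rfl, ?_⟩
      rw [conj_s hy hj, mul_inv_cancel_right, wordProd_cons]
    · have h1 : t.Pos ((t.s j * y) (t.simpleRoot i)) :=
        ((isRoot_simpleRoot i).map hy).pos_s hp hj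
      rw [wordProd_cons, inv_s_mul_apply] at hn
      obtain ⟨w', h2, h3, h4⟩ := ih (t.s j * y) (mul_mem (t.s_mem_W j) hy) i h1 hn
      refine ⟨j :: w', h2.cons_cons j, by simp [h3], ?_⟩
      rw [wordProd_cons, wordProd_cons, h4, mul_inv_rev, s_inv]
      simp only [← mul_assoc]
      rw [s_mul_s, one_mul]

theorem exchange (w : List (Fin (t.rank + 1))) (i : Fin (t.rank + 1))
    (h : ¬ t.Pos ((t.wordProd w)⁻¹ (t.simpleRoot i))) :
    ∃ w', w'.Sublist w ∧ w'.length + 1 = w.length ∧ t.s i * t.wordProd w = t.wordProd w' := by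
  obtain ⟨w', h1, h2, h3⟩ := exchange_aux w 1 (one_mem _) i (t.pos_simpleRoot i) h
  refine ⟨w', h1, h2, ?_⟩
  rw [h3, inv_one, mul_one, one_mul, ← mul_assoc, s_mul_s, one_mul]

theorem exists_red (w : List (Fin (t.rank + 1))) :
    ∃ w', w'.Sublist w ∧ t.Red w' ∧ t.wordProd w' = t.wordProd w := by
  induction hn : w.length using Nat.strong_induction_on generalizing w with
  | _ n ih =>
  cases w with
  | nil => exact ⟨[], List.Sublist.refl _, trivial, rfl⟩
  | cons i u =>
    rw [List.length_cons] at hn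
    obtain ⟨u', h1, h2, h3⟩ := ih u.length (by omega) u rfl
    by_cases hp : t.Pos ((t.wordProd u')⁻¹ (t.simpleRoot i))
    · exact ⟨i :: u', h1.cons_cons i, ⟨h2, hp⟩, by rw [wordProd_cons, wordProd_cons, h3]⟩
    · obtain ⟨v, h4, h5, h6⟩ := exchange u' i hp
      have := h1.length_le
      obtain ⟨v', h7, h8, h9⟩ := ih v.length (by omega) v rfl
      refine ⟨v', (h7.trans (h4.trans h1)).trans (List.sublist_cons_self _ _), h8, ?_⟩
      rw [h9, ← h6, wordProd_cons, h3]

theorem exists_wordProd {x : t.V ≃ₗ[ℚ] t.V} (hx : x ∈ t.W) : ∃ w, t.wordProd w = x :=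
  t.W_induction (P := fun x => ∃ w, t.wordProd w = x) ⟨[], rfl⟩
    (fun i _ _ ⟨w, hw⟩ => ⟨i :: w, by rw [wordProd_cons, hw]⟩) hx

theorem exists_red_of_mem {x : t.V ≃ₗ[ℚ] t.V} (hx : x ∈ t.W) :
    ∃ w, t.Red w ∧ t.wordProd w = x := by
  obtain ⟨w, rfl⟩ := exists_wordProd hx
  obtain ⟨w', _, h⟩ := exists_red w
  exact ⟨w', h⟩

/-! ### Rank two -/

theorem s_left (i j : Fin (t.rank + 1)) (p q : ℚ) :
    t.s i (p • t.simpleRoot i + q • t.simpleRoot j) =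
      (-p - t.cartan i j * q) • t.simpleRoot i + q • t.simpleRoot j := by
  rw [s_apply, map_add, map_smul, map_smul, coroot_simpleRoot_self, coroot_simpleRoot,
    smul_eq_mul, smul_eq_mul]
  module

theorem s_right (i j : Fin (t.rank + 1)) (p q : ℚ) :
    t.s j (p • t.simpleRoot i + q • t.simpleRoot j) =
      p • t.simpleRoot i + (-q - t.cartan j i * p) • t.simpleRoot j := by
  rw [add_comm (p • _), s_left, add_comm]

theorem braidLength_comm (i j : Fin (t.rank + 1)) : t.braidLength i j = t.braidLength j i := by
  rw [braidLength, braidLength, laces, laces, mul_comm]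

theorem cartan_cases {i j : Fin (t.rank + 1)} (h : i ≠ j) :
    (t.cartan i j = 0 ∧ t.cartan j i = 0) ∨ (t.cartan i j = -1 ∧ t.cartan j i = -1) ∨
    (t.cartan i j = -1 ∧ t.cartan j i = -2) ∨ (t.cartan i j = -2 ∧ t.cartan j i = -1) ∨
    (t.cartan i j = -1 ∧ t.cartan j i = -3) ∨ (t.cartan i j = -3 ∧ t.cartan j i = -1) ∨
    (t.cartan i j * t.cartan j i = 4 ∧ t.rank = 1) := by
  rw [cartan_eq_entry, cartan_eq_entry]
  exact t.rank_two_cases (Nat.lt_succ_iff.1 i.2) (Nat.lt_succ_iff.1 j.2) fun h' => h (Fin.ext h')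

theorem rank_two {i j : Fin (t.rank + 1)} (h : i ≠ j) (hm : t.braidLength i j ≠ 0) :
    t.wordProd (altWord (t.braidLength i j) i j) = t.wordProd (altWord (t.braidLength i j) j i) ∧
    (∀ k < t.braidLength i j, ∃ p q : ℚ, 0 ≤ p ∧ 0 ≤ q ∧ 0 < p + q ∧
      (t.wordProd (altWord k j i))⁻¹ (t.simpleRoot i) =
        p • t.simpleRoot i + q • t.simpleRoot j) ∧
    (t.wordProd (altWord (t.braidLength i j) i j) (t.simpleRoot i) = -t.simpleRoot i ∨
      t.wordProd (altWord (t.braidLength i j) i j) (t.simpleRoot i) = -t.simpleRoot j) := by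
  obtain ⟨E, hE⟩ : ∃ E : ℚ → ℚ → t.V,
      ∀ p q, E p q = p • t.simpleRoot i + q • t.simpleRoot j := ⟨_, fun _ _ => rfl⟩
  have hi : t.simpleRoot i = E 1 0 := by simp [hE]
  have hj : t.simpleRoot j = E 0 1 := by simp [hE]
  have hn : ∀ p q, -E p q = E (-p) (-q) := by intro p q; rw [hE, hE]; module
  have sl : ∀ p q, t.s i (E p q) = E (-p - t.cartan i j * q) q := by
    intro p q; rw [hE, hE, s_left]
  have sr : ∀ p q, t.s j (E p q) = E p (-q - t.cartan j i * p) := by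
    intro p q; rw [hE, hE, s_right]
  have fin : ∀ {p q : ℚ}, 0 ≤ p → 0 ≤ q → 0 < p + q →
      ∃ p' q' : ℚ, 0 ≤ p' ∧ 0 ≤ q' ∧ 0 < p' + q' ∧ E p q = E p' q' :=
    fun h1 h2 h3 => ⟨_, _, h1, h2, h3, rfl⟩
  have mem := t.s_mem_W
  simp only [← hE]
  rcases cartan_cases h with h' | h' | h' | h' | h' | h' | ⟨h', _⟩
  case inr.inr.inr.inr.inr.inr =>
    exact absurd (by simp [braidLength, laces, h']) hm
  all_goals
    obtain ⟨ha, hb⟩ := h'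
    simp only [ha, hb] at sl sr
    have hm' : t.braidLength i j = t.braidLength i j := rfl
    conv_rhs at hm' => simp only [braidLength, laces, ha, hb]
    norm_num at hm'
    rw [hm']
    refine ⟨?_, ?_, ?_⟩
  case inl.refine_1 =>
    have e : t.s i (t.simpleRoot j) = t.simpleRoot j := by rw [hj]; norm_num [sl, sr]
    simpa [altWord, mul_assoc] using conj_s (mem i) e
  case inr.inl.refine_1 =>
    have e : (t.s i * t.s j) (t.simpleRoot i) = t.simpleRoot j := by
      rw [hi, hj]; norm_num [sl, sr]
    simpa [altWord, mul_assoc] using conj_s (mul_mem (mem i) (mem j)) e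
  case inr.inr.inl.refine_1 | inr.inr.inr.inl.refine_1 =>
    have e : (t.s i * (t.s j * t.s i)) (t.simpleRoot j) = t.simpleRoot j := by
      rw [hj]; norm_num [sl, sr]
    simpa [altWord, mul_assoc] using conj_s (mul_mem (mem i) (mul_mem (mem j) (mem i))) e
  case inr.inr.inr.inr.inl.refine_1 | inr.inr.inr.inr.inr.inl.refine_1 =>
    have e : (t.s i * (t.s j * (t.s i * (t.s j * t.s i)))) (t.simpleRoot j) = t.simpleRoot j := by
      rw [hj]; norm_num [sl, sr]
    simpa [altWord, mul_assoc] using conj_s (mul_mem (mem i) (mul_mem (mem j)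
      (mul_mem (mem i) (mul_mem (mem j) (mem i))))) e
  case inl.refine_2 | inr.inl.refine_2 | inr.inr.inl.refine_2 | inr.inr.inr.inl.refine_2 |
      inr.inr.inr.inr.inl.refine_2 | inr.inr.inr.inr.inr.inl.refine_2 =>
    intro k hk
    rw [hi]
    interval_cases k
    all_goals
      simp only [altWord, wordProd_nil, wordProd_cons, mul_one, mul_inv_rev, inv_one, s_inv,
        LinearEquiv.mul_apply, LinearEquiv.coe_one, id, sl, sr]
      refine fin ?_ ?_ ?_ <;> norm_num
  all_goals
    rw [hi, hj, hn, hn]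
    simp only [altWord, wordProd_nil, wordProd_cons, mul_one, LinearEquiv.mul_apply, sl, sr]
    norm_num

/-! ### Reduced words of the same element have the same image -/

theorem descents_of_braidLength_eq_zero {i j : Fin (t.rank + 1)} (h : i ≠ j)
    (hm : t.braidLength i j = 0) {x : t.V ≃ₗ[ℚ] t.V} (hx : x ∈ t.W)
    (hi : ¬ t.Pos (x⁻¹ (t.simpleRoot i))) (hj : ¬ t.Pos (x⁻¹ (t.simpleRoot j))) : False := by
  have hr : t.rank = 1 := by
    rcases cartan_cases h with h' | h' | h' | h' | h' | h' | ⟨_, h'⟩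
    case inr.inr.inr.inr.inr.inr => exact h'
    all_goals
      simp only [braidLength, laces, h'.1, h'.2] at hm
      norm_num at hm
  have hd : t.delta = (t.label i : ℚ) • t.simpleRoot i + (t.label j : ℚ) • t.simpleRoot j := by
    ext k
    have hk : k = i ∨ k = j := by
      have := k.2; have := i.2; have := j.2
      have hij : (i : ℕ) ≠ j := fun h' => h (Fin.ext h')
      have : (k : ℕ) = i ∨ (k : ℕ) = j := by omega
      exact this.imp Fin.ext Fin.ext
    rcases hk with rfl | rfl
    · simp [delta, simpleRoot, h]
    · simp [delta, simpleRoot, h.symm]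
  have hi' := ((inv_root hx i).pos_neg_iff.2 hi).smul
    (c := t.label i) (by exact_mod_cast t.label_pos i)
  have hj' := ((inv_root hx j).pos_neg_iff.2 hj).smul
    (c := t.label j) (by exact_mod_cast t.label_pos j)
  have h1 := hi'.add hj'
  rw [smul_neg, smul_neg, ← neg_add, ← map_smul, ← map_smul, ← map_add, ← hd,
    t.W_delta (inv_mem hx)] at h1
  have h2 := h1.2 0
  have : (0 : ℚ) < t.label (0 : Fin (t.rank + 1)) := by exact_mod_cast t.label_pos 0
  simp [delta] at h2
  have h3 := t.label_zero_pos
  omega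

/-- An element with two left descents `i`, `j` has a reduced word starting with the long
alternating word in `i`, `j`. -/
theorem exists_red_altWord {i j : Fin (t.rank + 1)} (h : i ≠ j) {x : t.V ≃ₗ[ℚ] t.V} (hx : x ∈ t.W)
    (hi : ¬ t.Pos (x⁻¹ (t.simpleRoot i))) (hj : ¬ t.Pos (x⁻¹ (t.simpleRoot j))) :
    ∃ y, t.Red (altWord (t.braidLength i j) i j ++ y) ∧
      t.Red (altWord (t.braidLength i j) j i ++ y) ∧
      t.wordProd (altWord (t.braidLength i j) i j ++ y) = x ∧
      t.wordProd (altWord (t.braidLength i j) j i ++ y) = x := by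
  have hm : t.braidLength i j ≠ 0 := fun hm => descents_of_braidLength_eq_zero h hm hx hi hj
  obtain ⟨hA, hB, hC⟩ := rank_two h hm
  obtain ⟨_, hB', hC'⟩ := rank_two h.symm (by rwa [braidLength_comm])
  rw [braidLength_comm] at hB' hC'
  set m := t.braidLength i j
  set v := t.wordProd (altWord m i j) with hv
  have hvW : v ∈ t.W := t.wordProd_mem_W _
  obtain ⟨y, hy, hyx⟩ := exists_red_of_mem (mul_mem (inv_mem hvW) hx)
  have hpi : ∀ k, t.simpleRoot k = t.simpleRoot i ∨ t.simpleRoot k = t.simpleRoot j →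
      t.Pos (x⁻¹ (-t.simpleRoot k)) := by
    rintro k (h' | h') <;> rw [h', map_neg]
    · exact (inv_root hx i).pos_neg_iff.2 hi
    · exact (inv_root hx j).pos_neg_iff.2 hj
  have hyi : t.Pos ((t.wordProd y)⁻¹ (t.simpleRoot i)) := by
    rw [hyx, mul_inv_rev, inv_inv, LinearEquiv.mul_apply]
    rcases hC with h' | h' <;> rw [h']
    · exact hpi i (Or.inl rfl)
    · exact hpi j (Or.inr rfl)
  have hyj : t.Pos ((t.wordProd y)⁻¹ (t.simpleRoot j)) := by
    rw [hyx, mul_inv_rev, inv_inv, LinearEquiv.mul_apply, hA]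
    rcases hC' with h' | h' <;> rw [h']
    · exact hpi j (Or.inr rfl)
    · exact hpi i (Or.inl rfl)
  have comb : ∀ p q : ℚ, 0 ≤ p → 0 ≤ q → 0 < p + q → t.Pos ((t.wordProd y)⁻¹
      (p • t.simpleRoot i + q • t.simpleRoot j)) := by
    intro p q hp hq hpq
    rw [map_add, map_smul, map_smul]
    rcases hp.eq_or_lt with rfl | hp
    · rw [zero_smul, zero_add]; exact hyj.smul (by linarith)
    · rcases hq.eq_or_lt with rfl | hq
      · rw [zero_smul, add_zero]; exact hyi.smul hp
      · exact (hyi.smul hp).add (hyj.smul hq)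
  have aux : ∀ k ≤ m, t.Red (altWord k i j ++ y) ∧ t.Red (altWord k j i ++ y) := by
    intro k hk
    induction k with
    | zero => exact ⟨hy, hy⟩
    | succ k ih =>
      obtain ⟨h1, h2⟩ := ih (by omega)
      obtain ⟨p, q, hp, hq, hpq, e⟩ := hB k (by omega)
      obtain ⟨p', q', hp', hq', hpq', e'⟩ := hB' k (by omega)
      refine ⟨⟨h2, ?_⟩, ⟨h1, ?_⟩⟩
      · change t.Pos ((t.wordProd (altWord k j i ++ y))⁻¹ _)
        rw [wordProd_append, mul_inv_rev, LinearEquiv.mul_apply, e]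
        exact comb p q hp hq hpq
      · change t.Pos ((t.wordProd (altWord k i j ++ y))⁻¹ _)
        rw [wordProd_append, mul_inv_rev, LinearEquiv.mul_apply, e', add_comm (p' • _)]
        exact comb q' p' hq' hp' (by linarith)
  refine ⟨y, (aux m le_rfl).1, (aux m le_rfl).2, ?_, ?_⟩
  · rw [wordProd_append, hyx, ← hv, mul_inv_cancel_left]
  · rw [wordProd_append, hyx, ← hA, mul_inv_cancel_left]

variable (t) in
/-- A family of elements of a group satisfying the braid relations. -/
def IsBraided {G : Type*} [Group G] (T : Fin (t.rank + 1) → G) : Prop :=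
  ∀ i j, i ≠ j → alternating (t.braidLength i j) (T i) (T j) =
    alternating (t.braidLength i j) (T j) (T i)

section
variable {G : Type*} [Group G] {T : Fin (t.rank + 1) → G}

theorem prod_eq_of_red (hT : t.IsBraided T) (n : ℕ) : ∀ w w' : List (Fin (t.rank + 1)),
    w.length ≤ n → t.Red w → t.Red w' → t.wordProd w = t.wordProd w' →
    w.length = w'.length ∧ (w.map T).prod = (w'.map T).prod := by
  have hnil : ∀ i w, t.Red (i :: w) → t.wordProd (i :: w) ≠ 1 := by
    rintro i w ⟨_, hp⟩ h
    rw [wordProd_cons, mul_eq_one_iff_inv_eq, s_inv] at h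
    rw [← h, s_inv, s_simpleRoot_self] at hp
    exact (t.pos_simpleRoot i).not_neg hp
  have hdesc : ∀ i w, t.Red (i :: w) → ¬ t.Pos ((t.wordProd (i :: w))⁻¹ (t.simpleRoot i)) := by
    rintro i w ⟨_, hp⟩ h
    rw [wordProd_cons, inv_s_mul_apply, s_simpleRoot_self, map_neg] at h
    exact hp.not_neg h
  induction n with
  | zero =>
    intro w w' hw _ h2 h
    obtain rfl : w = [] := List.length_eq_zero_iff.1 (by omega)
    cases w' with
    | nil => exact ⟨rfl, rfl⟩
    | cons i w' => exact absurd h.symm (hnil i w' h2)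
  | succ n ih =>
    intro w w' hw h1 h2 h
    cases w with
    | nil =>
      cases w' with
      | nil => exact ⟨rfl, rfl⟩
      | cons i w' => exact absurd h.symm (hnil i w' h2)
    | cons i u =>
      cases w' with
      | nil => exact absurd h (hnil i u h1)
      | cons j v =>
        have hn : u.length ≤ n := by simpa using hw
        have same : ∀ k u v, u.length ≤ n → t.Red (k :: u) → t.Red (k :: v) →
            t.wordProd (k :: u) = t.wordProd (k :: v) → u.length = v.length ∧
            ((k :: u).map T).prod = ((k :: v).map T).prod := by
          intro k u v hl h1 h2 h
          rw [wordProd_cons, wordProd_cons, mul_right_inj] at h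
          obtain ⟨h3, h4⟩ := ih u v hl h1.1 h2.1 h
          exact ⟨h3, by simp [h4]⟩
        rcases eq_or_ne i j with rfl | hij
        · obtain ⟨h3, h4⟩ := same i u v hn h1 h2 h
          exact ⟨by simp [h3], h4⟩
        · have hi := hdesc i u h1
          have hj := hdesc j v h2
          rw [← h] at hj
          obtain ⟨y, r1, r2, e1, e2⟩ := exists_red_altWord hij (t.wordProd_mem_W (i :: u)) hi hj
          have hm : t.braidLength i j ≠ 0 := fun hm =>
            descents_of_braidLength_eq_zero hij hm (t.wordProd_mem_W (i :: u)) hi hj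
          have hb := hT i j hij
          obtain ⟨m, hm'⟩ := Nat.exists_eq_succ_of_ne_zero hm
          rw [hm'] at r1 r2 e1 e2 hb
          obtain ⟨h3, h4⟩ := same i u (altWord m j i ++ y) hn h1 r1 e1.symm
          rw [List.length_append, length_altWord] at h3
          obtain ⟨h5, h6⟩ := same j (altWord m i j ++ y) v
            (by rw [List.length_append, length_altWord]; omega) r2 h2 (e2.trans h)
          rw [List.length_append, length_altWord] at h5
          refine ⟨by simp; omega, ?_⟩
          rw [h4, ← h6]
          have e := prod_map_altWord T
          change ((altWord (m + 1) i j ++ y).map T).prod = ((altWord (m + 1) j i ++ y).map T).prod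
          rw [List.map_append, List.prod_append, e, List.map_append, List.prod_append, e]
          rw [show alternating (m + 1) (T i) (T j) = alternating (m + 1) (T j) (T i) from hb]

open Classical in
/-- The image `T_x` of an element `x` of the affine Weyl group: the product of the `T_i` along a
reduced word of `x`. -/
noncomputable def weylLift (T : Fin (t.rank + 1) → G) (x : t.V ≃ₗ[ℚ] t.V) : G :=
  if h : x ∈ t.W then ((exists_red_of_mem h).choose.map T).prod else 1

theorem weylLift_wordProd (hT : t.IsBraided T) {w : List (Fin (t.rank + 1))} (hw : t.Red w) :
    weylLift T (t.wordProd w) = (w.map T).prod := by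
  rw [weylLift, dif_pos (t.wordProd_mem_W w)]
  have h := (exists_red_of_mem (t.wordProd_mem_W w)).choose_spec
  exact (prod_eq_of_red hT _ _ _ le_rfl h.1 hw h.2).2

theorem weylLift_one (hT : t.IsBraided T) : weylLift T (1 : t.V ≃ₗ[ℚ] t.V) = 1 :=
  weylLift_wordProd hT (w := []) trivial

theorem weylLift_s_mul (hT : t.IsBraided T) {x : t.V ≃ₗ[ℚ] t.V} (hx : x ∈ t.W) {i : Fin (t.rank + 1)}
    (h : t.Pos (x⁻¹ (t.simpleRoot i))) : weylLift T (t.s i * x) = T i * weylLift T x := by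
  obtain ⟨w, hw, rfl⟩ := exists_red_of_mem hx
  rw [weylLift_wordProd hT hw, ← wordProd_cons, weylLift_wordProd hT (w := i :: w) ⟨hw, h⟩, List.map_cons,
    List.prod_cons]

theorem weylLift_s (hT : t.IsBraided T) (i : Fin (t.rank + 1)) : weylLift T (t.s i) = T i := by
  have := weylLift_s_mul hT (one_mem t.W) (i := i) (by rw [inv_one]; exact t.pos_simpleRoot i)
  rwa [mul_one, weylLift_one hT, mul_one] at this

/-- `T_{xy} = T_x T_y` if every positive root made negative by `y` is made negative by `x y`. -/
theorem weylLift_mul (hT : t.IsBraided T) {x y : t.V ≃ₗ[ℚ] t.V} (hx : x ∈ t.W) (hy : y ∈ t.W)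
    (h : ∀ v, t.IsRoot v → t.Pos v → ¬ t.Pos (y v) → ¬ t.Pos (x (y v))) :
    weylLift T (x * y) = weylLift T x * weylLift T y := by
  obtain ⟨w, hw, rfl⟩ := exists_red_of_mem hx
  clear hx
  induction w with
  | nil => rw [wordProd_nil, one_mul, weylLift_one hT, one_mul]
  | cons i w ih =>
    obtain ⟨hw, hp⟩ := hw
    have hwW := t.wordProd_mem_W w
    rw [wordProd_cons] at h
    have h1 : ∀ v, t.IsRoot v → t.Pos v → ¬ t.Pos (y v) → ¬ t.Pos (t.wordProd w (y v)) := by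
      intro v hv hvp hvn hc
      by_cases he : t.wordProd w (y v) = t.simpleRoot i
      · rw [← he, aut_inv_apply] at hp
        exact hvn hp
      · exact h v hv hvp hvn (((hv.map hy).map hwW).pos_s hc he)
    have h2 : t.Pos ((t.wordProd w * y)⁻¹ (t.simpleRoot i)) := by
      by_contra hc
      have hc' := (inv_root (mul_mem hwW hy) i).pos_neg_iff.2 hc
      rw [← map_neg, mul_inv_rev, LinearEquiv.mul_apply] at hc'
      refine h _ (((isRoot_simpleRoot i).neg.map (inv_mem hwW)).map (inv_mem hy)) hc' ?_ ?_
      · rw [aut_apply_inv, map_neg]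
        exact hp.not_neg
      · rw [aut_apply_inv, LinearEquiv.mul_apply, aut_apply_inv, map_neg,
          s_simpleRoot_self, neg_neg]
        exact t.pos_simpleRoot i
    rw [wordProd_cons, mul_assoc, weylLift_s_mul hT (mul_mem hwW hy) h2, ih hw h1,
      weylLift_s_mul hT hwW hp, mul_assoc]

theorem weylLift_mul_s (hT : t.IsBraided T) {x : t.V ≃ₗ[ℚ] t.V} (hx : x ∈ t.W) {i : Fin (t.rank + 1)}
    (h : t.Pos (x (t.simpleRoot i))) : weylLift T (x * t.s i) = weylLift T x * T i := by
  rw [weylLift_mul hT hx (t.s_mem_W i), weylLift_s hT]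
  intro v hv hp hn
  by_cases he : v = t.simpleRoot i
  · subst he
    rw [s_simpleRoot_self, map_neg]
    exact h.not_neg
  · exact absurd (hv.pos_s hp he) hn

end

end AffineType
end TripleArtin

namespace TripleArtin
namespace AffineType

variable (t : AffineType)

/-! ### The finite Weyl group, `θ` and translations -/

/-- `a_0⁻¹ δ` -/
def dl : t.V := (t.label 0 : ℚ)⁻¹ • t.delta

/-- `a_0⁻¹ θ` -/
def th : t.V := (t.label 0 : ℚ)⁻¹ • t.theta

theorem label0_ne : (t.label 0 : ℚ) ≠ 0 := by exact_mod_cast t.label_zero_pos.ne'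

theorem dl_eq : t.dl = t.simpleRoot 0 + t.th := by
  rw [th, theta, smul_sub, smul_smul, inv_mul_cancel₀ t.label0_ne, one_smul]
  abel

theorem th_eq : t.th = t.dl - t.simpleRoot 0 := by rw [dl_eq]; abel

theorem dl_zero : t.dl 0 = 1 := by
  simp [dl, delta, inv_mul_cancel₀ t.label0_ne]

theorem th_zero : t.th 0 = 0 := by
  rw [th_eq, Pi.sub_apply, dl_zero]; simp [simpleRoot]

theorem theta_eq : t.theta = (t.label 0 : ℚ) • t.th := by
  rw [th, smul_smul, mul_inv_cancel₀ t.label0_ne, one_smul]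

theorem coroot_dl (i : Fin (t.rank + 1)) : t.coroot i t.dl = 0 := by
  rw [dl, map_smul, coroot_delta, smul_zero]

theorem coroot_th (i : Fin (t.rank + 1)) : t.coroot i t.th = -t.cartan i 0 := by
  rw [th_eq, map_sub, coroot_dl, coroot_simpleRoot, zero_sub]

theorem bil_dl_right (x : t.V) : t.bil x t.dl = 0 := by
  rw [dl, map_smul, bil_delta_right, smul_zero]

theorem bil_dl_left (x : t.V) : t.bil t.dl x = 0 := by rw [bil_comm, bil_dl_right]

theorem bil_th (x : t.V) : t.bil t.th x = -t.coroot 0 x := by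
  rw [th_eq, map_sub, LinearMap.sub_apply, bil_dl_left, bil_simpleRoot_left, Fin.val_zero, sym_zero]
  simp

theorem bil_th_th : t.bil t.th t.th = 2 := by
  rw [bil_th, coroot_th, cartan_self]; norm_num

theorem s_dl (i : Fin (t.rank + 1)) : t.s i t.dl = t.dl := by rw [dl, map_smul, s_delta]

theorem W_dl {x : t.V ≃ₗ[ℚ] t.V} (hx : x ∈ t.W) : x t.dl = t.dl := by rw [dl, map_smul, W_delta t hx]

/-- The finite Weyl group. -/
def F : Subgroup (t.V ≃ₗ[ℚ] t.V) := Subgroup.closure (Set.range fun i : Fin t.rank => t.s i.succ)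

theorem F_le_W : t.F ≤ t.W := by
  rw [F, Subgroup.closure_le]
  rintro _ ⟨i, rfl⟩
  exact t.s_mem_W _

theorem s_mem_F {i : Fin (t.rank + 1)} (hi : i ≠ 0) : t.s i ∈ t.F := by
  obtain ⟨j, rfl⟩ := Fin.exists_succ_eq.2 hi
  exact Subgroup.subset_closure ⟨j, rfl⟩

theorem F_induction {P : (t.V ≃ₗ[ℚ] t.V) → Prop} (h1 : P 1)
    (hs : ∀ i, i ≠ 0 → ∀ x ∈ t.F, P x → P (t.s i * x)) {x : t.V ≃ₗ[ℚ] t.V} (hx : x ∈ t.F) : P x := by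
  induction hx using Subgroup.closure_induction_left with
  | one => exact h1
  | mul_left x hx y hy ih => obtain ⟨i, rfl⟩ := hx; exact hs _ (Fin.succ_ne_zero i) y hy ih
  | inv_mul_cancel x hx y hy ih =>
    obtain ⟨i, rfl⟩ := hx
    simp only [s_inv]
    exact hs _ (Fin.succ_ne_zero i) y hy ih

theorem F_apply_zero {x : t.V ≃ₗ[ℚ] t.V} (hx : x ∈ t.F) (v : t.V) : x v 0 = v 0 :=
  t.F_induction (P := fun x => x v 0 = v 0) rfl
    (fun i hi y _ ih => by rw [LinearEquiv.mul_apply, s_apply_of_ne t hi.symm, ih]) hx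

theorem exists_word_of_mem_F {x : t.V ≃ₗ[ℚ] t.V} (hx : x ∈ t.F) :
    ∃ w : List (Fin t.rank), t.wordProd (w.map Fin.succ) = x :=
  t.F_induction (P := fun x => ∃ w : List (Fin t.rank), t.wordProd (w.map Fin.succ) = x) ⟨[], rfl⟩
    (fun i hi _ _ ⟨w, hw⟩ => by
      obtain ⟨j, rfl⟩ := Fin.exists_succ_eq.2 hi
      exact ⟨j :: w, by rw [List.map_cons, wordProd_cons, hw]⟩) hx

theorem wordProd_mem_F (w : List (Fin t.rank)) : t.wordProd (w.map Fin.succ) ∈ t.F := by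
  induction w with
  | nil => exact one_mem _
  | cons i w ih =>
    rw [List.map_cons, wordProd_cons]
    exact mul_mem (t.s_mem_F (Fin.succ_ne_zero i)) ih

/-- A positive vector of minimal norm in the finite root lattice is conjugate to a simple root. -/
theorem exists_conj_simpleRoot {d : ℤ} (hd : 0 < d) (n : ℕ) : ∀ v ∈ t.lat d, t.bil v v = 2 * d →
    v 0 = 0 → t.Pos v → ∑ k, v k ≤ n → ∃ u ∈ t.F, ∃ k, k ≠ 0 ∧ v = u (t.simpleRoot k) := by
  have hd' : (0 : ℚ) < d := by exact_mod_cast hd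
  induction n with
  | zero =>
    intro v _ _ _ hp hs
    exfalso
    have h0 : ∑ k, v k = 0 := le_antisymm (by simpa using hs) (Finset.sum_nonneg fun k _ => hp.2 k)
    rw [Finset.sum_eq_zero_iff_of_nonneg fun k _ => hp.2 k] at h0
    exact hp.1 (funext fun k => h0 k (Finset.mem_univ _))
  | succ n ih =>
    intro v hv hn h0 hp hs
    obtain ⟨k, hk⟩ : ∃ k, 0 < v k * t.sym k * t.coroot k v := by
      by_contra hc
      push Not at hc
      have h1 : t.bil v v ≤ 0 := by
        rw [bil_apply]; exact Finset.sum_nonpos fun k _ => hc k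
      linarith
    have hs0 : (0 : ℚ) < t.sym k := by exact_mod_cast t.sym_pos k
    have hc : 0 < t.coroot k v := by
      have := hp.2 k
      by_contra hc
      push Not at hc
      have := mul_nonneg this hs0.le
      nlinarith
    have hk0 : k ≠ 0 := by
      rintro rfl
      rw [h0] at hk; simp at hk
    have hkF := t.s_mem_F hk0
    have hn' : t.bil (t.s k v) (t.s k v) = 2 * d := by rw [bil_s, hn]
    rcases t.pos_or_pos_neg hd (t.s_mem_lat hv k) hn' with h | h
    · obtain ⟨z, hz⟩ := t.exists_coroot_int hv k
      have hz1 : (1 : ℚ) ≤ t.coroot k v := by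
        rw [hz] at hc ⊢
        have : 0 < z := by exact_mod_cast hc
        exact_mod_cast this
      obtain ⟨u, hu, l, hl, he⟩ := ih (t.s k v) (t.s_mem_lat hv k) hn'
        (by rw [s_apply_of_ne t hk0.symm, h0]) h (by
          have : ∑ j, (t.s k v) j = ∑ j, v j - t.coroot k v := by
            simp [s_apply, simpleRoot, Finset.sum_sub_distrib, ← Finset.mul_sum]
          rw [this]; push_cast at hs; linarith)
      exact ⟨t.s k * u, mul_mem hkF hu, l, hl, by
        rw [LinearEquiv.mul_apply, ← he, s_s_apply]⟩
    · refine ⟨1, one_mem _, k, hk0, ?_⟩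
      have hvk : v = v k • t.simpleRoot k := by
        ext j
        rcases eq_or_ne j k with rfl | hj
        · simp [simpleRoot]
        · have h1 := h.2 j
          rw [Pi.neg_apply, s_apply_of_ne t hj] at h1
          have := hp.2 j
          have : v j = 0 := by linarith
          simp [simpleRoot, hj, this]
      have hvk0 : 0 < v k := by
        refine lt_of_le_of_ne (hp.2 k) fun h' => hp.1 ?_
        rw [hvk, ← h', zero_smul]
      have h1 : v k = 1 := eq_one_of_smul_mem_lat (t := t) (i := k) (d := d) (by rwa [← hvk])
        (by rwa [← hvk]) hvk0
      rw [h1, one_smul] at hvk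
      exact hvk

theorem theta_apply {k : Fin (t.rank + 1)} (hk : k ≠ 0) : t.theta k = t.label k := by
  simp [theta, delta, simpleRoot, hk]

theorem theta_zero : t.theta 0 = 0 := by
  simp [theta, delta, simpleRoot]

theorem exists_theta : ∃ u ∈ t.F, ∃ k, k ≠ 0 ∧ t.theta = u (t.simpleRoot k) := by
  have hd : (0 : ℤ) < (t.label 0 : ℤ) ^ 2 := by
    have := t.label_zero_pos
    positivity
  refine t.exists_conj_simpleRoot hd (∑ k : Fin (t.rank + 1), t.label k) _ ?_ ?_ t.theta_zero
    ⟨fun h => ?_, fun k => ?_⟩ ?_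
  · refine t.mem_lat.2 ⟨fun k => ?_, fun k => ?_⟩ <;> rcases eq_or_ne k 0 with rfl | hk
    · exact ⟨0, by simp [theta_zero]⟩
    · exact ⟨t.label k, by rw [theta_apply t hk]; simp⟩
    · exact ⟨0, by simp [theta_zero]⟩
    · obtain ⟨z, hz⟩ := t.label_zero_sq_dvd k hk
      refine ⟨z, ?_⟩
      rw [theta_apply t hk, mul_comm]
      exact_mod_cast hz
  · rw [theta_eq]
    simp only [map_smul, LinearMap.smul_apply, bil_th_th, smul_eq_mul]
    push_cast; ring
  · have h1 := t.bil_th_th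
    rw [th, h] at h1
    simp at h1
  · rcases eq_or_ne k 0 with rfl | hk
    · rw [theta_zero]
    · rw [theta_apply t hk]; positivity
  · push_cast
    refine Finset.sum_le_sum fun k _ => ?_
    rcases eq_or_ne k 0 with rfl | hk
    · rw [theta_zero]; positivity
    · rw [theta_apply t hk]

theorem isRoot_theta : t.IsRoot t.theta := by
  obtain ⟨u, hu, k, _, h⟩ := t.exists_theta
  exact ⟨u, t.F_le_W hu, k, h⟩

/-- The reflection `s_θ` as an automorphism. -/
def sTheta : t.V ≃ₗ[ℚ] t.V := Module.reflection t.bil_th_th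

theorem sTheta_apply (x : t.V) : t.sTheta x = x - t.bil t.th x • t.th :=
  Module.reflection_apply _ _

theorem sTheta_mul_self : t.sTheta * t.sTheta = 1 := by
  ext1 x; exact Module.involutive_reflection t.bil_th_th x

theorem sTheta_inv : t.sTheta⁻¹ = t.sTheta := inv_eq_of_mul_eq_one_left t.sTheta_mul_self

theorem sTheta_mem_F : t.sTheta ∈ t.F := by
  obtain ⟨u, hu, k, hk, h⟩ := t.exists_theta
  have hW := t.F_le_W hu
  have : t.sTheta = u * t.s k * u⁻¹ := by
    ext1 x
    rw [LinearEquiv.mul_apply, LinearEquiv.mul_apply, s_apply, map_sub, map_smul, ← h,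
      aut_apply_inv, sTheta_apply, theta_eq, smul_smul]
    congr 2
    have hk0 : (t.sym k : ℚ) ≠ 0 := by exact_mod_cast (t.sym_pos k).ne'
    have h1 : t.bil t.theta x = t.sym k * t.coroot k (u⁻¹ x) := by
      have := W_bil t hW (t.simpleRoot k) (u⁻¹ x)
      rwa [aut_apply_inv, ← h, bil_simpleRoot_left] at this
    have h2 : t.bil t.theta t.theta = 2 * t.sym k := by
      rw [h, W_bil t hW, bil_simpleRoot_left, coroot_simpleRoot_self]; ring
    rw [theta_eq] at h1 h2
    simp only [map_smul, LinearMap.smul_apply, smul_eq_mul, bil_th_th] at h1 h2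
    have := t.label0_ne
    have h3 : (t.sym k : ℚ) = t.label 0 * t.label 0 := by linarith
    rw [h3] at h1
    have h4 : (t.label 0 : ℚ) * (t.bil t.th x - t.coroot k (u⁻¹ x) * t.label 0) = 0 := by
      linear_combination h1
    have := (mul_eq_zero.1 h4).resolve_left this
    linarith
  rw [this]
  exact mul_mem (mul_mem hu (t.s_mem_F hk)) (inv_mem hu)

theorem sTheta_mem_W : t.sTheta ∈ t.W := t.F_le_W t.sTheta_mem_F

theorem thetaReflection_eq : t.thetaReflection = (t.sTheta : t.V →ₗ[ℚ] t.V) := by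
  refine LinearMap.ext fun x => ?_
  rw [LinearEquiv.coe_coe, sTheta_apply, thetaReflection, Module.preReflection_apply]
  have hb : ∀ x y, t.form x y = (t.label 0 : ℚ)⁻¹ * t.bil x y := by
    intro x y
    rw [bil, LinearMap.smul_apply, LinearMap.smul_apply, smul_eq_mul, ← mul_assoc,
      inv_mul_cancel₀ t.label0_ne, one_mul]
  rw [LinearMap.smul_apply, hb, hb, theta_eq]
  simp only [map_smul, LinearMap.smul_apply, smul_eq_mul, bil_th_th, smul_smul]
  congr 2
  have := t.label0_ne
  field_simp

theorem wordReflection_eq (w : List (Fin t.rank)) :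
    t.wordReflection w = (t.wordProd (w.map Fin.succ) : t.V →ₗ[ℚ] t.V) := by
  induction w with
  | nil => rfl
  | cons i w ih =>
    rw [wordReflection, List.map_cons, List.prod_cons, ← wordReflection, ih, List.map_cons,
      wordProd_cons]
    rfl

theorem wordReflection_eq_iff (w : List (Fin t.rank)) :
    t.wordReflection w = t.thetaReflection ↔ t.wordProd (w.map Fin.succ) = t.sTheta := by
  rw [wordReflection_eq, thetaReflection_eq]
  exact LinearEquiv.toLinearMap_inj

theorem exists_isReducedTheta : ∃ w : List (Fin t.rank), t.IsReducedTheta w := by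
  classical
  obtain ⟨w, hw⟩ := t.exists_word_of_mem_F t.sTheta_mem_F
  have hex : ∃ n, ∃ w : List (Fin t.rank), w.length = n ∧ t.wordReflection w = t.thetaReflection :=
    ⟨_, w, rfl, (t.wordReflection_eq_iff w).2 hw⟩
  obtain ⟨w, hl, hw⟩ := Nat.find_spec hex
  exact ⟨w, hw, fun w' hw' => hl ▸ Nat.find_min' hex ⟨w', rfl, hw'⟩⟩

variable {t} in
theorem IsReducedTheta.red {w : List (Fin t.rank)} (h : t.IsReducedTheta w) :
    t.Red (w.map Fin.succ) ∧ t.wordProd (w.map Fin.succ) = t.sTheta := by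
  have h1 := (t.wordReflection_eq_iff w).1 h.1
  refine ⟨?_, h1⟩
  obtain ⟨w', h2, h3, h4⟩ := exists_red (t := t) (w.map Fin.succ)
  obtain ⟨v, h5, rfl⟩ := List.sublist_map_iff.1 h2
  have h6 := h.2 v ((t.wordReflection_eq_iff v).2 (h4.trans h1))
  rw [h5.eq_of_length_le h6] at h3
  exact h3

/-! ### Translations -/

/-- The translation `x ↦ x - (x, v) a_0⁻¹ δ`. -/
def tr (v : t.V) : t.V ≃ₗ[ℚ] t.V :=
  LinearEquiv.ofLinearMap (LinearMap.id - (t.bil v).smulRight t.dl)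
    (LinearMap.id + (t.bil v).smulRight t.dl)
    (LinearMap.ext fun x => by simp [bil_dl_right]) (LinearMap.ext fun x => by simp [bil_dl_right])

theorem tr_apply (v x : t.V) : t.tr v x = x - t.bil v x • t.dl := rfl

theorem tr_add (v w : t.V) : t.tr (v + w) = t.tr v * t.tr w := by
  ext1 x
  rw [LinearEquiv.mul_apply, tr_apply, tr_apply, tr_apply, map_sub, map_smul, bil_dl_right,
    map_add, LinearMap.add_apply]
  module

theorem tr_zero : t.tr 0 = 1 := by
  ext1 x; simp [tr_apply]

theorem tr_neg (v : t.V) : t.tr (-v) = (t.tr v)⁻¹ := by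
  rw [eq_inv_iff_mul_eq_one, ← tr_add, neg_add_cancel, tr_zero]

theorem s_zero_mul_sTheta : t.s 0 * t.sTheta = t.tr t.th := by
  ext1 x
  have e : ∀ x, t.s 0 x = x + t.bil t.th x • (t.dl - t.th) := by
    intro x
    rw [s_apply, bil_th, dl_eq]; module
  rw [LinearEquiv.mul_apply, e, sTheta_apply, tr_apply, map_sub, map_smul, bil_th_th]
  simp only [smul_eq_mul]
  module

theorem s_zero_eq : t.s 0 = t.tr t.th * t.sTheta := by
  rw [← s_zero_mul_sTheta, mul_assoc, sTheta_mul_self, mul_one]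

variable {t} in
theorem mul_tr {x : t.V ≃ₗ[ℚ] t.V} (hx : x ∈ t.W) (v : t.V) : x * t.tr v = t.tr (x v) * x := by
  ext1 y
  rw [LinearEquiv.mul_apply, LinearEquiv.mul_apply, tr_apply, tr_apply, map_sub, map_smul, W_dl t hx,
    W_bil t hx]

variable {t} in
/-- The finite part of a root is proportional to a root of the finite root system. -/
theorem IsRoot.exists_finite_part {v : t.V} (h : t.IsRoot v) :
    ∃ c : ℚ, 0 < c ∧ ∃ r, t.IsRoot r ∧ r 0 = 0 ∧ v = c • r + v 0 • t.dl := by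
  obtain ⟨x, hx, i, rfl⟩ := h
  refine t.W_induction (P := fun x => ∃ c : ℚ, 0 < c ∧ ∃ r, t.IsRoot r ∧ r 0 = 0 ∧
    x (t.simpleRoot i) = c • r + x (t.simpleRoot i) 0 • t.dl) ?_ (fun j x hx ih => ?_) hx
  · show ∃ c : ℚ, 0 < c ∧ ∃ r, t.IsRoot r ∧ r 0 = 0 ∧
      t.simpleRoot i = c • r + t.simpleRoot i 0 • t.dl
    rcases eq_or_ne i 0 with rfl | hi
    · refine ⟨(t.label 0 : ℚ)⁻¹, ?_, -t.theta, t.isRoot_theta.neg, by simp [theta_zero], ?_⟩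
      · have : (0 : ℚ) < t.label 0 := by exact_mod_cast t.label_zero_pos
        positivity
      · rw [smul_neg, dl_eq, th]
        simp [simpleRoot]
    · refine ⟨1, one_pos, t.simpleRoot i, isRoot_simpleRoot i, by simp [simpleRoot, hi.symm], ?_⟩
      have h2 : t.simpleRoot i 0 = 0 := by simp [simpleRoot, hi.symm]
      rw [h2, zero_smul, add_zero, one_smul]
  · obtain ⟨c, hc, r, hr, hr0, he⟩ := ih
    rw [LinearEquiv.mul_apply]
    generalize x (t.simpleRoot i) = v at he ⊢
    have fin : ∀ (r' : t.V) (k : ℚ), t.IsRoot r' → r' 0 = 0 → t.s j v = c • r' + k • t.dl →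
        ∃ c : ℚ, 0 < c ∧ ∃ r, t.IsRoot r ∧ r 0 = 0 ∧ t.s j v = c • r + (t.s j v) 0 • t.dl := by
      intro r' k h1 h2 h3
      refine ⟨c, hc, r', h1, h2, ?_⟩
      have : (t.s j v) 0 = k := by
        rw [h3, Pi.add_apply, Pi.smul_apply, Pi.smul_apply, dl_zero, h2]; simp
      rw [this, h3]
    rcases eq_or_ne j 0 with rfl | hj
    · refine fin (t.sTheta r) (v 0 - c * t.bil t.th (t.sTheta r)) (hr.map t.sTheta_mem_W) ?_ ?_
      · rw [F_apply_zero t t.sTheta_mem_F, hr0]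
      · conv_lhs => rw [he]
        rw [map_add, map_smul, map_smul, s_dl, s_zero_eq, LinearEquiv.mul_apply, tr_apply]
        module
    · refine fin (t.s j r) (v 0) (hr.map (t.s_mem_W j)) ?_ ?_
      · rw [s_apply_of_ne t hj.symm, hr0]
      · conv_lhs => rw [he]
        rw [map_add, map_smul, map_smul, s_dl]

end AffineType
end TripleArtin

namespace TripleArtin
namespace AffineType

variable (t : AffineType)

/-! ### The finite lattice -/

theorem simpleRoot_mem_weightLattice {j : Fin (t.rank + 1)} (hj : j ≠ 0) :
    t.simpleRoot j ∈ t.weightLattice :=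
  ⟨by simp [simpleRoot, hj.symm], fun i => ⟨t.cartan i.succ j, t.coroot_simpleRoot _ _⟩⟩

theorem simpleRoot_mem_finiteLattice {j : Fin (t.rank + 1)} (hj : j ≠ 0) :
    t.simpleRoot j ∈ t.finiteLattice := by
  have h : t.simpleRoot j ∈ t.rootLattice := by
    obtain ⟨i, rfl⟩ := Fin.exists_succ_eq.2 hj
    exact AddSubgroup.subset_closure ⟨i, rfl⟩
  have h' := t.simpleRoot_mem_weightLattice hj
  cases t
  case A2even m => exact h'
  all_goals exact h

theorem th_mem : t.th ∈ t.finiteLattice := t.inv_smul_theta_mem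

theorem theta_eq_sum :
    t.theta = ∑ k ∈ Finset.univ.erase (0 : Fin (t.rank + 1)), t.label k • t.simpleRoot k := by
  ext j
  rw [Finset.sum_apply]
  rcases eq_or_ne j 0 with rfl | hj
  · rw [theta_zero]
    refine (Finset.sum_eq_zero fun k hk => ?_).symm
    simp [simpleRoot, (Finset.mem_erase.1 hk).1.symm]
  · rw [theta_apply t hj, Finset.sum_eq_single j]
    · simp [simpleRoot]
    · intro k _ hk
      simp [simpleRoot, hk.symm]
    · intro h; exact absurd (Finset.mem_erase.2 ⟨hj, Finset.mem_univ _⟩) h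

theorem sym_le_four (i : ℕ) : t.sym i ≤ 4 := by
  cases t <;> simp only [sym] <;> (try split_ifs) <;> norm_num

theorem of_isLastNode {j : Fin (t.rank + 1)} (h : t.IsLastNode j) (hd : ¬ IsDivisibleNode t j) :
    t.label 0 = 1 ∧ ∀ k, ¬ IsDivisibleNode t k := by
  cases t <;> simp_all [IsLastNode, IsDivisibleNode, label]

theorem simpleRoot_mem_of_closed {H : AddSubgroup t.V} (hth : t.th ∈ H)
    (hc : ∀ j ≠ 0, ¬ IsDivisibleNode t j → ∀ γ ∈ H, γ ∈ t.finiteLattice → t.coroot j γ = -1 →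
      t.simpleRoot j ∈ H) (j : Fin (t.rank + 1)) (hj : j ≠ 0) (hd : ¬ IsDivisibleNode t j) :
    t.simpleRoot j ∈ H := by
  suffices h : ∀ n, n ≤ t.rank → ∀ j : Fin (t.rank + 1), (j : ℕ) = n → j ≠ 0 →
      ¬ IsDivisibleNode t j → t.simpleRoot j ∈ H from
    h j (Nat.lt_succ_iff.1 j.2) j rfl hj hd
  refine node_induction t (P := fun n => ∀ j : Fin (t.rank + 1), (j : ℕ) = n → j ≠ 0 →
      ¬ IsDivisibleNode t j → t.simpleRoot j ∈ H) ?_ ?_ ?_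
  · intro j h h'; exact absurd (Fin.ext h) h'
  · intro i j' hi _ hj0 hl he ih j hjj hj hd
    subst hjj
    obtain ⟨i, rfl⟩ : ∃ i' : Fin (t.rank + 1), (i' : ℕ) = i := ⟨⟨i, Nat.lt_succ_iff.2 hi⟩, rfl⟩
    have hc' : t.cartan j i = -1 := by rw [cartan_eq_entry, he]
    rcases eq_or_ne i 0 with rfl | hi0
    · refine hc j hj hd (-t.th) (neg_mem hth) (neg_mem t.th_mem) ?_
      rw [map_neg, coroot_th, hc']; norm_num
    · have hi4 : ¬ IsDivisibleNode t i := by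
        rw [isDivisibleNode_iff]
        intro h4
        have h1 := t.sym_mul_cartan i j
        rw [h4, hc'] at h1
        have h2 := t.sym_le_four j
        have h3 := t.sym_pos j
        exact hl (t.isLastNode_of_sym_eq_four (by omega))
      refine hc j hj hd _ (ih i rfl hi0 hi4) (t.simpleRoot_mem_finiteLattice hi0) ?_
      rw [coroot_simpleRoot, hc']; norm_num
  · intro j' _ hl ih j hjj hj hd
    subst hjj
    obtain ⟨h1, h2⟩ := t.of_isLastNode hl hd
    have h3 := t.theta_eq_sum
    rw [← Finset.add_sum_erase _ _ (Finset.mem_erase.2 ⟨hj, Finset.mem_univ j⟩), t.label_last hl,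
      one_smul] at h3
    rw [← sub_eq_iff_eq_add] at h3
    rw [← h3, theta_eq, h1, Nat.cast_one, one_smul]
    refine sub_mem hth (sum_mem fun k hk => nsmul_mem ?_ _)
    simp only [Finset.mem_erase] at hk
    exact ih k (Nat.lt_succ_iff.1 k.2) (fun h => hk.1 (Fin.ext h)) k rfl hk.2.1 (h2 k)

theorem coroot_A2even_last {m : ℕ} {a b : Fin ((A2even m).rank + 1)} (ha : (a : ℕ) = m + 1)
    (hb : (b : ℕ) = m) (x : (A2even m).V) : (A2even m).coroot a x = 2 * x a - x b := by
  rw [coroot_apply]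
  have aux : ∀ j, ((A2even m).cartan a j : ℚ) * x j =
      (if j = a then 2 * x a else 0) + (if j = b then -x b else 0) := by
    intro j
    have hj : (j : ℕ) < m + 2 := j.2
    have hab : a ≠ b := fun h => by rw [h] at ha; omega
    rcases eq_or_ne j a with rfl | h1
    · rw [cartan_self]; simp [hab]
    · rcases eq_or_ne j b with rfl | h2
      · rw [cartan_eq_entry, ha, hb]
        simp [entry, Edge, mult, h1]
      · rw [cartan_eq_entry, entry_of_not_edge]
        · simp [h1, h2]
        · intro h; exact h1 (Fin.ext h.symm)
        · simp only [Edge, ne_eq, Fin.ext_iff] at *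
          omega
  rw [Finset.sum_congr rfl fun j (_ : j ∈ Finset.univ) => aux j, Finset.sum_add_distrib,
    Finset.sum_ite_eq', Finset.sum_ite_eq']
  simp [sub_eq_add_neg]

theorem coroot_A2even {m i : ℕ} (h : i < m) {a b c : Fin ((A2even m).rank + 1)}
    (ha : (a : ℕ) = i + 1) (hb : (b : ℕ) = i) (hc : (c : ℕ) = i + 2) (x : (A2even m).V) :
    (A2even m).coroot a x = 2 * x a - x b - (if i + 1 = m then 2 else 1) * x c := by
  rw [coroot_apply]
  have aux : ∀ j, ((A2even m).cartan a j : ℚ) * x j = (if j = a then 2 * x a else 0) +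
      (if j = b then -x b else 0) +
      (if j = c then -((if i + 1 = m then 2 else 1) * x c) else 0) := by
    intro j
    have hj : (j : ℕ) < m + 2 := j.2
    have hab : a ≠ b := fun h => by rw [h] at ha; omega
    have hac : a ≠ c := fun h => by rw [h] at ha; omega
    have hbc : b ≠ c := fun h => by rw [h] at hb; omega
    rcases eq_or_ne j a with rfl | h1
    · rw [cartan_self]; simp [hab, hac]
    · rcases eq_or_ne j b with rfl | h2
      · have h3 : ¬ (i + 1 = m ∧ i = m + 1) := by omega
        rw [cartan_eq_entry, ha, hb]
        simp [entry, Edge, mult, h1, hbc, h3]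
      · rcases eq_or_ne j c with rfl | h3
        · rw [cartan_eq_entry, ha, hc]
          simp only [entry, Edge, mult, h1, h2]
          by_cases h4 : i + 1 = m
          · subst h4; simp
          · simp [h4]
        · rw [cartan_eq_entry, entry_of_not_edge]
          · simp [h1, h2, h3]
          · intro h; exact h1 (Fin.ext h.symm)
          · simp only [Edge, ne_eq, Fin.ext_iff] at *
            omega
  rw [Finset.sum_congr rfl fun j (_ : j ∈ Finset.univ) => aux j, Finset.sum_add_distrib,
    Finset.sum_add_distrib, Finset.sum_ite_eq', Finset.sum_ite_eq', Finset.sum_ite_eq']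
  simp [sub_eq_add_neg]

theorem th_A2even {m : ℕ} (j : Fin ((A2even m).rank + 1)) :
    (A2even m).th j = if (j : ℕ) = 0 then 0 else if (j : ℕ) = m + 1 then 1 / 2 else 1 := by
  by_cases h : j = 0
  · subst h; rw [th_zero]; simp
  · rw [th, Pi.smul_apply, theta_apply _ h]
    have h' : (j : ℕ) ≠ 0 := fun h' => h (Fin.ext h')
    simp only [label, h', if_false]
    split_ifs <;> first | contradiction | omega | norm_num

theorem weightLattice_A2even_le {m : ℕ} {H : AddSubgroup (A2even m).V} (hth : (A2even m).th ∈ H)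
    (hH : ∀ j ≠ 0, ¬ IsDivisibleNode (A2even m) j → (A2even m).simpleRoot j ∈ H) :
    (A2even m).weightLattice ≤ H := by
  rintro x ⟨hx0, hx⟩
  obtain ⟨f, hf⟩ : ∃ f : ℕ → Fin ((A2even m).rank + 1), ∀ i, i ≤ m + 1 → (f i : ℕ) = i :=
    ⟨fun i => Fin.ofNat _ i, fun i hi => Nat.mod_eq_of_lt (Nat.lt_succ_of_le hi)⟩
  have hf0 : ∀ i, i < m + 1 → f (i + 1) ≠ 0 := fun i hi h => by
    have := hf (i + 1) (by omega)
    rw [h] at this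
    simp at this
  have hint : ∀ i, i < m + 1 → ∃ z : ℤ, (A2even m).coroot (f (i + 1)) x = z := fun i hi => by
    obtain ⟨j, hj⟩ := Fin.exists_succ_eq.2 (hf0 i hi)
    rw [← hj]; exact hx j
  set u : ℕ → ℚ := fun i => (if i = m + 1 then 2 else 1) * x (f i) with hu
  have diff : ∀ i, i ≤ m → ∃ z : ℤ, u (i + 1) - u i = z := by
    intro i hi
    induction hi using Nat.decreasingInduction with
    | self =>
      obtain ⟨z, hz⟩ := hint m (by omega)
      refine ⟨z, ?_⟩
      rw [← hz, coroot_A2even_last (hf _ le_rfl) (hf m (by omega))]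
      simp [hu]
    | of_succ k hk ih =>
      obtain ⟨z, hz⟩ := ih
      obtain ⟨z', hz'⟩ := hint k (by omega)
      refine ⟨z + z', ?_⟩
      push_cast
      rw [← hz, ← hz', coroot_A2even hk (hf _ (by omega)) (hf _ (by omega)) (hf (k + 2) (by omega))]
      simp only [hu]
      split_ifs <;> first | omega | ring
  have int : ∀ i, i ≤ m + 1 → ∃ z : ℤ, u i = z := by
    intro i
    induction i with
    | zero =>
      refine fun _ => ⟨0, ?_⟩
      have : f 0 = 0 := Fin.ext (hf 0 (by omega))
      simp only [hu, this, hx0]; simp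
    | succ i ih =>
      intro hi
      obtain ⟨z, hz⟩ := ih (by omega)
      obtain ⟨z', hz'⟩ := diff i (by omega)
      exact ⟨z + z', by push_cast; linarith⟩
  choose! z hz using int
  have hmem : z (m + 1) • (A2even m).th + ∑ k ∈ Finset.range m,
      (z (k + 1) - z (m + 1)) • (A2even m).simpleRoot (f (k + 1)) ∈ H := by
    refine add_mem (zsmul_mem hth _) (sum_mem fun k hk => zsmul_mem (hH _ ?_ ?_) _)
    · exact hf0 k (by have := Finset.mem_range.1 hk; omega)
    · have := Finset.mem_range.1 hk
      simp only [IsDivisibleNode, hf (k + 1) (by omega)]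
      omega
  convert hmem using 1
  funext j
  have hj : (j : ℕ) < m + 2 := j.2
  have hfj : f j = j := Fin.ext (hf j (by omega))
  have hs : (∑ k ∈ Finset.range m, (z (k + 1) - z (m + 1)) • (A2even m).simpleRoot (f (k + 1))) j =
      ∑ k ∈ Finset.range m, if (j : ℕ) = k + 1 then (u j - u (m + 1)) else 0 := by
    rw [Finset.sum_apply]
    refine Finset.sum_congr rfl fun k hk => ?_
    have hk := Finset.mem_range.1 hk
    have h1 := hf (k + 1) (by omega)
    split_ifs with h2
    · have : f (k + 1) = j := Fin.ext (by omega)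
      rw [hz _ (by omega), hz _ (by omega), this, h2]
      simp [simpleRoot]
    · have : j ≠ f (k + 1) := fun h => by rw [← h] at h1; omega
      simp [simpleRoot, this]
  rw [Pi.add_apply, hs, Pi.smul_apply, th_A2even]
  have hz1 := hz (m + 1) le_rfl
  rcases Nat.eq_zero_or_pos (j : ℕ) with h0 | h0
  · have : j = 0 := Fin.ext h0
    subst this
    rw [hx0]; simp
  · obtain ⟨k, hk⟩ : ∃ k, (j : ℕ) = k + 1 := ⟨j - 1, by omega⟩
    have hzj : u j = (if (j : ℕ) = m + 1 then 2 else 1) * x j := by simp only [hu, hfj]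
    simp only [hk, Nat.add_right_cancel_iff, Nat.succ_ne_zero, if_false, Finset.sum_ite_eq,
      Finset.mem_range, zsmul_eq_mul] at *
    rw [← hz1]
    split_ifs at * with h1 h2 <;> first | contradiction | omega | skip
    · subst h1; rw [hzj]; ring
    · rw [hzj]; ring

theorem finiteLattice_le {H : AddSubgroup t.V} (hth : t.th ∈ H)
    (hc : ∀ j ≠ 0, ¬ IsDivisibleNode t j → ∀ γ ∈ H, γ ∈ t.finiteLattice → t.coroot j γ = -1 →
      t.simpleRoot j ∈ H) : t.finiteLattice ≤ H := by
  have h := t.simpleRoot_mem_of_closed hth hc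
  have h' : (∀ j, ¬ IsDivisibleNode t j) → t.rootLattice ≤ H := by
    intro hd
    rw [rootLattice, AddSubgroup.closure_le]
    rintro _ ⟨i, rfl⟩
    exact h _ (Fin.succ_ne_zero i) (hd _)
  cases t
  case A2even m => exact weightLattice_A2even_le hth h
  all_goals exact h' fun _ => id

theorem finiteLattice_le_weightLattice : t.finiteLattice ≤ t.weightLattice := by
  refine t.finiteLattice_le ⟨t.th_zero, fun i => ⟨-t.cartan i.succ 0, ?_⟩⟩
    fun j hj _ _ _ _ _ => t.simpleRoot_mem_weightLattice hj
  rw [coroot_th]; push_cast; rfl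

variable {t}

theorem apply_zero_of_mem {v : t.V} (hv : v ∈ t.finiteLattice) : v 0 = 0 :=
  (t.finiteLattice_le_weightLattice hv).1

theorem exists_coroot_of_mem {v : t.V} (hv : v ∈ t.finiteLattice) {j : Fin (t.rank + 1)} (hj : j ≠ 0) :
    ∃ z : ℤ, t.coroot j v = z := by
  obtain ⟨i, rfl⟩ := Fin.exists_succ_eq.2 hj
  exact (t.finiteLattice_le_weightLattice hv).2 i

theorem s_mem_finiteLattice {v : t.V} (hv : v ∈ t.finiteLattice) {j : Fin (t.rank + 1)} (hj : j ≠ 0) :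
    t.s j v ∈ t.finiteLattice := by
  obtain ⟨z, hz⟩ := exists_coroot_of_mem hv hj
  rw [s_apply, hz, Int.cast_smul_eq_zsmul]
  exact sub_mem hv (zsmul_mem (t.simpleRoot_mem_finiteLattice hj) z)

theorem F_mem_finiteLattice {v : t.V} (hv : v ∈ t.finiteLattice) {x : t.V ≃ₗ[ℚ] t.V} (hx : x ∈ t.F) :
    x v ∈ t.finiteLattice :=
  t.F_induction (P := fun x => x v ∈ t.finiteLattice) hv
    (fun i hi y _ ih => by rw [LinearEquiv.mul_apply]; exact s_mem_finiteLattice ih hi) hx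

theorem tr_mem_W {v : t.V} (hv : v ∈ t.finiteLattice) : t.tr v ∈ t.W := by
  let H : AddSubgroup t.V :=
    { carrier := {v | t.tr v ∈ t.W}
      zero_mem' := by simp only [Set.mem_ofPred_eq, tr_zero, one_mem]
      add_mem' := fun {a b} ha hb => by
        simp only [Set.mem_ofPred_eq, tr_add] at *
        exact mul_mem ha hb
      neg_mem' := fun {a} ha => by
        simp only [Set.mem_ofPred_eq, tr_neg] at *
        exact inv_mem ha }
  have hmem : ∀ v, v ∈ H ↔ t.tr v ∈ t.W := fun _ => Iff.rfl
  refine (hmem v).1 (t.finiteLattice_le (H := H) ?_ (fun j _ _ γ hγ _ h => ?_) hv)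
  · rw [hmem, ← s_zero_mul_sTheta]
    exact mul_mem (t.s_mem_W 0) t.sTheta_mem_W
  · have h1 : t.s j γ ∈ H := by
      have h2 := mul_tr (t.s_mem_W j) γ
      rw [hmem, eq_mul_inv_of_mul_eq h2.symm]
      exact mul_mem (mul_mem (t.s_mem_W j) hγ) (inv_mem (t.s_mem_W j))
    have h2 : t.simpleRoot j = t.s j γ - γ := by rw [s_apply, h]; module
    rw [h2]
    exact sub_mem h1 hγ

theorem mem_finiteLattice_of_int {v : t.V} (h0 : v 0 = 0) (h : ∀ k, ∃ z : ℤ, v k = z) :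
    v ∈ t.finiteLattice := by
  choose z hz using h
  have : v = ∑ k ∈ Finset.univ.erase (0 : Fin (t.rank + 1)), z k • t.simpleRoot k := by
    ext j
    rw [Finset.sum_apply]
    rcases eq_or_ne j 0 with rfl | hj
    · rw [h0]
      refine (Finset.sum_eq_zero fun k hk => ?_).symm
      simp [simpleRoot, (Finset.mem_erase.1 hk).1.symm]
    · rw [hz, Finset.sum_eq_single j]
      · simp [simpleRoot]
      · intro k _ hk
        simp [simpleRoot, hk.symm]
      · intro h; exact absurd (Finset.mem_erase.2 ⟨hj, Finset.mem_univ _⟩) h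
  rw [this]
  exact sum_mem fun k hk => zsmul_mem (t.simpleRoot_mem_finiteLattice (Finset.mem_erase.1 hk).1) _

theorem eq_zero_of_coroot {v : t.V} (h0 : v 0 = 0) (h : ∀ j ≠ 0, t.coroot j v = 0) : v = 0 := by
  refine t.eq_zero_of_bil_self v ?_ h0
  rw [bil_apply]
  refine Finset.sum_eq_zero fun k _ => ?_
  rcases eq_or_ne k 0 with rfl | hk
  · rw [h0]; simp
  · rw [h k hk]; simp

variable (t) in
theorem exists_dominant (c : Fin (t.rank + 1) → ℚ) : ∃ N : ℕ, 0 < N ∧ ∃ v ∈ t.finiteLattice,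
    ∀ j ≠ 0, t.coroot j v = N * c j := by
  let ι : (Fin t.rank → ℚ) →ₗ[ℚ] t.V := LinearMap.pi (Fin.cons 0 fun i => LinearMap.proj i)
  have hι0 : ∀ y, ι y 0 = 0 := fun y => rfl
  have hιs : ∀ y i, ι y (Fin.succ i) = y i := fun y i => rfl
  let Φ : (Fin t.rank → ℚ) →ₗ[ℚ] (Fin t.rank → ℚ) := LinearMap.pi fun i => t.coroot i.succ ∘ₗ ι
  have hΦ : ∀ y i, Φ y i = t.coroot i.succ (ι y) := fun y i => rfl
  have hinj : Function.Injective Φ := by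
    rw [injective_iff_map_eq_zero]
    intro y hy
    have : ι y = 0 := eq_zero_of_coroot (hι0 y) fun j hj => by
      obtain ⟨i, rfl⟩ := Fin.exists_succ_eq.2 hj
      rw [← hΦ, hy]; rfl
    ext i
    have h := hιs y i
    rw [← h, this]; rfl
  obtain ⟨y, hy⟩ := (LinearMap.injective_iff_surjective.1 hinj) fun i => c i.succ
  refine ⟨∏ i, (y i).den, Finset.prod_pos fun i _ => (y i).den_pos,
    ((∏ i, (y i).den : ℕ) : ℚ) • ι y, mem_finiteLattice_of_int ?_ fun k => ?_, fun j hj => ?_⟩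
  · rw [Pi.smul_apply, hι0, smul_zero]
  · rcases eq_or_ne k 0 with rfl | hk
    · exact ⟨0, by rw [Pi.smul_apply, hι0]; simp⟩
    · obtain ⟨i, rfl⟩ := Fin.exists_succ_eq.2 hk
      refine ⟨(∏ l ∈ Finset.univ.erase i, ((y l).den : ℤ)) * (y i).num, ?_⟩
      rw [Pi.smul_apply, hιs, ← Finset.prod_erase_mul _ _ (Finset.mem_univ i)]
      push_cast
      rw [smul_eq_mul, mul_assoc, Rat.den_mul_eq_num]
  · obtain ⟨i, rfl⟩ := Fin.exists_succ_eq.2 hj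
    rw [map_smul, ← hΦ, hy, smul_eq_mul]

end AffineType
end TripleArtin

namespace TripleArtin
namespace AffineType

variable {t : AffineType}

/-! ### The Bernstein presentation -/

theorem IsRoot.pos_iff {v r : t.V} {c m : ℚ} (hv : t.IsRoot v) (hc : 0 < c) (h0 : r 0 = 0)
    (he : v = c • r + m • t.dl) : t.Pos v ↔ 0 < m ∨ (m = 0 ∧ t.Pos r) := by
  have hm : v 0 = m := by
    rw [he, Pi.add_apply, Pi.smul_apply, Pi.smul_apply, h0, dl_zero]; simp
  constructor
  · intro h
    rcases (h.2 0).lt_or_eq with h' | h'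
    · left; rwa [hm] at h'
    · right
      rw [hm] at h'
      refine ⟨h'.symm, Pos.of_smul hc ?_⟩
      rw [he, ← h', zero_smul, add_zero] at h
      exact h
  · rintro (h | ⟨h, h'⟩)
    · exact hv.pos_of_coord (k := 0) (by rwa [hm])
    · rw [he, h, zero_smul, add_zero]
      exact h'.smul hc

/-- Dominant vectors. -/
def Dom (v : t.V) : Prop := ∀ j ≠ 0, 0 ≤ t.coroot j v

theorem Dom.add {v w : t.V} (hv : Dom v) (hw : Dom w) : Dom (v + w) := fun j hj => by
  rw [map_add]; exact add_nonneg (hv j hj) (hw j hj)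

theorem Dom.bil_nonneg {v r : t.V} (hv : Dom v) (hr : t.Pos r) (h0 : r 0 = 0) :
    0 ≤ t.bil v r := by
  rw [bil_comm, bil_apply]
  refine Finset.sum_nonneg fun k _ => ?_
  rcases eq_or_ne k 0 with rfl | hk
  · rw [h0]; simp
  · have : (0 : ℚ) < t.sym k := by exact_mod_cast t.sym_pos k
    exact mul_nonneg (mul_nonneg (hr.2 k) this.le) (hv k hk)

theorem Dom.bil_nonpos {v r : t.V} (hv : Dom v) (hr : t.IsRoot r) (hn : ¬ t.Pos r) (h0 : r 0 = 0) :
    t.bil v r ≤ 0 := by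
  have := hv.bil_nonneg (hr.pos_neg_iff.2 hn) (by simp [h0])
  rw [map_neg] at this
  linarith

theorem tr_finite_part (u r : t.V) (c m : ℚ) :
    t.tr u (c • r + m • t.dl) = c • r + (m - c * t.bil u r) • t.dl := by
  rw [tr_apply, map_add, map_smul, map_smul, bil_dl_right]
  simp only [smul_eq_mul]
  module

section

variable {G : Type*} [Group G] {T : Fin (t.rank + 1) → G}

theorem weylLift_tr_add (hT : t.IsBraided T) {u v : t.V} (hu : u ∈ t.finiteLattice)
    (hv : v ∈ t.finiteLattice) (hu' : Dom u) (hv' : Dom v) :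
    weylLift T (t.tr (u + v)) = weylLift T (t.tr u) * weylLift T (t.tr v) := by
  rw [tr_add]
  refine weylLift_mul hT (tr_mem_W hu) (tr_mem_W hv) fun w hw hp hn hp' => ?_
  obtain ⟨c, hc, r, hr, hr0, he⟩ := hw.exists_finite_part
  have e1 : t.tr v w = c • r + (w 0 - c * t.bil v r) • t.dl := by
    conv_lhs => rw [he]
    exact tr_finite_part _ _ _ _
  have e2 : t.tr u (t.tr v w) = c • r + (w 0 - c * t.bil v r - c * t.bil u r) • t.dl := by
    rw [e1]; exact tr_finite_part _ _ _ _
  rw [hw.pos_iff hc hr0 he] at hp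
  rw [(hw.map (tr_mem_W hv)).pos_iff hc hr0 e1] at hn
  rw [((hw.map (tr_mem_W hv)).map (tr_mem_W hu)).pos_iff hc hr0 e2] at hp'
  push Not at hn
  by_cases hr' : t.Pos r
  · have h1 := mul_nonneg hc.le (hu'.bil_nonneg hr' hr0)
    have h2 : w 0 - c * t.bil v r < 0 := lt_of_le_of_ne hn.1 fun h => hn.2 h hr'
    rcases hp' with h | h
    · linarith
    · linarith [h.1]
  · have h1 := mul_nonneg hc.le (neg_nonneg.2 (hv'.bil_nonpos hr hr' hr0))
    rcases hp with h | h
    · linarith [hn.1]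
    · exact hr' h.2

theorem dom_th : Dom t.th := fun j hj => by
  rw [coroot_th]
  have : (t.cartan j 0 : ℚ) ≤ 0 := by exact_mod_cast t.cartan_nonpos hj
  linarith

theorem weylLift_tr_th (hT : t.IsBraided T) :
    weylLift T (t.tr t.th) = T 0 * weylLift T t.sTheta := by
  rw [← s_zero_mul_sTheta]
  refine weylLift_s_mul hT t.sTheta_mem_W ?_
  refine ((t.isRoot_simpleRoot 0).map (inv_mem t.sTheta_mem_W)).pos_of_coord (k := 0) ?_
  rw [F_apply_zero t (inv_mem t.sTheta_mem_F)]
  simp [simpleRoot]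

theorem commute_weylLift_tr (hT : t.IsBraided T) {i : Fin (t.rank + 1)} {v : t.V}
    (hv : v ∈ t.finiteLattice) (h : t.coroot i v = 0) : Commute (T i) (weylLift T (t.tr v)) := by
  have h1 : ∀ c : ℚ, t.tr (c • v) (t.simpleRoot i) = t.simpleRoot i := fun c => by
    rw [tr_apply, map_smul, LinearMap.smul_apply, bil_simpleRoot_right, h]; simp
  have h2 := weylLift_mul_s hT (tr_mem_W hv) (i := i) (by
    have := h1 1
    rw [one_smul] at this
    rw [this]; exact t.pos_simpleRoot i)
  have h3 := weylLift_s_mul hT (tr_mem_W hv) (i := i) (by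
    have := h1 (-1)
    rw [neg_one_smul, tr_neg] at this
    rw [this]; exact t.pos_simpleRoot i)
  have h4 := mul_tr (t.s_mem_W i) v
  rw [s_apply, h, zero_smul, sub_zero] at h4
  rw [Commute, SemiconjBy, ← h3, ← h2, h4]

/-- Lusztig's relation for dominant vectors. -/
theorem weylLift_tr_add_s (hT : t.IsBraided T) {i : Fin (t.rank + 1)} (hi : i ≠ 0)
    (hd : ¬ IsDivisibleNode t i) {v : t.V} (hv : v ∈ t.finiteLattice) (hv' : Dom v)
    (h : t.coroot i v = 1) : weylLift T (t.tr (v + t.s i v)) =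
      weylLift T (t.tr v) * (T i)⁻¹ * (weylLift T (t.tr v) * (T i)⁻¹) := by
  have hs := t.s_mem_W i
  have hdi : (0 : ℚ) < t.sym i := by exact_mod_cast t.sym_pos i
  have hx : t.tr v * t.s i ∈ t.W := mul_mem (tr_mem_W hv) hs
  have hxs : t.tr v * t.s i * t.s i = t.tr v := by rw [mul_assoc, s_mul_s, mul_one]
  have h1 : weylLift T (t.tr v) * (T i)⁻¹ = weylLift T (t.tr v * t.s i) := by
    rw [mul_inv_eq_iff_eq_mul, ← weylLift_mul_s hT hx, hxs]
    refine ((isRoot_simpleRoot i).map hx).pos_of_coord (k := 0) ?_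
    rw [LinearEquiv.mul_apply, s_simpleRoot_self, tr_apply, map_neg, bil_simpleRoot_right, h,
      Pi.sub_apply, Pi.smul_apply, dl_zero]
    simp [simpleRoot, hi.symm, hdi]
  rw [h1]
  have h2 : t.tr (v + t.s i v) = t.tr v * t.s i * (t.tr v * t.s i) := by
    rw [tr_add, ← mul_assoc, mul_assoc (t.tr v), mul_tr hs, ← mul_assoc, mul_assoc _ (t.s i), s_mul_s,
      mul_one]
  rw [h2]
  refine weylLift_mul hT hx hx fun w hw hp hn hp' => ?_
  obtain ⟨c, hc, r, hr, hr0, he⟩ := hw.exists_finite_part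
  have hr0' : t.s i r 0 = 0 := by rw [s_apply_of_ne t hi.symm, hr0]
  have hsr : t.IsRoot (t.s i r) := hr.map hs
  have e1 : (t.tr v * t.s i) w = c • t.s i r + (w 0 - c * t.bil v (t.s i r)) • t.dl := by
    conv_lhs => rw [he]
    rw [LinearEquiv.mul_apply, map_add, map_smul, map_smul, s_dl]
    exact tr_finite_part _ _ _ _
  have e2 : (t.tr v * t.s i) ((t.tr v * t.s i) w) =
      c • r + (w 0 - c * t.bil v (t.s i r) - c * t.bil v r) • t.dl := by
    rw [e1, LinearEquiv.mul_apply, map_add, map_smul, map_smul, s_dl, s_s_apply]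
    exact tr_finite_part _ _ _ _
  rw [hw.pos_iff hc hr0 he] at hp
  rw [(hw.map hx).pos_iff hc hr0' e1] at hn
  rw [((hw.map hx).map hx).pos_iff hc hr0 e2] at hp'
  push Not at hn
  by_cases hri : r = t.simpleRoot i
  · have e : t.bil v (t.s i r) = - t.sym i := by
      rw [hri, s_simpleRoot_self, map_neg, bil_simpleRoot_right, h, mul_one]
    have := mul_pos hc hdi
    have hw0 : 0 ≤ w 0 := by
      rcases hp with h | h
      · exact h.le
      · exact h.1.ge
    rw [e] at hn
    linarith [hn.1]
  by_cases hri' : -r = t.simpleRoot i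
  · have hri2 : r = -t.simpleRoot i := by rw [← hri', neg_neg]
    have hsr : t.s i r = t.simpleRoot i := by rw [hri2, map_neg, s_simpleRoot_self, neg_neg]
    have e : t.bil v (t.s i r) = t.sym i := by
      rw [hsr, bil_simpleRoot_right, h, mul_one]
    have hnr : ¬ t.Pos r := by rw [hri2]; exact (t.pos_simpleRoot i).not_neg
    rw [e, hsr] at hn
    have hw0 : 0 < w 0 := hp.resolve_right fun h => hnr h.2
    have hw1 : w 0 < c * t.sym i := by
      have := lt_of_le_of_ne hn.1 fun h => hn.2 h (t.pos_simpleRoot i)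
      linarith
    obtain ⟨j, hj, hj'⟩ := hw.exists_norm
    have hcj : (t.sym j : ℚ) = c ^ 2 * t.sym i := by
      rw [he, hri2] at hj'
      simp only [map_add, map_smul, LinearMap.add_apply, LinearMap.smul_apply, bil_dl_right,
        bil_dl_left, map_neg, LinearMap.neg_apply, bil_simpleRoot_left, coroot_simpleRoot_self,
        smul_eq_mul] at hj'
      linear_combination -(1 / 2) * hj'
    have hji := t.sym_eq_of_sq j hi hd hcj
    rw [hji] at hcj hj
    have hc1 : c = 1 := by
      have h3 : (c - 1) * (c + 1) = 0 := by
        have h4 : (t.sym i : ℚ) * ((c - 1) * (c + 1)) = 0 := by linear_combination -hcj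
        exact (mul_eq_zero.1 h4).resolve_left hdi.ne'
      rcases mul_eq_zero.1 h3 with h | h <;> linarith
    obtain ⟨z, hz⟩ := (t.mem_lat.1 hj).2 0
    rw [Fin.val_zero, sym_zero, Int.cast_one, one_mul] at hz
    rw [hz] at hw0 hw1
    rw [hc1, one_mul] at hw1
    have h5 : 0 < t.sym i * z := by exact_mod_cast hw0
    have h6 : t.sym i * z < t.sym i := by exact_mod_cast hw1
    have h7 := t.sym_pos i
    have h8 : 0 < z := by
      by_contra hz'
      push Not at hz'
      nlinarith
    nlinarith
  · by_cases hr' : t.Pos r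
    · have hp2 := hr.pos_s hr' hri
      have h3 := mul_nonneg hc.le (hv'.bil_nonneg hr' hr0)
      have h4 : w 0 - c * t.bil v (t.s i r) < 0 := lt_of_le_of_ne hn.1 fun h => hn.2 h hp2
      rcases hp' with h | h
      · linarith
      · linarith [h.1]
    · have hp2 := hr.neg.pos_s (hr.pos_neg_iff.2 hr') hri'
      rw [map_neg, hsr.pos_neg_iff] at hp2
      have h1 := mul_nonneg hc.le (neg_nonneg.2 (hv'.bil_nonpos hsr hp2 hr0'))
      rcases hp with h | h
      · linarith [hn.1]
      · exact hr' h.2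

/-- `w = u - v` with `u` and `v` dominant and, if `i ≠ 0`, `(v, α_i^∨) = 0`. -/
theorem exists_sub_dom {w : t.V} (hw : w ∈ t.finiteLattice) (i : Fin (t.rank + 1))
    (hi : i ≠ 0 → 0 ≤ t.coroot i w) : ∃ u ∈ t.finiteLattice, ∃ v ∈ t.finiteLattice, Dom u ∧ Dom v ∧
      w = u - v ∧ (i ≠ 0 → t.coroot i v = 0) := by
  obtain ⟨N, hN, v, hv, h⟩ := t.exists_dominant fun j => if j = i then 0 else |t.coroot j w|
  have hN' : (1 : ℚ) ≤ N := by exact_mod_cast hN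
  refine ⟨w + v, add_mem hw hv, v, hv, fun j hj => ?_, fun j hj => ?_, by abel, fun hi => ?_⟩
  · rw [map_add, h j hj]
    split_ifs with hji
    · rw [hji]; simpa using hi (hji ▸ hj)
    · have h1 := neg_abs_le (t.coroot j w)
      have h2 := abs_nonneg (t.coroot j w)
      nlinarith
  · rw [h j hj]
    split_ifs
    · simp
    · positivity
  · rw [h i hi, if_pos rfl, mul_zero]

open Classical in
/-- The extension of `v ↦ T_{tr v}` from dominant vectors to all of `finiteLattice`. -/
noncomputable def bernstein (T : Fin (t.rank + 1) → G) (w : t.V) : G :=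
  if h : ∃ p : t.V × t.V, p.1 ∈ t.finiteLattice ∧ p.2 ∈ t.finiteLattice ∧ Dom p.1 ∧ Dom p.2 ∧
    w = p.1 - p.2 then weylLift T (t.tr h.choose.1) * (weylLift T (t.tr h.choose.2))⁻¹ else 1

theorem commute_weylLift_tr_tr (hT : t.IsBraided T) {u v : t.V} (hu : u ∈ t.finiteLattice)
    (hv : v ∈ t.finiteLattice) (hu' : Dom u) (hv' : Dom v) :
    Commute (weylLift T (t.tr u)) (weylLift T (t.tr v)) := by
  rw [Commute, SemiconjBy, ← weylLift_tr_add hT hu hv hu' hv', ← weylLift_tr_add hT hv hu hv' hu',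
    add_comm u]

theorem bernstein_sub (hT : t.IsBraided T) {u v : t.V} (hu : u ∈ t.finiteLattice)
    (hv : v ∈ t.finiteLattice) (hu' : Dom u) (hv' : Dom v) :
    bernstein T (u - v) = weylLift T (t.tr u) * (weylLift T (t.tr v))⁻¹ := by
  have h : ∃ p : t.V × t.V, p.1 ∈ t.finiteLattice ∧ p.2 ∈ t.finiteLattice ∧ Dom p.1 ∧ Dom p.2 ∧
    u - v = p.1 - p.2 := ⟨(u, v), hu, hv, hu', hv', rfl⟩
  rw [bernstein, dif_pos h]
  obtain ⟨h1, h2, h3, h4, h5⟩ := h.choose_spec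
  generalize h.choose = p at *
  have h6 : p.1 + v = u + p.2 := by
    rw [sub_eq_sub_iff_add_eq_add] at h5; exact h5.symm
  have h7 := weylLift_tr_add hT h1 hv h3 hv'
  rw [h6, weylLift_tr_add hT hu h2 hu' h4] at h7
  rw [mul_inv_eq_iff_eq_mul, mul_assoc, ← (commute_weylLift_tr_tr hT h2 hv h4 hv').inv_right.eq,
    ← mul_assoc, h7, mul_assoc, mul_inv_cancel, mul_one]

theorem bernstein_dom (hT : t.IsBraided T) {u : t.V} (hu : u ∈ t.finiteLattice) (hu' : Dom u) :
    bernstein T u = weylLift T (t.tr u) := by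
  have := bernstein_sub hT hu (zero_mem _) hu' (fun j _ => by rw [map_zero])
  rwa [sub_zero, tr_zero, weylLift_one hT, inv_one, mul_one] at this

theorem bernstein_add (hT : t.IsBraided T) {v w : t.V} (hv : v ∈ t.finiteLattice)
    (hw : w ∈ t.finiteLattice) : bernstein T (v + w) = bernstein T v * bernstein T w := by
  obtain ⟨a, ha, b, hb, ha', hb', rfl, -⟩ := exists_sub_dom hv 0 fun h => absurd rfl h
  obtain ⟨c, hc, d, hd, hc', hd', rfl, -⟩ := exists_sub_dom hw 0 fun h => absurd rfl h
  rw [bernstein_sub hT ha hb ha' hb', bernstein_sub hT hc hd hc' hd', sub_add_sub_comm,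
    bernstein_sub hT (add_mem ha hc) (add_mem hb hd) (ha'.add hc') (hb'.add hd'),
    weylLift_tr_add hT ha hc ha' hc', add_comm b, weylLift_tr_add hT hd hb hd' hb', mul_inv_rev,
    mul_assoc, mul_assoc, ← mul_assoc _ _ (weylLift T (t.tr d))⁻¹,
    (commute_weylLift_tr_tr hT hc hb hc' hb').inv_right.eq, mul_assoc]

theorem bernstein_zero (hT : t.IsBraided T) : bernstein T (0 : t.V) = 1 := by
  have := bernstein_add hT (zero_mem t.finiteLattice) (zero_mem t.finiteLattice)
  rwa [add_zero, eq_comm, mul_eq_right] at this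

theorem bernstein_neg (hT : t.IsBraided T) {v : t.V} (hv : v ∈ t.finiteLattice) :
    bernstein T (-v) = (bernstein T v)⁻¹ := by
  rw [eq_inv_iff_mul_eq_one, ← bernstein_add hT (neg_mem hv) hv, neg_add_cancel, bernstein_zero hT]

theorem commute_bernstein_bernstein (hT : t.IsBraided T) {v w : t.V} (hv : v ∈ t.finiteLattice)
    (hw : w ∈ t.finiteLattice) : Commute (bernstein T v) (bernstein T w) := by
  rw [Commute, SemiconjBy, ← bernstein_add hT hv hw, ← bernstein_add hT hw hv, add_comm v]

theorem bernstein_th (hT : t.IsBraided T) : bernstein T t.th = T 0 * weylLift T t.sTheta := by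
  rw [bernstein_dom hT t.th_mem dom_th, weylLift_tr_th hT]

theorem commute_bernstein (hT : t.IsBraided T) {i : Fin (t.rank + 1)} (hi : i ≠ 0) {w : t.V}
    (hw : w ∈ t.finiteLattice) (h : t.coroot i w = 0) : Commute (T i) (bernstein T w) := by
  obtain ⟨u, hu, v, hv, hu', hv', rfl, hiv⟩ := exists_sub_dom hw i fun _ => h.ge
  rw [bernstein_sub hT hu hv hu' hv']
  rw [map_sub, hiv hi, sub_zero] at h
  exact (commute_weylLift_tr hT hu h).mul_right (commute_weylLift_tr hT hv (hiv hi)).inv_right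

theorem inv_mul_bernstein_mul_inv (hT : t.IsBraided T) {i : Fin (t.rank + 1)} (hi : i ≠ 0)
    (hd : ¬ IsDivisibleNode t i) {w : t.V} (hw : w ∈ t.finiteLattice) (h : t.coroot i w = 1) :
    (T i)⁻¹ * bernstein T w * (T i)⁻¹ = bernstein T (t.s i w) := by
  obtain ⟨u, hu, v, hv, hu', hv', rfl, hiv⟩ := exists_sub_dom hw i fun _ => by rw [h]; norm_num
  have hiv := hiv hi
  have hsv : t.s i v = v := by rw [s_apply, hiv, zero_smul, sub_zero]
  rw [map_sub, hiv, sub_zero] at h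
  have hsu := s_mem_finiteLattice hu hi
  have hdom : Dom (u + t.s i u) := fun j hj => by
    rw [s_apply, h, map_add, map_sub, one_smul, coroot_simpleRoot]
    rcases eq_or_ne j i with rfl | hji
    · rw [h, cartan_self]; norm_num
    · have h1 : (t.cartan j i : ℚ) ≤ 0 := by exact_mod_cast t.cartan_nonpos hji
      linarith [hu' j hj]
  have h1 := weylLift_tr_add_s hT hi hd hu hu' h
  rw [← bernstein_dom hT (add_mem hu hsu) hdom, bernstein_add hT hu hsu, bernstein_dom hT hu hu',
    mul_assoc, mul_right_inj] at h1
  rw [map_sub, hsv, sub_eq_add_neg, sub_eq_add_neg, bernstein_add hT hu (neg_mem hv),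
    bernstein_add hT hsu (neg_mem hv), h1, bernstein_dom hT hu hu', bernstein_neg hT hv,
    bernstein_dom hT hv hv']
  have h2 := (commute_weylLift_tr hT hv hiv).inv_left.inv_right.eq
  simp only [mul_assoc]
  rw [h2]

theorem mul_bernstein_mul (hT : t.IsBraided T) {i : Fin (t.rank + 1)} (hi : i ≠ 0)
    (hd : ¬ IsDivisibleNode t i) {w : t.V} (hw : w ∈ t.finiteLattice) (h : t.coroot i w = -1) :
    T i * bernstein T w * T i = bernstein T (t.s i w) := by
  have := inv_mul_bernstein_mul_inv hT hi hd (s_mem_finiteLattice hw hi) (by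
    rw [s_apply, map_sub, map_smul, coroot_simpleRoot_self, h]; norm_num)
  rw [s_s_apply] at this
  rw [← this]
  group

end

end AffineType
end TripleArtin

namespace TripleArtin
namespace AffineType

variable {t : AffineType}

/-! ### Triples of braided families -/

section

variable {G : Type*} [Group G] {T T' : Fin (t.rank + 1) → G}

theorem IsBraided.commute (hT : t.IsBraided T) {i j : Fin (t.rank + 1)} (h : i ≠ j)
    (hc : t.cartan i j = 0) : Commute (T i) (T j) := by
  have hl : t.braidLength i j = 2 := by rw [braidLength, laces, hc]; simp
  have := hT i j h
  rw [hl] at this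
  simpa [alternating, Commute, SemiconjBy] using this

theorem IsBraided.braid_three (hT : t.IsBraided T) {i j : Fin (t.rank + 1)} (h : i ≠ j)
    (h1 : t.cartan i j = -1) (h2 : t.cartan j i = -1) : T i * T j * T i = T j * T i * T j := by
  have hl : t.braidLength i j = 3 := by rw [braidLength, laces, h1, h2]; norm_num
  have := hT i j h
  rw [hl] at this
  simpa [alternating, mul_assoc] using this

theorem IsBraided.braid_four (hT : t.IsBraided T) {i j : Fin (t.rank + 1)} (h : i ≠ j)
    (h1 : t.cartan i j = -2) (h2 : t.cartan j i = -1) :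
    T i * T j * T i * T j = T j * T i * T j * T i := by
  have hl : t.braidLength i j = 4 := by rw [braidLength, laces, h1, h2]; norm_num
  have := hT i j h
  rw [hl] at this
  simpa [alternating, mul_assoc] using this

theorem exists_red_of_mem_F {x : t.V ≃ₗ[ℚ] t.V} (hx : x ∈ t.F) :
    ∃ w : List (Fin t.rank), t.Red (w.map Fin.succ) ∧ t.wordProd (w.map Fin.succ) = x := by
  obtain ⟨w, rfl⟩ := t.exists_word_of_mem_F hx
  obtain ⟨w', h2, h3, h4⟩ := exists_red (t := t) (w.map Fin.succ)
  obtain ⟨v, h5, rfl⟩ := List.sublist_map_iff.1 h2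
  exact ⟨v, h3, h4⟩

theorem weylLift_congr (hT : t.IsBraided T) (hT' : t.IsBraided T') (h : ∀ i ≠ 0, T i = T' i)
    {x : t.V ≃ₗ[ℚ] t.V} (hx : x ∈ t.F) : weylLift T x = weylLift T' x := by
  obtain ⟨w, hw, rfl⟩ := exists_red_of_mem_F hx
  rw [weylLift_wordProd hT hw, weylLift_wordProd hT' hw, List.map_map, List.map_map]
  congr 2
  funext i
  exact h _ (Fin.succ_ne_zero i)

theorem weylLift_conj (hT : t.IsBraided T) {x : t.V ≃ₗ[ℚ] t.V} (hx : x ∈ t.W)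
    {i j : Fin (t.rank + 1)} (h : x (t.simpleRoot i) = t.simpleRoot j) :
    T j * weylLift T x = weylLift T x * T i := by
  rw [← weylLift_mul_s hT hx (by rw [h]; exact t.pos_simpleRoot j), conj_s hx h,
    weylLift_s_mul hT hx]
  rw [← h, aut_inv_apply]
  exact t.pos_simpleRoot i

/-- A group with three families satisfying the braid relations which differ only at the affine
node, subject to the relations of the presentation with a tripled affine node. -/
structure IsTriple (t : AffineType) (T₁ T₂ T₃ : Fin (t.rank + 1) → G) : Prop where
  braided₁ : t.IsBraided T₁
  braided₂ : t.IsBraided T₂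
  braided₃ : t.IsBraided T₃
  eq₂ : ∀ i ≠ 0, T₂ i = T₁ i
  eq₃ : ∀ i ≠ 0, T₃ i = T₁ i
  double : ∀ i ≠ 0, t.laces 0 i = 2 → Commute (T₁ 0) ((T₁ i)⁻¹ * T₃ 0 * T₁ i)
  central : ∀ x, Commute (T₁ 0 * T₂ 0 * T₃ 0 * weylLift T₁ t.sTheta) x

theorem th_pos {k : Fin (t.rank + 1)} (hk : k ≠ 0) : 0 < t.th k := by
  have h0 : (0 : ℚ) < t.label 0 := by exact_mod_cast t.label_zero_pos
  have h1 : (0 : ℚ) < t.label k := by exact_mod_cast t.label_pos k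
  rw [th, Pi.smul_apply, theta_apply t hk]
  exact mul_pos (inv_pos.2 h0) h1

theorem exists_ne_ne (hr : t.rank ≠ 1) (i : Fin (t.rank + 1)) : ∃ k, k ≠ 0 ∧ k ≠ i := by
  have h1 := t.rank_pos
  by_cases h : (i : ℕ) = 1
  · exact ⟨⟨2, by omega⟩, by simp [Fin.ext_iff], by simp [Fin.ext_iff, h]⟩
  · exact ⟨⟨1, by omega⟩, by simp [Fin.ext_iff], fun h' => h (by rw [← h'])⟩

theorem sym_eq_of_cartan {i : Fin (t.rank + 1)} {a : ℤ} (h : t.cartan 0 i = a)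
    (h' : t.cartan i 0 = -1) : t.sym i = -a := by
  have := t.sym_mul_cartan 0 i
  rw [h, h', Fin.val_zero, sym_zero] at this
  omega

theorem not_isDivisibleNode_of_cartan {i : Fin (t.rank + 1)} {a : ℤ} (ha : -2 ≤ a)
    (hc : t.cartan 0 i = a) (hc' : t.cartan i 0 = -1) : ¬ IsDivisibleNode t i := by
  rw [isDivisibleNode_iff, sym_eq_of_cartan hc hc']
  omega

theorem simpleRoot_eq_th (hr : t.rank = 1) {j : Fin (t.rank + 1)} (hj : j ≠ 0)
    (hd : ¬ IsDivisibleNode t j) : t.simpleRoot j = t.th := by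
  have h1 : (j : ℕ) = 1 := by
    have := j.2
    have h2 : (j : ℕ) ≠ 0 := fun h => hj (Fin.ext h)
    omega
  have hl : t.IsLastNode j := by
    cases t <;> simp only [rank, IsLastNode, IsDivisibleNode] at * <;> omega
  have h0 := (t.of_isLastNode hl hd).1
  funext k
  rcases eq_or_ne k 0 with rfl | hk
  · rw [th_zero]; simp [simpleRoot, hj.symm]
  · have hkj : k = j := by
      have := k.2
      have h2 : (k : ℕ) ≠ 0 := fun h => hk (Fin.ext h)
      exact Fin.ext (by omega)
    rw [hkj, th, Pi.smul_apply, theta_apply t hj, h0, t.label_last hl]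
    simp [simpleRoot]

theorem cartan_zero_of_simple {i j : Fin (t.rank + 1)} (hj : j ≠ 0) (h : t.cartan 0 i = -1) :
    t.cartan 0 j = -1 ∨ t.cartan 0 j = 0 := by
  have hi := i.2
  have hj' := j.2
  have hj0 : (j : ℕ) ≠ 0 := fun h => hj (Fin.ext h)
  rw [cartan_eq_entry] at *
  generalize (i : ℕ) = i at *
  generalize (j : ℕ) = j at *
  rw [Fin.val_zero] at *
  cases t <;> simp only [rank, entry, Edge, mult] at * <;> split_ifs at * <;>
    first | omega | contradiction | (norm_num at *; done) | (exfalso; norm_num at *; omega)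

theorem cartan_zero_cases {j : Fin (t.rank + 1)} (hj : j ≠ 0) :
    (t.cartan 0 j = 0 ∧ t.cartan j 0 = 0) ∨ (t.cartan 0 j = -1 ∧ t.cartan j 0 = -1) ∨
    (t.cartan 0 j = -2 ∧ t.cartan j 0 = -1) ∨ (t.cartan 0 j * t.cartan j 0 = 4 ∧ t.rank = 1) := by
  rw [cartan_eq_entry, cartan_eq_entry]
  exact t.zero_node_cases (Nat.lt_succ_iff.1 j.2) fun h => hj (Fin.ext h)

theorem pos_conj_sTheta {i : Fin (t.rank + 1)} (hr : t.rank ≠ 1) (h : t.cartan i 0 = -1) :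
    t.Pos ((t.s i * t.sTheta * t.s i) (t.simpleRoot i)) ∧
      t.Pos ((t.s i * t.sTheta)⁻¹ (t.simpleRoot i)) := by
  obtain ⟨k, hk0, hki⟩ := exists_ne_ne hr i
  have hs := t.s_mem_W i
  have hd : (0 : ℚ) < t.sym i := by exact_mod_cast t.sym_pos i
  have hx : t.s i * t.sTheta * t.s i ∈ t.W := mul_mem (mul_mem hs t.sTheta_mem_W) hs
  have hki' : t.simpleRoot i k = 0 := by simp [simpleRoot, hki]
  have e : t.sTheta (t.simpleRoot i) k < 0 := by
    rw [sTheta_apply, bil_simpleRoot_right, coroot_th, h, Pi.sub_apply, hki', Pi.smul_apply]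
    have := mul_pos hd (th_pos hk0)
    push_cast
    rw [smul_eq_mul]
    linarith
  constructor
  · refine ((isRoot_simpleRoot i).map hx).pos_of_coord (k := k) ?_
    rw [LinearEquiv.mul_apply, LinearEquiv.mul_apply, s_simpleRoot_self, s_apply_of_ne t hki, map_neg,
      Pi.neg_apply]
    linarith
  · refine ((isRoot_simpleRoot i).map (inv_mem (mul_mem hs t.sTheta_mem_W))).pos_of_coord (k := k) ?_
    rw [mul_inv_rev, s_inv, sTheta_inv, LinearEquiv.mul_apply, s_simpleRoot_self, map_neg,
      Pi.neg_apply]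
    linarith

theorem conj_sTheta_inv (i : Fin (t.rank + 1)) :
    (t.s i * t.sTheta * t.s i)⁻¹ = t.s i * t.sTheta * t.s i := by
  rw [mul_inv_rev, mul_inv_rev, s_inv, sTheta_inv, mul_assoc]

theorem conj_sTheta_mem_F {i : Fin (t.rank + 1)} (hi : i ≠ 0) : t.s i * t.sTheta * t.s i ∈ t.F :=
  mul_mem (mul_mem (t.s_mem_F hi) t.sTheta_mem_F) (t.s_mem_F hi)

theorem conj_sTheta_mem_W (i : Fin (t.rank + 1)) : t.s i * t.sTheta * t.s i ∈ t.W :=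
  mul_mem (mul_mem (t.s_mem_W i) t.sTheta_mem_W) (t.s_mem_W i)

theorem weylLift_sTheta_mul_s (hT : t.IsBraided T) {i : Fin (t.rank + 1)} (hr : t.rank ≠ 1)
    (h : t.cartan i 0 = -1) :
    weylLift T (t.sTheta * t.s i) = T i * weylLift T (t.s i * t.sTheta * t.s i) := by
  rw [← weylLift_s_mul hT (conj_sTheta_mem_W i), ← mul_assoc, ← mul_assoc, s_mul_s, one_mul]
  rw [conj_sTheta_inv]
  exact (pos_conj_sTheta hr h).1

theorem weylLift_sTheta_eq (hT : t.IsBraided T) {i : Fin (t.rank + 1)} (hr : t.rank ≠ 1)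
    (h : t.cartan i 0 = -1) :
    weylLift T t.sTheta = T i * weylLift T (t.s i * t.sTheta) := by
  rw [← weylLift_s_mul hT (mul_mem (t.s_mem_W i) t.sTheta_mem_W) (pos_conj_sTheta hr h).2, ← mul_assoc,
    s_mul_s, one_mul]

theorem weylLift_s_mul_sTheta (hT : t.IsBraided T) {i : Fin (t.rank + 1)} (hr : t.rank ≠ 1)
    (h : t.cartan i 0 = -1) :
    weylLift T (t.s i * t.sTheta) = weylLift T (t.s i * t.sTheta * t.s i) * T i := by
  rw [← weylLift_mul_s hT (conj_sTheta_mem_W i) (pos_conj_sTheta hr h).1, mul_assoc _ (t.s i), s_mul_s,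
    mul_one]

/-- `T_0` commutes with the lift of the reflection in `th - α_i` if node `i` is joined to the affine
node by double laces. -/
theorem commute_weylLift_conj_sTheta (hT : t.IsBraided T) {i : Fin (t.rank + 1)}
    (hc : t.cartan 0 i = -2) (hc' : t.cartan i 0 = -1) :
    Commute (T 0) (weylLift T (t.s i * t.sTheta * t.s i)) := by
  refine weylLift_conj hT (conj_sTheta_mem_W i) ?_
  have e2 : t.sTheta (t.s i (t.simpleRoot 0)) = t.s i (t.simpleRoot 0) := by
    rw [sTheta_apply, bil_th, s_apply, map_sub, map_smul, coroot_simpleRoot, coroot_simpleRoot,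
      coroot_simpleRoot, cartan_self, hc, hc']
    simp
  rw [LinearEquiv.mul_apply, LinearEquiv.mul_apply, e2, s_s_apply]

namespace IsTriple

variable {T₁ T₂ T₃ : Fin (t.rank + 1) → G} (h : IsTriple t T₁ T₂ T₃)
include h

theorem weylLift_eq {x : t.V ≃ₗ[ℚ] t.V} (hx : x ∈ t.F) : weylLift T₃ x = weylLift T₁ x :=
  weylLift_congr h.braided₃ h.braided₁ h.eq₃ hx

theorem central_mul_inv :
    T₁ 0 * T₂ 0 * T₃ 0 * weylLift T₁ t.sTheta * (bernstein T₃ t.th)⁻¹ = T₁ 0 * T₂ 0 := by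
  rw [bernstein_th h.braided₃, h.weylLift_eq t.sTheta_mem_F]
  group

theorem bernstein_th_eq :
    bernstein T₃ t.th = (T₁ 0 * T₂ 0)⁻¹ * (T₁ 0 * T₂ 0 * T₃ 0 * weylLift T₁ t.sTheta) := by
  rw [bernstein_th h.braided₃, h.weylLift_eq t.sTheta_mem_F]
  group

theorem commute_A {v : t.V} (hv : v ∈ t.finiteLattice) :
    Commute (T₁ 0 * T₂ 0) (bernstein T₃ v) := by
  rw [← h.central_mul_inv]
  exact (h.central _).mul_left (commute_bernstein_bernstein h.braided₃ t.th_mem hv).inv_left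

/-- The vectors of the lattice orthogonal to the affine coroot whose elements commute with `T_0`. -/
def commLattice : AddSubgroup t.V where
  carrier := {v | v ∈ t.finiteLattice ∧ t.coroot 0 v = 0 ∧ Commute (T₁ 0) (bernstein T₃ v)}
  zero_mem' := ⟨zero_mem _, map_zero _, by rw [bernstein_zero h.braided₃]; exact Commute.one_right _⟩
  add_mem' := by
    rintro a b ⟨ha, ha', ha''⟩ ⟨hb, hb', hb''⟩
    refine ⟨add_mem ha hb, by rw [map_add, ha', hb', add_zero], ?_⟩
    rw [bernstein_add h.braided₃ ha hb]
    exact ha''.mul_right hb''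
  neg_mem' := by
    rintro a ⟨ha, ha', ha''⟩
    refine ⟨neg_mem ha, by rw [map_neg, ha', neg_zero], ?_⟩
    rw [bernstein_neg h.braided₃ ha]
    exact ha''.inv_right

/-- The relation `T_0 X_v T_0 = X_{s_0 v}`, as a property of `v`. -/
def Good (_ : IsTriple t T₁ T₂ T₃) (v : t.V) : Prop :=
  v ∈ t.finiteLattice ∧ t.coroot 0 v = -1 ∧
    T₁ 0 * bernstein T₃ v * T₁ 0 = bernstein T₃ v * (T₁ 0 * T₂ 0)

theorem Good.add {v w : t.V} (hv : h.Good v) (hw : w ∈ h.commLattice) : h.Good (v + w) := by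
  obtain ⟨h1, h2, h3⟩ := hv
  obtain ⟨h4, h5, h6⟩ := hw
  refine ⟨add_mem h1 h4, by rw [map_add, h2, h5, add_zero], ?_⟩
  rw [bernstein_add h.braided₃ h1 h4, mul_assoc, mul_assoc, ← h6.eq, ← mul_assoc (bernstein T₃ v),
    ← mul_assoc, ← mul_assoc, h3, mul_assoc (bernstein T₃ v), mul_assoc (bernstein T₃ v),
    (h.commute_A h4).eq]

theorem Good.sub {v w : t.V} (hv : h.Good v) (hw : h.Good w) : v - w ∈ h.commLattice := by
  obtain ⟨h1, h2, h3⟩ := hv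
  obtain ⟨h4, h5, h6⟩ := hw
  refine ⟨sub_mem h1 h4, by rw [map_sub, h2, h5, sub_self], ?_⟩
  have e1 := eq_mul_inv_of_mul_eq h3
  have e2 : (T₁ 0)⁻¹ * (bernstein T₃ w)⁻¹ =
      (T₁ 0 * T₂ 0)⁻¹ * (bernstein T₃ w)⁻¹ * T₁ 0 := by
    rw [← mul_inv_rev, ← mul_inv_rev, ← h6]
    group
  rw [sub_eq_add_neg, bernstein_add h.braided₃ h1 (neg_mem h4), bernstein_neg h.braided₃ h4, Commute,
    SemiconjBy, ← mul_assoc, e1, mul_assoc _ (T₁ 0)⁻¹, e2]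
  group

theorem commute_of_cartan_eq_zero {j : Fin (t.rank + 1)} (hj : j ≠ 0) (hc : t.cartan 0 j = 0) :
    Commute (T₁ 0) (T₁ j) := h.braided₁.commute hj.symm hc

/-- If `(v, α_j^∨) = -1` then `X_{α_j} = T_j X_v T_j X_v⁻¹`. -/
theorem bernstein_simpleRoot {j : Fin (t.rank + 1)} (hj : j ≠ 0) (hd : ¬ IsDivisibleNode t j)
    {v : t.V} (hv : v ∈ t.finiteLattice) (hc : t.coroot j v = -1) :
    bernstein T₃ (v + t.simpleRoot j) = T₁ j * bernstein T₃ v * T₁ j := by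
  rw [← h.eq₃ j hj, mul_bernstein_mul h.braided₃ hj hd hv hc, s_apply, hc, neg_one_smul, sub_neg_eq_add]

theorem simpleRoot_mem_of_commute {j : Fin (t.rank + 1)} (hj : j ≠ 0) (hd : ¬ IsDivisibleNode t j)
    (hc : t.cartan 0 j = 0) {v : t.V} (hv : v ∈ h.commLattice) (hcv : t.coroot j v = -1) :
    t.simpleRoot j ∈ h.commLattice := by
  have hv' := hv
  obtain ⟨h1, h2, h3⟩ := hv
  have h4 := h.commute_of_cartan_eq_zero hj hc
  have h5 : v + t.simpleRoot j ∈ h.commLattice := by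
    refine ⟨add_mem h1 (t.simpleRoot_mem_finiteLattice hj), ?_, ?_⟩
    · rw [map_add, h2, coroot_simpleRoot, hc]; norm_num
    · rw [h.bernstein_simpleRoot hj hd h1 hcv]
      exact (h4.mul_right h3).mul_right h4
  simpa using sub_mem h5 hv'

theorem Good.simpleRoot_mem {j : Fin (t.rank + 1)} (hj : j ≠ 0) (hd : ¬ IsDivisibleNode t j)
    (hc : t.cartan 0 j = 0) {v : t.V} (hv : h.Good v) (hcv : t.coroot j v = -1) :
    t.simpleRoot j ∈ h.commLattice := by
  have hv' := hv
  obtain ⟨h1, h2, h3⟩ := hv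
  have h4 := h.commute_of_cartan_eq_zero hj hc
  have h5 : Commute (T₁ 0 * T₂ 0) (T₁ j) := by
    refine h4.mul_left ?_
    rw [← h.eq₂ j hj]
    exact h.braided₂.commute hj.symm hc
  have h6 : h.Good (v + t.simpleRoot j) := by
    refine ⟨add_mem h1 (t.simpleRoot_mem_finiteLattice hj), ?_, ?_⟩
    · rw [map_add, h2, coroot_simpleRoot, hc]; norm_num
    · rw [h.bernstein_simpleRoot hj hd h1 hcv]
      generalize bernstein T₃ v = x at *
      calc T₁ 0 * (T₁ j * x * T₁ j) * T₁ 0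
          = (T₁ 0 * T₁ j) * x * (T₁ j * T₁ 0) := by simp only [mul_assoc]
        _ = (T₁ j * T₁ 0) * x * (T₁ 0 * T₁ j) := by rw [h4.eq]
        _ = T₁ j * (T₁ 0 * x * T₁ 0) * T₁ j := by simp only [mul_assoc]
        _ = T₁ j * x * (T₁ 0 * T₂ 0 * T₁ j) := by rw [h3]; simp only [mul_assoc]
        _ = T₁ j * x * T₁ j * (T₁ 0 * T₂ 0) := by rw [h5.eq]; simp only [mul_assoc]
  simpa using h6.sub h hv'

theorem good_simpleRoot {i : Fin (t.rank + 1)} (hi : i ≠ 0) (hc : t.cartan 0 i = -1)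
    (hc' : t.cartan i 0 = -1) : h.Good (t.simpleRoot i) := by
  have hd := not_isDivisibleNode_of_cartan (by norm_num) hc hc'
  have hmem := t.simpleRoot_mem_finiteLattice hi
  refine ⟨hmem, by rw [coroot_simpleRoot, hc]; norm_num, ?_⟩
  have h1 := h.bernstein_simpleRoot hi hd (neg_mem t.th_mem) (by
    rw [map_neg, coroot_th, hc']; norm_num)
  rw [bernstein_add h.braided₃ (neg_mem t.th_mem) hmem, bernstein_neg h.braided₃ t.th_mem,
    h.bernstein_th_eq] at h1
  have hC := h.central
  generalize T₁ 0 * T₂ 0 * T₃ 0 * weylLift T₁ t.sTheta = C at *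
  have hA := h.commute_A hmem
  generalize bernstein T₃ (t.simpleRoot i) = y at *
  have b1 := h.braided₁.braid_three hi hc' hc
  have b2 := h.braided₂.braid_three hi hc' hc
  rw [h.eq₂ i hi] at b2
  generalize T₁ 0 = a at *
  generalize T₂ 0 = b at *
  generalize T₁ i = s at *
  have h2 : y = s * a * b * s * b⁻¹ * a⁻¹ := by
    have h3 : a * b * y = s * (a * b) * s := by
      have e1 : ((a * b)⁻¹ * C)⁻¹ = a * b * C⁻¹ := by
        rw [mul_inv_rev, inv_inv]; exact ((hC _).inv_left).eq
      rw [e1] at h1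
      have e2 : ∀ x, C⁻¹ * x = x * C⁻¹ := fun x => ((hC x).inv_left).eq
      rw [mul_assoc, e2, ← mul_assoc, ← mul_assoc, mul_assoc _ C⁻¹, e2, ← mul_assoc] at h1
      exact mul_right_cancel h1
    rw [hA.eq] at h3
    rw [eq_mul_inv_iff_mul_eq, eq_mul_inv_iff_mul_eq, mul_assoc, h3]
    group
  have e3 : y * (a * b) = s * a * b * s := by rw [h2]; group
  rw [e3, h2]
  calc a * (s * a * b * s * b⁻¹ * a⁻¹) * a = (a * s * a) * (b * s * b⁻¹) := by group
    _ = (s * a * s) * (b * s * b⁻¹) := by rw [b1]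
    _ = s * a * (s * b * s) * b⁻¹ := by group
    _ = s * a * (b * s * b) * b⁻¹ := by rw [b2]
    _ = s * a * b * s := by group

theorem th_sub_mem {i : Fin (t.rank + 1)} (hi : i ≠ 0) (hr : t.rank ≠ 1) (hc : t.cartan 0 i = -2)
    (hc' : t.cartan i 0 = -1) : t.th - t.simpleRoot i ∈ h.commLattice := by
  have hd := not_isDivisibleNode_of_cartan (by norm_num) hc hc'
  have hmem := t.simpleRoot_mem_finiteLattice hi
  have e1 : t.s i t.th = t.th - t.simpleRoot i := by
    rw [s_apply, coroot_th, hc']; simp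
  refine ⟨sub_mem t.th_mem hmem, ?_, ?_⟩
  · rw [map_sub, coroot_th, coroot_simpleRoot, cartan_self, hc]; norm_num
  · rw [← e1, ← inv_mul_bernstein_mul_inv h.braided₃ hi hd t.th_mem (by
      rw [coroot_th, hc']; norm_num), bernstein_th h.braided₃, weylLift_sTheta_eq h.braided₃ hr hc',
      weylLift_s_mul_sTheta h.braided₃ hr hc']
    have hF := conj_sTheta_mem_F (t := t) hi
    have h1 := commute_weylLift_conj_sTheta h.braided₁ hc hc'
    have h2 := h.double i hi (by rw [laces, hc, hc']; norm_num)
    rw [h.weylLift_eq hF, h.eq₃ i hi]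
    have h3 := h2.mul_right h1
    have e3 : ∀ s c x : G, s⁻¹ * (c * (s * (x * s))) * s⁻¹ = s⁻¹ * c * s * x := fun s c x => by group
    rwa [e3]

/-- If no node is joined to the affine node by a simple lace, the lattice is spanned by
`commLattice` and `th`. -/
theorem finiteLattice_le_of_not_simple (hs : ∀ j ≠ 0, t.cartan 0 j ≠ -1) :
    t.finiteLattice ≤ h.commLattice ⊔ AddSubgroup.zmultiples t.th := by
  have hth : t.th ∈ h.commLattice ⊔ AddSubgroup.zmultiples t.th :=
    AddSubgroup.mem_sup_right (AddSubgroup.mem_zmultiples _)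
  refine t.finiteLattice_le hth fun j hj hd γ hγ _ hcγ => ?_
  by_cases hr : t.rank = 1
  · rw [simpleRoot_eq_th hr hj hd]; exact hth
  rcases cartan_zero_cases hj with ⟨h1, h2⟩ | ⟨h1, _⟩ | ⟨h1, h2⟩ | ⟨_, h2⟩
  · obtain ⟨κ, hκ, ζ, hζ, rfl⟩ := AddSubgroup.mem_sup.1 hγ
    obtain ⟨k, rfl⟩ := AddSubgroup.mem_zmultiples_iff.1 hζ
    refine AddSubgroup.mem_sup_left (h.simpleRoot_mem_of_commute hj hd h1 hκ ?_)
    rw [map_add, map_zsmul, coroot_th, h2] at hcγ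
    simpa using hcγ
  · exact absurd h1 (hs j hj)
  · have h3 := AddSubgroup.mem_sup_left (T := AddSubgroup.zmultiples t.th) (h.th_sub_mem hj hr h1 h2)
    simpa using sub_mem hth h3
  · exact absurd h2 hr

theorem Good.th_sub {v : t.V} (hv : h.Good v) : h.Good (t.th - v) := by
  obtain ⟨h1, h2, h3⟩ := hv
  refine ⟨sub_mem t.th_mem h1, by rw [map_sub, h2, coroot_th, cartan_self]; norm_num, ?_⟩
  rw [sub_eq_add_neg, bernstein_add h.braided₃ t.th_mem (neg_mem h1), bernstein_neg h.braided₃ h1,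
    h.bernstein_th_eq]
  have hC := h.central
  generalize T₁ 0 * T₂ 0 * T₃ 0 * weylLift T₁ t.sTheta = C at *
  have hA := h.commute_A h1
  generalize bernstein T₃ v = y at *
  generalize T₁ 0 * T₂ 0 = A at *
  generalize T₁ 0 = a at *
  have e : A⁻¹ * C * y⁻¹ * A = C * (A⁻¹ * y⁻¹ * A) := by
    rw [← ((hC A⁻¹).eq)]; group
  rw [e, hA.inv_inv.eq, inv_mul_cancel_right, ← (hC A⁻¹).eq]
  calc a * (C * A⁻¹ * y⁻¹) * a = (a * C) * (y * A)⁻¹ * a := by group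
    _ = C * a * (a * y * a)⁻¹ * a := by rw [h3, (hC a).eq]
    _ = C * y⁻¹ := by group

theorem finiteLattice_le_of_simple {i : Fin (t.rank + 1)} (hi : i ≠ 0) (hc : t.cartan 0 i = -1)
    (hc' : t.cartan i 0 = -1) :
    t.finiteLattice ≤ h.commLattice ⊔ AddSubgroup.zmultiples (t.simpleRoot i) := by
  have hg := h.good_simpleRoot hi hc hc'
  have hαi : t.simpleRoot i ∈ h.commLattice ⊔ AddSubgroup.zmultiples (t.simpleRoot i) :=
    AddSubgroup.mem_sup_right (AddSubgroup.mem_zmultiples _)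
  have of_good : ∀ v, h.Good v → v ∈ h.commLattice ⊔ AddSubgroup.zmultiples (t.simpleRoot i) :=
    fun v hv => by
      have := add_mem (AddSubgroup.mem_sup_left (T := AddSubgroup.zmultiples (t.simpleRoot i))
        (hv.sub h hg)) hαi
      rwa [sub_add_cancel] at this
  refine t.finiteLattice_le ?_ fun j hj hd γ hγ _ hcγ => ?_
  · have := add_mem (of_good _ (hg.th_sub h)) hαi
    rwa [sub_add_cancel] at this
  rcases cartan_zero_of_simple hj hc with h1 | h1
  · refine of_good _ (h.good_simpleRoot hj h1 ?_)
    have h2 := t.sym_mul_cartan 0 j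
    have h3 := t.sym_pos j
    rw [h1, Fin.val_zero, sym_zero] at h2
    rcases cartan_zero_cases hj with h4 | h4 | h4 | h4
    · omega
    · exact h4.2
    · omega
    · rw [h1] at h4
      have : t.cartan j 0 = -4 := by omega
      rw [this] at h2
      omega
  · obtain ⟨κ, hκ, ζ, hζ, rfl⟩ := AddSubgroup.mem_sup.1 hγ
    obtain ⟨k, rfl⟩ := AddSubgroup.mem_zmultiples_iff.1 hζ
    refine AddSubgroup.mem_sup_left ?_
    rw [map_add, map_zsmul, coroot_simpleRoot] at hcγ
    have hij : i ≠ j := fun e => by rw [e, h1] at hc; norm_num at hc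
    have h2 := t.sym_mul_cartan i j
    rw [sym_eq_of_cartan hc hc'] at h2
    have h3 := t.sym_pos j
    have h4 : t.cartan j i = 0 ∨ t.cartan j i = -1 := by
      rcases cartan_cases hij with h | h | h | h | h | h | h
      · exact Or.inl h.2
      · exact Or.inr h.2
      · rw [h.1, h.2] at h2; omega
      · exact Or.inr h.2
      · rw [h.1, h.2] at h2; omega
      · exact Or.inr h.2
      · have hi' := i.2
        have hj' := j.2
        simp only [ne_eq, Fin.ext_iff, Fin.val_zero] at hi hj hij
        omega
    rcases h4 with h4 | h4
    · rw [h4] at hcγ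
      exact h.simpleRoot_mem_of_commute hj hd h1 hκ (by simpa using hcγ)
    · exact hg.simpleRoot_mem h hj hd h1 (by rw [coroot_simpleRoot, h4]; norm_num)

theorem commute_and_mul_bernstein_mul : (∀ v ∈ t.finiteLattice, t.coroot 0 v = 0 →
    Commute (T₁ 0) (bernstein T₃ v)) ∧ ∀ v ∈ t.finiteLattice, t.coroot 0 v = -1 →
      T₁ 0 * bernstein T₃ v * T₁ 0 = bernstein T₃ v * (T₁ 0 * T₂ 0) := by
  by_cases hs : ∃ i ≠ 0, t.cartan 0 i = -1 ∧ t.cartan i 0 = -1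
  · obtain ⟨i, hi, hc, hc'⟩ := hs
    have aux : ∀ v ∈ t.finiteLattice, ∃ κ ∈ h.commLattice, ∃ k : ℤ, v = κ + k • t.simpleRoot i ∧
        t.coroot 0 v = -k := fun v hv => by
      obtain ⟨κ, hκ, ζ, hζ, rfl⟩ := AddSubgroup.mem_sup.1 (h.finiteLattice_le_of_simple hi hc hc' hv)
      obtain ⟨k, rfl⟩ := AddSubgroup.mem_zmultiples_iff.1 hζ
      refine ⟨κ, hκ, k, rfl, ?_⟩
      rw [map_add, map_zsmul, hκ.2.1, coroot_simpleRoot, hc]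
      simp
    refine ⟨fun v hv h0 => ?_, fun v hv h0 => ?_⟩ <;> obtain ⟨κ, hκ, k, rfl, he⟩ := aux v hv <;>
      rw [h0] at he
    · have hk : k = 0 := by
        have : (k : ℚ) = 0 := by linarith
        exact_mod_cast this
      rw [hk, zero_smul, add_zero]
      exact hκ.2.2
    · have hk : k = 1 := by
        have : (k : ℚ) = 1 := by linarith
        exact_mod_cast this
      rw [hk, one_smul, add_comm κ]
      exact ((h.good_simpleRoot hi hc hc').add h hκ).2.2
  · have hs' : ∀ j ≠ 0, t.cartan 0 j ≠ -1 := fun j hj h1 => hs ⟨j, hj, h1, by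
      have h2 := t.sym_mul_cartan 0 j
      have h3 := t.sym_pos j
      rw [h1, Fin.val_zero, sym_zero] at h2
      nlinarith⟩
    have aux : ∀ v ∈ t.finiteLattice, ∃ κ ∈ h.commLattice, ∃ k : ℤ, v = κ + k • t.th ∧
        t.coroot 0 v = ((-2 * k : ℤ) : ℚ) := fun v hv => by
      obtain ⟨κ, hκ, ζ, hζ, rfl⟩ := AddSubgroup.mem_sup.1 (h.finiteLattice_le_of_not_simple hs' hv)
      obtain ⟨k, rfl⟩ := AddSubgroup.mem_zmultiples_iff.1 hζ
      refine ⟨κ, hκ, k, rfl, ?_⟩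
      rw [map_add, map_zsmul, hκ.2.1, coroot_th, cartan_self]
      simp [mul_comm]
    refine ⟨fun v hv h0 => ?_, fun v hv h0 => ?_⟩ <;> obtain ⟨κ, hκ, k, rfl, he⟩ := aux v hv <;>
      rw [h0] at he
    · have hk : 0 = -2 * k := by exact_mod_cast he
      have hk : k = 0 := by omega
      rw [hk, zero_smul, add_zero]
      exact hκ.2.2
    · have hk : -1 = -2 * k := by exact_mod_cast he
      omega

end IsTriple

end

end AffineType
end TripleArtin

namespace TripleArtin
namespace AffineType

variable {t : AffineType}

/-! ### From the double affine Artin group to triples -/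

theorem finiteLattice_le_xLattice : t.finiteLattice ≤ t.xLattice := le_sup_left

theorem dl_mem : t.dl ∈ t.xLattice := t.xDelta.2

theorem simpleRoot_mem_xLattice (i : Fin (t.rank + 1)) : t.simpleRoot i ∈ t.xLattice := by
  rcases eq_or_ne i 0 with rfl | hi
  · exact t.xAlphaZero.2
  · exact finiteLattice_le_xLattice (t.simpleRoot_mem_finiteLattice hi)

theorem exists_of_mem_xLattice {v : t.V} (hv : v ∈ t.xLattice) :
    ∃ u ∈ t.finiteLattice, ∃ k : ℤ, v = u + k • t.dl := by
  obtain ⟨u, hu, z, hz, rfl⟩ := AddSubgroup.mem_sup.1 hv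
  obtain ⟨k, rfl⟩ := AddSubgroup.mem_zmultiples_iff.1 hz
  exact ⟨u, hu, k, rfl⟩

section

variable {G : Type*} [Group G] {T : Fin (t.rank + 1) → G} {X : t.V → G}

/-- The relations of the double affine Artin group. -/
structure IsDoubleAffine (T : Fin (t.rank + 1) → G) (X : t.V → G) : Prop where
  braided : t.IsBraided T
  add : ∀ u ∈ t.xLattice, ∀ v ∈ t.xLattice, X (u + v) = X u * X v
  central : ∀ x, Commute (X t.dl) x
  comm : ∀ i, ∀ v ∈ t.xLattice, t.coroot i v = 0 → Commute (T i) (X v)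
  refl : ∀ i, ¬ IsDivisibleNode t i → ∀ v ∈ t.xLattice, t.coroot i v = -1 →
    T i * X v * T i = X (t.s i v)

theorem isRoot_smul_th {x : t.V ≃ₗ[ℚ] t.V} (hx : x ∈ t.W) :
    ∃ r, t.IsRoot r ∧ x t.th = (t.label 0 : ℚ)⁻¹ • r :=
  ⟨x t.theta, t.isRoot_theta.map hx, by rw [th, map_smul]⟩

theorem label_inv_pos : 0 < (t.label 0 : ℚ)⁻¹ := by
  have h0 : (0 : ℚ) < t.label 0 := by exact_mod_cast t.label_zero_pos
  exact inv_pos.2 h0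

theorem pos_th_of_coord {x : t.V ≃ₗ[ℚ] t.V} (hx : x ∈ t.W) {k : Fin (t.rank + 1)}
    (h : 0 < x t.th k) : t.Pos (x t.th) := by
  obtain ⟨r, hr, he⟩ := isRoot_smul_th hx
  rw [he] at h ⊢
  refine (hr.pos_of_coord (k := k) ?_).smul label_inv_pos
  rw [Pi.smul_apply, smul_eq_mul] at h
  exact pos_of_mul_pos_right h label_inv_pos.le

namespace IsDoubleAffine

variable (h : IsDoubleAffine T X)
include h

/-- For `Y = X_th T_{s_θ}⁻¹` and `u` in the finite Weyl group with `u th` positive,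
`Y T_{s_θ u⁻¹} = T_{u⁻¹} X_{u th}`. -/
theorem X_th_mul_weylLift_wordProd (w : List (Fin t.rank)) (hw : t.Red (w.map Fin.succ))
    (hp : t.Pos (t.wordProd (w.map Fin.succ) t.th)) :
    X t.th * (weylLift T t.sTheta)⁻¹ * weylLift T (t.sTheta * (t.wordProd (w.map Fin.succ))⁻¹) =
      weylLift T (t.wordProd (w.map Fin.succ))⁻¹ * X (t.wordProd (w.map Fin.succ) t.th) := by
  induction w with
  | nil => simp [weylLift_one h.braided]
  | cons j w ih =>
    rw [List.map_cons] at hw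
    obtain ⟨hw, hr⟩ := hw
    rw [List.map_cons, wordProd_cons] at hp ⊢
    have hF := t.wordProd_mem_F w
    generalize t.wordProd (w.map Fin.succ) = u at *
    have hj : j.succ ≠ 0 := Fin.succ_ne_zero j
    generalize j.succ = j at *
    have hW := t.F_le_W hF
    have hsW := t.s_mem_W j
    have hd : (0 : ℚ) < t.sym j := by exact_mod_cast t.sym_pos j
    set c := t.coroot j (u t.th) with hc
    have hb : t.bil t.th (u⁻¹ (t.simpleRoot j)) = t.sym j * c := by
      rw [← W_bil t hW, aut_apply_inv, bil_simpleRoot_right]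
    have hρ : t.IsRoot (u⁻¹ (t.simpleRoot j)) := inv_root hW j
    have hρ0 : (u⁻¹ (t.simpleRoot j)) 0 = 0 := by
      rw [F_apply_zero t (inv_mem hF)]; simp [simpleRoot, hj.symm]
    have hc0 : 0 ≤ c := by
      have := dom_th.bil_nonneg hr hρ0
      rw [hb] at this
      exact nonneg_of_mul_nonneg_right this hd
    rw [LinearEquiv.mul_apply] at hp ⊢
    have hs : t.s j (u t.th) = u t.th - c • t.simpleRoot j := s_apply _ _ _
    have hγ : t.Pos (u t.th) := by
      rcases hc0.lt_or_eq with h0 | h0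
      · have := hp.add ((t.pos_simpleRoot j).smul h0)
        rwa [hs, sub_add_cancel] at this
      · rwa [hs, ← h0, zero_smul, sub_zero] at hp
    have hmem := F_mem_finiteLattice t.th_mem hF
    have hmem' := finiteLattice_le_xLattice hmem
    obtain ⟨z, hz⟩ := exists_coroot_of_mem hmem hj
    have hlt : c ^ 2 * t.sym j < 4 := by
      set x := u t.th - (c / 2) • t.simpleRoot j with hx
      have e : t.bil x x = 2 - c ^ 2 * t.sym j / 2 := by
        rw [hx]
        simp only [map_sub, map_smul, LinearMap.sub_apply, LinearMap.smul_apply, smul_eq_mul,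
          bil_simpleRoot_left, bil_simpleRoot_right, coroot_simpleRoot_self, W_bil t hW, bil_th_th,
          ← hc]
        ring
      have h1 := t.bil_self_nonneg x
      refine lt_of_le_of_ne (by linarith) fun h2 => ?_
      have h3 := t.eq_zero_of_bil_self x (by linarith) (by
        rw [hx, Pi.sub_apply, F_apply_zero t hF, th_zero, Pi.smul_apply]
        simp [simpleRoot, hj.symm])
      have h4 : t.s j (u t.th) = -u t.th := by
        have h5 := sub_eq_zero.1 h3
        rw [h5, map_smul, s_simpleRoot_self, smul_neg]
      rw [h4] at hp
      exact hγ.not_neg hp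
    have hu : (t.s j * u)⁻¹ = u⁻¹ * t.s j := by rw [mul_inv_rev, s_inv]
    have e1 : weylLift T (u⁻¹ * t.s j) = weylLift T u⁻¹ * T j :=
      weylLift_mul_s h.braided (inv_mem hW) hr
    have hx : t.sTheta * u⁻¹ ∈ t.W := mul_mem t.sTheta_mem_W (inv_mem hW)
    have ih := ih hw hγ
    rw [hu, e1, ← mul_assoc t.sTheta]
    have hsρ : t.IsRoot ((t.sTheta * u⁻¹) (t.simpleRoot j)) := (isRoot_simpleRoot j).map hx
    have hz0 : 0 ≤ z := by rw [← hc] at hz; rw [hz] at hc0; exact_mod_cast hc0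
    have hs1 : 1 ≤ t.sym j := t.sym_pos j
    have hz' : z ^ 2 * t.sym j < 4 := by
      rw [← hc] at hz
      rw [hz] at hlt; exact_mod_cast hlt
    rcases hz0.lt_or_eq with h0 | h0
    · have hz1 : z = 1 := by
        by_contra hne
        have : 2 ≤ z := by omega
        nlinarith
      have hc1 : c = 1 := by rw [← hc] at hz; rw [hz, hz1]; norm_num
      have hnd : ¬ IsDivisibleNode t j := by
        rw [isDivisibleNode_iff]
        intro h4
        rw [h4, hz1] at hz'
        norm_num at hz'
      have e2 : weylLift T (t.sTheta * u⁻¹) = weylLift T (t.sTheta * u⁻¹ * t.s j) * T j := by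
        rw [← weylLift_mul_s h.braided (mul_mem hx hsW), mul_assoc _ (t.s j), s_mul_s, mul_one]
        rw [LinearEquiv.mul_apply, s_simpleRoot_self, map_neg, hsρ.pos_neg_iff]
        intro hpos
        have := dom_th.bil_nonneg hpos (by
          rw [LinearEquiv.mul_apply, F_apply_zero t t.sTheta_mem_F, hρ0])
        rw [LinearEquiv.mul_apply, sTheta_apply, map_sub, map_smul, bil_th_th, hb, hc1] at this
        simp only [smul_eq_mul] at this
        linarith
      have e3 := h.refl j hnd (t.s j (u t.th)) (finiteLattice_le_xLattice
        (s_mem_finiteLattice hmem hj)) (by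
          rw [s_apply, map_sub, map_smul, coroot_simpleRoot_self, ← hc, hc1]; norm_num)
      rw [s_s_apply] at e3
      rw [← e3, e2] at ih
      have e4 : ∀ y a x b s : G, y * (a * s) = x * (s * b * s) → y * a = x * s * b := by
        intro y a x b s h
        have : y * a * s = x * s * b * s := by rw [mul_assoc, h]; simp only [mul_assoc]
        exact mul_right_cancel this
      exact e4 _ _ _ _ _ ih
    · have hc1 : c = 0 := by rw [← hc] at hz; rw [hz, ← h0]; norm_num
      have e2 : weylLift T (t.sTheta * u⁻¹ * t.s j) = weylLift T (t.sTheta * u⁻¹) * T j := by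
        refine weylLift_mul_s h.braided hx ?_
        rw [LinearEquiv.mul_apply, sTheta_apply, hb, hc1]
        simpa using hr
      have e3 := h.comm j (u t.th) hmem' hc1
      rw [hs, hc1, zero_smul, sub_zero, e2, mul_assoc _ (T j), e3.eq, ← mul_assoc, ← mul_assoc, ih]

theorem key_of_mem {u : t.V ≃ₗ[ℚ] t.V} (hu : u ∈ t.F) (hp : t.Pos (u t.th)) :
    X t.th * (weylLift T t.sTheta)⁻¹ * weylLift T (t.sTheta * u⁻¹) =
      weylLift T u⁻¹ * X (u t.th) := by
  obtain ⟨w, hw, rfl⟩ := exists_red_of_mem_F hu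
  exact h.X_th_mul_weylLift_wordProd w hw hp

end IsDoubleAffine

end

end AffineType
end TripleArtin

namespace TripleArtin
namespace AffineType

variable {t : AffineType}

section

variable {G : Type*} [Group G] {T : Fin (t.rank + 1) → G} {X : t.V → G}

theorem IsBraided.update (hT : t.IsBraided T) {c : G}
    (h : ∀ i ≠ 0, alternating (t.braidLength 0 i) c (T i) = alternating (t.braidLength 0 i) (T i) c) :
    t.IsBraided (Function.update T 0 c) := by
  intro i j hij
  rcases eq_or_ne i 0 with rfl | hi
  · rw [Function.update_self, Function.update_of_ne hij.symm]
    exact h j hij.symm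
  · rcases eq_or_ne j 0 with rfl | hj
    · rw [Function.update_self, Function.update_of_ne hij, braidLength_comm]
      exact (h i hij).symm
    · rw [Function.update_of_ne hi, Function.update_of_ne hj]
      exact hT i j hij

theorem th_mem' : t.th ∈ t.xLattice := finiteLattice_le_xLattice t.th_mem

theorem not_isDivisibleNode_zero : ¬ IsDivisibleNode t 0 := by
  rw [isDivisibleNode_iff, Fin.val_zero, sym_zero]; norm_num

theorem cartan_mul_cartan_of_rank_eq_one (hr : t.rank = 1) {i : Fin (t.rank + 1)} (hi : i ≠ 0) :
    t.cartan 0 i * t.cartan i 0 = 4 := by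
  have h1 : (i : ℕ) = 1 := by
    have := i.2
    have h2 : (i : ℕ) ≠ 0 := fun h => hi (Fin.ext h)
    omega
  rw [cartan_eq_entry, cartan_eq_entry, h1, Fin.val_zero]
  cases t <;> simp only [rank] at hr <;> try omega
  · simp [entry, Edge, mult]
  · obtain rfl : _ = 0 := by simpa using hr
    simp [entry, Edge, mult]

/-- To verify the braid relations at the affine node, three cases suffice. -/
theorem alternating_zero_cases {c : G} {i : Fin (t.rank + 1)} (hi : i ≠ 0) {s : G}
    (h2 : t.cartan 0 i = 0 → t.cartan i 0 = 0 → Commute c s)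
    (h3 : t.rank ≠ 1 → t.cartan 0 i = -1 → t.cartan i 0 = -1 → c * s * c = s * c * s)
    (h4 : t.rank ≠ 1 → t.cartan 0 i = -2 → t.cartan i 0 = -1 → c * s * c * s = s * c * s * c) :
    alternating (t.braidLength 0 i) c s = alternating (t.braidLength 0 i) s c := by
  have hr' : t.cartan 0 i * t.cartan i 0 ≠ 4 → t.rank ≠ 1 := fun h hr =>
    h (cartan_mul_cartan_of_rank_eq_one hr hi)
  rcases cartan_zero_cases hi with ⟨h, h'⟩ | ⟨h, h'⟩ | ⟨h, h'⟩ | ⟨h, _⟩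
  · have hl : t.braidLength 0 i = 2 := by rw [braidLength, laces, h]; simp
    rw [hl]
    simpa [alternating] using (h2 h h').eq
  · have hl : t.braidLength 0 i = 3 := by rw [braidLength, laces, h, h']; norm_num
    rw [hl]
    simpa [alternating, mul_assoc] using h3 (hr' (by rw [h, h']; norm_num)) h h'
  · have hl : t.braidLength 0 i = 4 := by rw [braidLength, laces, h, h']; norm_num
    rw [hl]
    simpa [alternating, mul_assoc] using h4 (hr' (by rw [h, h']; norm_num)) h h'
  · have hl : t.braidLength 0 i = 0 := by rw [braidLength, laces, h]; norm_num
    rw [hl]; rfl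

theorem commute_weylLift_of_neg (hT : t.IsBraided T) {x : t.V ≃ₗ[ℚ] t.V} (hx : x ∈ t.W)
    {i : Fin (t.rank + 1)} (h : x (t.simpleRoot i) = -t.simpleRoot i) :
    Commute (T i) (weylLift T x) := by
  have hy : t.s i * x ∈ t.W := mul_mem (t.s_mem_W i) hx
  have h1 : (t.s i * x) (t.simpleRoot i) = t.simpleRoot i := by
    rw [LinearEquiv.mul_apply, h, map_neg, s_simpleRoot_self, neg_neg]
  have h2 : Commute (T i) (weylLift T (t.s i * x)) := weylLift_conj hT hy h1
  have h3 := weylLift_s_mul hT hy (i := i) (by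
    have := t.pos_simpleRoot i
    rwa [← aut_inv_apply (t.s i * x) (t.simpleRoot i), h1] at this)
  rw [← mul_assoc, s_mul_s, one_mul] at h3
  rw [h3]
  exact (Commute.refl _).mul_right h2

namespace IsDoubleAffine

variable (h : IsDoubleAffine T X)
include h

theorem X_zero : X 0 = 1 := by
  have := h.add 0 (zero_mem _) 0 (zero_mem _)
  rwa [add_zero, eq_comm, mul_eq_right] at this

theorem X_neg {v : t.V} (hv : v ∈ t.xLattice) : X (-v) = (X v)⁻¹ := by
  rw [eq_inv_iff_mul_eq_one, ← h.add _ (neg_mem hv) _ hv, neg_add_cancel, h.X_zero]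

theorem commute_X {u v : t.V} (hu : u ∈ t.xLattice) (hv : v ∈ t.xLattice) :
    Commute (X u) (X v) := by
  rw [Commute, SemiconjBy, ← h.add u hu v hv, ← h.add v hv u hu, add_comm u]

theorem conj_eq {i : Fin (t.rank + 1)} (hi : i ≠ 0) (hr : t.rank ≠ 1) (hc' : t.cartan i 0 = -1) :
    (T i)⁻¹ * (X t.th * (weylLift T t.sTheta)⁻¹) * T i =
      X (t.th - t.simpleRoot i) * (weylLift T (t.s i * t.sTheta * t.s i))⁻¹ := by
  have e1 : t.s i t.th = t.th - t.simpleRoot i := by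
    rw [s_apply, coroot_th, hc']; simp
  obtain ⟨k, hk0, hki⟩ := exists_ne_ne hr i
  have h1 := h.key_of_mem (t.s_mem_F hi) (pos_th_of_coord (t.s_mem_W i) (k := k) (by
    rw [s_apply_of_ne t hki]; exact th_pos hk0))
  rw [s_inv, weylLift_s h.braided, e1, weylLift_sTheta_mul_s h.braided hr hc'] at h1
  rw [eq_mul_inv_iff_mul_eq, mul_assoc, mul_assoc, h1, inv_mul_cancel_left]

theorem braided_T03 :
    t.IsBraided (Function.update T 0 (X t.th * (weylLift T t.sTheta)⁻¹)) := by
  refine h.braided.update fun i hi => alternating_zero_cases hi ?_ ?_ ?_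
  · intro h1 h2
    have e1 := h.comm i t.th th_mem' (by rw [coroot_th, h2]; simp)
    have e2 : Commute (T i) (weylLift T t.sTheta) := weylLift_conj h.braided t.sTheta_mem_W (by
      rw [sTheta_apply, bil_th, coroot_simpleRoot, h1]; simp)
    exact (e1.mul_right e2.inv_right).symm
  · intro hr h1 h2
    have e1 := h.conj_eq hi hr h2
    have eb : t.bil t.th (t.simpleRoot i) = 1 := by
      rw [bil_th, coroot_simpleRoot, h1]; norm_num
    have e2 : (t.s i * t.sTheta * t.s i) t.th = t.simpleRoot i := by
      simp only [LinearEquiv.mul_apply, sTheta_apply, s_apply, map_sub, map_smul, eb, bil_th_th,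
        coroot_th, h2, coroot_simpleRoot_self]
      push_cast
      module
    have e3 : t.sTheta * (t.s i * t.sTheta * t.s i) = t.s i * t.sTheta := by
      ext1 v
      simp only [LinearEquiv.mul_apply, sTheta_apply, s_apply, map_sub, map_smul, eb, bil_th_th,
        coroot_th, h2, coroot_simpleRoot_self]
      push_cast
      module
    have e4 := h.key_of_mem (conj_sTheta_mem_F hi) (by rw [e2]; exact t.pos_simpleRoot i)
    rw [conj_sTheta_inv, e2, e3] at e4
    have e5 := weylLift_sTheta_eq h.braided hr h2
    have hα := simpleRoot_mem_xLattice (t := t) i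
    have e6 := h.add _ (sub_mem th_mem' hα) _ hα
    rw [sub_add_cancel] at e6
    have aux : ∀ P B s R D Xa Xb : G, s⁻¹ * (P * B⁻¹) * s = Xb * R⁻¹ → P * B⁻¹ * D = R * Xa →
        B = s * D → P = Xb * Xa → P * B⁻¹ * s * (P * B⁻¹) = s * (P * B⁻¹) * s := by
      rintro P B s R D Xa Xb k1 k2 rfl k4
      have k5 : Xa = R⁻¹ * (P * (s * D)⁻¹ * D) := by rw [k2]; group
      calc P * (s * D)⁻¹ * s * (P * (s * D)⁻¹)
          = s * (s⁻¹ * (P * (s * D)⁻¹) * s) * (P * (s * D)⁻¹ * D) * D⁻¹ := by group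
        _ = s * (Xb * (R⁻¹ * (P * (s * D)⁻¹ * D))) * D⁻¹ := by rw [k1]; group
        _ = s * (P * (s * D)⁻¹) * s := by rw [← k5, ← k4]; group
    exact aux _ _ _ _ _ _ _ e1 e4 e5 e6
  · intro hr h1 h2
    have e1 := h.conj_eq hi hr h2
    have eb : t.bil t.th (t.simpleRoot i) = 2 := by
      rw [bil_th, coroot_simpleRoot, h1]; norm_num
    have e2 : (t.s i * t.sTheta * t.s i) t.th = t.th := by
      simp only [LinearEquiv.mul_apply, sTheta_apply, s_apply, map_sub, map_smul, eb, bil_th_th,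
        coroot_th, h2, coroot_simpleRoot_self]
      push_cast
      module
    have e3 : (t.sTheta * (t.s i * t.sTheta * t.s i)) (t.simpleRoot i) = -t.simpleRoot i := by
      simp only [LinearEquiv.mul_apply, sTheta_apply, s_apply, map_sub, map_smul, eb, bil_th_th,
        coroot_th, h2, coroot_simpleRoot_self]
      push_cast
      module
    obtain ⟨k, hk0, hki⟩ := exists_ne_ne hr i
    have e4 := h.key_of_mem (conj_sTheta_mem_F hi) (pos_th_of_coord (conj_sTheta_mem_W i) (k := k) (by
      rw [e2]; exact th_pos hk0))
    rw [conj_sTheta_inv, e2] at e4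
    have hx := mul_mem t.sTheta_mem_W (conj_sTheta_mem_W i)
    have e5 := commute_weylLift_of_neg h.braided hx e3
    have hα := simpleRoot_mem_xLattice (t := t) i
    have e6 := h.comm i _ (add_mem (sub_mem th_mem' hα) th_mem') (by
      rw [map_add, map_sub, coroot_th, coroot_simpleRoot_self, h2]; norm_num)
    rw [h.add _ (sub_mem th_mem' hα) _ th_mem'] at e6
    have e7 := e6.mul_right e5.inv_right
    have aux : ∀ Y s R D P Xb : G, s⁻¹ * Y * s = Xb * R⁻¹ → Y * D = R * P →
        Commute s (Xb * P * D⁻¹) → Y * s * Y * s = s * Y * s * Y := by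
      intro Y s R D P Xb k1 k2 k3
      have k4 : Xb * P * D⁻¹ = s⁻¹ * Y * s * Y := by
        have : Y = R * P * D⁻¹ := by rw [← k2]; group
        rw [k1]
        conv_rhs => rw [this]
        group
      rw [k4] at k3
      calc Y * s * Y * s = s * (s⁻¹ * Y * s * Y * s) := by group
        _ = s * (s * (s⁻¹ * Y * s * Y)) := by rw [k3.eq]
        _ = s * Y * s * Y := by group
    exact aux _ _ _ _ _ _ e1 e4 e7

theorem braided_T02 :
    t.IsBraided (Function.update T 0 ((T 0)⁻¹ * X (t.simpleRoot 0))) := by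
  refine h.braided.update fun i hi => ?_
  have h0 := simpleRoot_mem_xLattice (t := t) 0
  have hα := simpleRoot_mem_xLattice (t := t) i
  have eX : ∀ a, -2 ≤ a → t.cartan 0 i = a → t.cartan i 0 = -1 →
      T i * X (t.simpleRoot 0) * T i = X (t.simpleRoot 0 + t.simpleRoot i) := by
    intro a ha h1 h2
    rw [h.refl i (not_isDivisibleNode_of_cartan ha h1 h2) _ h0 (by
      rw [coroot_simpleRoot, h2]; norm_num), s_apply, coroot_simpleRoot, h2]
    congr 1
    push_cast
    module
  refine alternating_zero_cases hi ?_ ?_ ?_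
  · intro h1 h2
    refine ((h.braided.commute hi.symm h1).inv_left).mul_left (h.comm i _ h0 ?_).symm
    rw [coroot_simpleRoot, h2]; norm_num
  · intro hr h1 h2
    have e1 := eX _ (by norm_num) h1 h2
    have e2 := h.refl 0 not_isDivisibleNode_zero _ hα (by
      rw [coroot_simpleRoot, h1]; norm_num)
    have e3 : t.s 0 (t.simpleRoot i) = t.simpleRoot 0 + t.simpleRoot i := by
      rw [s_apply, coroot_simpleRoot, h1]
      push_cast
      module
    rw [e3] at e2
    have e4 := h.add _ h0 _ hα
    have e5 := (h.commute_X h0 hα).eq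
    have e6 := h.braided.braid_three hi.symm h1 h2
    rw [← e4] at e5
    have aux : ∀ a s x y E : G, s * x * s = E → a * y * a = E → E = y * x →
        a * s * a = s * a * s → a⁻¹ * x * s * (a⁻¹ * x) = s * (a⁻¹ * x) * s := by
      intro a s x y E k1 k2 k3 k4
      have k5 : a⁻¹ * s⁻¹ * a = s * a⁻¹ * s⁻¹ := by
        rw [eq_mul_inv_iff_mul_eq, mul_assoc, mul_assoc, inv_mul_eq_iff_eq_mul, inv_mul_eq_iff_eq_mul,
          ← mul_assoc, ← mul_assoc, eq_mul_inv_iff_mul_eq, k4]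
      calc a⁻¹ * x * s * (a⁻¹ * x) = a⁻¹ * s⁻¹ * (s * x * s) * a⁻¹ * x := by group
        _ = a⁻¹ * s⁻¹ * (a * y * a) * a⁻¹ * x := by rw [k1, k2]
        _ = a⁻¹ * s⁻¹ * a * (y * x) := by group
        _ = s * a⁻¹ * s⁻¹ * (s * x * s) := by rw [k5, ← k3, k1]
        _ = s * (a⁻¹ * x) * s := by group
    exact aux _ _ _ _ _ e1 e2 e5 e6
  · intro hr h1 h2
    have e1 := eX _ (by norm_num) h1 h2
    have hE := add_mem h0 hα
    have e2 := h.comm 0 _ hE (by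
      rw [map_add, coroot_simpleRoot_self, coroot_simpleRoot, h1]; norm_num)
    have e3 := h.commute_X h0 hE
    have e4 := h.braided.braid_four hi.symm h1 h2
    have aux : ∀ a s x E : G, s * x * s = E → Commute a E → Commute x E →
        a * s * a * s = s * a * s * a →
        a⁻¹ * x * s * (a⁻¹ * x) * s = s * (a⁻¹ * x) * s * (a⁻¹ * x) := by
      rintro a s x E k1 k2 k3 k4
      have k5 : a⁻¹ * s⁻¹ * a⁻¹ * s = s * a⁻¹ * s⁻¹ * a⁻¹ := by
        have : (a * s * a * s)⁻¹ = (s * a * s * a)⁻¹ := by rw [k4]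
        have e : s * (a * s * a * s)⁻¹ * s = s * (s * a * s * a)⁻¹ * s := by rw [this]
        have e1 : s * (a * s * a * s)⁻¹ * s = a⁻¹ * s⁻¹ * a⁻¹ * s := by group
        have e2 : s * (s * a * s * a)⁻¹ * s = s * a⁻¹ * s⁻¹ * a⁻¹ := by group
        rw [← e1, ← e2, e]
      have k6 : x * s = s⁻¹ * E := by rw [← k1]; group
      have k7 : E * s⁻¹ = s * x := by rw [← k1]; group
      calc a⁻¹ * x * s * (a⁻¹ * x) * s = a⁻¹ * (x * s) * a⁻¹ * (x * s) := by group
        _ = a⁻¹ * s⁻¹ * (E * a⁻¹) * s⁻¹ * E := by rw [k6]; group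
        _ = a⁻¹ * s⁻¹ * a⁻¹ * (E * s⁻¹) * E := by rw [← k2.inv_left.eq]; group
        _ = (a⁻¹ * s⁻¹ * a⁻¹ * s) * (x * E) := by rw [k7]; group
        _ = s * a⁻¹ * s⁻¹ * (a⁻¹ * E) * x := by rw [k5, k3.eq]; group
        _ = s * a⁻¹ * (s⁻¹ * E) * a⁻¹ * x := by rw [k2.inv_left.eq]; group
        _ = s * (a⁻¹ * x) * s * (a⁻¹ * x) := by rw [← k6]; group
    exact aux _ _ _ _ e1 e2 e3 e4

theorem isTriple : IsTriple t T (Function.update T 0 ((T 0)⁻¹ * X (t.simpleRoot 0)))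
    (Function.update T 0 (X t.th * (weylLift T t.sTheta)⁻¹)) where
  braided₁ := h.braided
  braided₂ := h.braided_T02
  braided₃ := h.braided_T03
  eq₂ i hi := Function.update_of_ne hi _ _
  eq₃ i hi := Function.update_of_ne hi _ _
  double i hi hl := by
    have hc : t.cartan 0 i = -2 ∧ t.cartan i 0 = -1 := by
      rw [laces] at hl
      rcases cartan_zero_cases hi with ⟨h1, h2⟩ | ⟨h1, h2⟩ | h1 | ⟨h1, _⟩
      · rw [h1, h2] at hl; norm_num at hl
      · rw [h1, h2] at hl; norm_num at hl
      · exact h1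
      · rw [h1] at hl; norm_num at hl
    have hr : t.rank ≠ 1 := fun hr => by
      have := cartan_mul_cartan_of_rank_eq_one hr hi
      rw [hc.1, hc.2] at this; norm_num at this
    rw [Function.update_self, h.conj_eq hi hr hc.2]
    refine (h.comm 0 _ (sub_mem th_mem' (simpleRoot_mem_xLattice i)) ?_).mul_right
      (commute_weylLift_conj_sTheta h.braided hc.1 hc.2).inv_right
    rw [map_sub, coroot_th, coroot_simpleRoot, cartan_self, hc.1]; norm_num
  central x := by
    have : T 0 * ((T 0)⁻¹ * X (t.simpleRoot 0)) * (X t.th * (weylLift T t.sTheta)⁻¹) *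
        weylLift T t.sTheta = X t.dl := by
      rw [dl_eq, h.add _ (simpleRoot_mem_xLattice 0) _ th_mem']; group
    rw [Function.update_self, Function.update_self, this]
    exact h.central x

end IsDoubleAffine

end

end AffineType
end TripleArtin

namespace TripleArtin
namespace AffineType

variable {t : AffineType}

/-! ### From triples to the double affine Artin group -/

section

variable {G : Type*} [Group G] {T₁ T₂ T₃ : Fin (t.rank + 1) → G}

/-- The elements `X_v` attached to a triple of braided families. -/
noncomputable def xMap (T₁ T₂ T₃ : Fin (t.rank + 1) → G) (v : t.V) : G :=
  bernstein T₃ (v - v 0 • t.dl) * (T₁ 0 * T₂ 0 * T₃ 0 * weylLift T₁ t.sTheta) ^ ⌊v 0⌋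

theorem xMap_add_smul {u : t.V} (hu : u ∈ t.finiteLattice) (k : ℤ) :
    xMap T₁ T₂ T₃ (u + k • t.dl) =
      bernstein T₃ u * (T₁ 0 * T₂ 0 * T₃ 0 * weylLift T₁ t.sTheta) ^ k := by
  have h0 : (u + k • t.dl) 0 = k := by
    rw [Pi.add_apply, apply_zero_of_mem hu, Pi.smul_apply, dl_zero]; simp
  rw [xMap, h0, Int.floor_intCast, Int.cast_smul_eq_zsmul, add_sub_cancel_right]

theorem xMap_of_mem {u : t.V} (hu : u ∈ t.finiteLattice) :
    xMap T₁ T₂ T₃ u = bernstein T₃ u := by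
  have := xMap_add_smul (T₁ := T₁) (T₂ := T₂) (T₃ := T₃) hu 0
  rwa [zero_smul, add_zero, zpow_zero, mul_one] at this

namespace IsTriple

variable (h : IsTriple t T₁ T₂ T₃)
include h

theorem xMap_dl : xMap T₁ T₂ T₃ t.dl = T₁ 0 * T₂ 0 * T₃ 0 * weylLift T₁ t.sTheta := by
  have := xMap_add_smul (T₁ := T₁) (T₂ := T₂) (T₃ := T₃) (zero_mem t.finiteLattice) 1
  rwa [one_smul, zero_add, zpow_one, bernstein_zero h.braided₃, one_mul] at this

theorem xMap_simpleRoot_zero : xMap T₁ T₂ T₃ (t.simpleRoot 0) = T₁ 0 * T₂ 0 := by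
  have := xMap_add_smul (T₁ := T₁) (T₂ := T₂) (T₃ := T₃) (neg_mem t.th_mem) 1
  rwa [one_smul, dl_eq, neg_add_cancel_comm_assoc, zpow_one, bernstein_neg h.braided₃ t.th_mem,
    ← (h.central _).eq, h.central_mul_inv] at this

theorem isDoubleAffine : IsDoubleAffine T₁ (xMap T₁ T₂ T₃) where
  braided := h.braided₁
  add u hu' v hv' := by
    obtain ⟨u, hu, k, rfl⟩ := exists_of_mem_xLattice hu'
    obtain ⟨v, hv, l, rfl⟩ := exists_of_mem_xLattice hv'
    rw [add_add_add_comm, ← add_smul, xMap_add_smul (add_mem hu hv), xMap_add_smul hu,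
      xMap_add_smul hv, bernstein_add h.braided₃ hu hv, zpow_add]
    have hC := ((h.central (bernstein T₃ v)).zpow_left k).eq
    generalize T₁ 0 * T₂ 0 * T₃ 0 * weylLift T₁ t.sTheta = C at *
    rw [mul_assoc, ← mul_assoc _ (C ^ k), ← hC]
    simp only [mul_assoc]
  central x := by rw [h.xMap_dl]; exact h.central x
  comm i v hv' hc := by
    obtain ⟨v, hv, k, rfl⟩ := exists_of_mem_xLattice hv'
    rw [map_add, map_zsmul, coroot_dl, smul_zero, add_zero] at hc
    rw [xMap_add_smul hv]
    refine Commute.mul_right ?_ ((h.central _).zpow_left k).symm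
    rcases eq_or_ne i 0 with rfl | hi
    · exact h.commute_and_mul_bernstein_mul.1 v hv hc
    · rw [← h.eq₃ i hi]
      exact commute_bernstein h.braided₃ hi hv hc
  refl i hd v hv' hc := by
    obtain ⟨v, hv, k, rfl⟩ := exists_of_mem_xLattice hv'
    rw [map_add, map_zsmul, coroot_dl, smul_zero, add_zero] at hc
    rw [xMap_add_smul hv, map_add, map_zsmul, s_dl]
    have e : ∀ a x y : G, (∀ z, Commute y z) → a * (x * y) * a = a * x * a * y := by
      intro a x y hy
      rw [← mul_assoc, mul_assoc (a * x), (hy a).eq, ← mul_assoc]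
    rw [e _ _ _ fun z => (h.central z).zpow_left k]
    rcases eq_or_ne i 0 with rfl | hi
    · have h1 : t.s 0 v + k • t.dl = (v - t.th) + (k + 1) • t.dl := by
        rw [s_apply, hc, add_smul, one_smul]
        conv_rhs => rw [dl_eq]
        rw [dl_eq]
        module
      rw [h1, xMap_add_smul (sub_mem hv t.th_mem), h.commute_and_mul_bernstein_mul.2 v hv hc,
        sub_eq_add_neg, bernstein_add h.braided₃ hv (neg_mem t.th_mem),
        bernstein_neg h.braided₃ t.th_mem, add_comm k, zpow_add, zpow_one]
      have hA := h.central_mul_inv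
      have hC := (h.central (bernstein T₃ t.th)⁻¹).eq
      generalize T₁ 0 * T₂ 0 * T₃ 0 * weylLift T₁ t.sTheta = C at *
      rw [← hA, hC]
      simp only [mul_assoc]
    · rw [← h.eq₃ i hi, mul_bernstein_mul h.braided₃ hi hd hv hc,
        xMap_add_smul (s_mem_finiteLattice hv hi)]

end IsTriple

/-- A homomorphism which maps the `T_i` and `X_th` correctly maps all `X_v` correctly. -/
theorem IsDoubleAffine.map_eq {H : Type*} [Group H] {T : Fin (t.rank + 1) → G} {X : t.V → G}
    {T' : Fin (t.rank + 1) → H} {X' : t.V → H} (h : IsDoubleAffine T X) (h' : IsDoubleAffine T' X')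
    (f : G →* H) (hT : ∀ i ≠ 0, f (T i) = T' i) (hth : f (X t.th) = X' t.th)
    (hdl : f (X t.dl) = X' t.dl) {v : t.V} (hv : v ∈ t.xLattice) : f (X v) = X' v := by
  let S : AddSubgroup t.V :=
    { carrier := {v | v ∈ t.xLattice ∧ f (X v) = X' v}
      zero_mem' := ⟨zero_mem _, by rw [h.X_zero, h'.X_zero, map_one]⟩
      add_mem' := by
        rintro a b ⟨ha, ha'⟩ ⟨hb, hb'⟩
        exact ⟨add_mem ha hb, by rw [h.add a ha b hb, h'.add a ha b hb, map_mul, ha', hb']⟩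
      neg_mem' := by
        rintro a ⟨ha, ha'⟩
        exact ⟨neg_mem ha, by rw [h.X_neg ha, h'.X_neg ha, map_inv, ha']⟩ }
  have hS : ∀ v, v ∈ S ↔ v ∈ t.xLattice ∧ f (X v) = X' v := fun _ => Iff.rfl
  have hle : t.finiteLattice ≤ S := by
    refine t.finiteLattice_le ((hS _).2 ⟨th_mem', hth⟩) fun j hj hd γ hγ hγ' hc => ?_
    have hα := simpleRoot_mem_xLattice (t := t) j
    have e : t.s j γ = γ + t.simpleRoot j := by rw [s_apply, hc]; module
    have h1 : γ + t.simpleRoot j ∈ S := by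
      refine (hS _).2 ⟨add_mem hγ.1 hα, ?_⟩
      rw [← e, ← h.refl j hd γ hγ.1 hc, ← h'.refl j hd γ hγ.1 hc, map_mul, map_mul, hT j hj, hγ.2]
    simpa using sub_mem h1 hγ
  obtain ⟨u, hu, k, rfl⟩ := exists_of_mem_xLattice hv
  exact ((hS _).1 (add_mem (hle hu) (zsmul_mem ((hS _).2 ⟨dl_mem, hdl⟩) k))).2

end

end AffineType
end TripleArtin

namespace TripleArtin

theorem map_alternating {G H : Type*} [Group G] [Group H] (f : G →* H) (k : ℕ) (x y : G) :
    f (alternating k x y) = alternating k (f x) (f y) := by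
  induction k generalizing x y with
  | zero => exact map_one f
  | succ k ih => rw [alternating, alternating, map_mul, ih]

namespace DoubleAffineArtin

open AffineType

variable {t : AffineType}

theorem mk_eq_one {r : FreeGroup (DAGen t)} (h : DARel t r) :
    PresentedGroup.mk {r | DARel t r} r = 1 :=
  PresentedGroup.one_of_mem (rels := {r | DARel t r}) h

open Classical in
/-- The elements `X_v`, extended by `1` to all vectors. -/
noncomputable def X' (t : AffineType) (v : t.V) : DoubleAffineArtin t :=
  if h : v ∈ t.xLattice then X t ⟨v, h⟩ else 1

theorem X'_coe (β : t.xLattice) : X' t β = X t β := dif_pos β.2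

theorem X'_of_mem {v : t.V} (h : v ∈ t.xLattice) : X' t v = X t ⟨v, h⟩ := dif_pos h

theorem isDoubleAffine (t : AffineType) : IsDoubleAffine (T t) (X' t) where
  braided i j h := by
    have := mk_eq_one (DARel.braid i j h)
    rw [map_mul, map_inv, mul_inv_eq_one, map_alternating, map_alternating] at this
    exact this
  add u hu v hv := by
    rw [X'_of_mem hu, X'_of_mem hv, X'_of_mem (add_mem hu hv)]
    have := mk_eq_one (DARel.lattice (⟨u, hu⟩ : t.xLattice) ⟨v, hv⟩)
    rw [map_mul, map_inv, mul_inv_eq_one, map_mul] at this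
    exact this.symm
  central x := by
    rw [X'_of_mem dl_mem]
    exact ((Subgroup.mem_center_iff.1 (X_delta_mem_center t)) x).symm
  comm i v hv hc := by
    rw [X'_of_mem hv]
    have := mk_eq_one (DARel.commute i ⟨v, hv⟩ hc)
    rw [map_mul, map_inv, mul_inv_eq_one, map_mul, map_mul] at this
    exact this
  refl i hd v hv hc := by
    have hs : t.s i v ∈ t.xLattice := by
      rw [s_apply, hc, neg_one_smul, sub_neg_eq_add]
      exact add_mem hv (simpleRoot_mem_xLattice i)
    rw [X'_of_mem hv, X'_of_mem hs]
    have := mk_eq_one (DARel.reflect i hd ⟨v, hv⟩ ⟨_, hs⟩ hc rfl)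
    rw [map_mul, map_inv, mul_inv_eq_one, map_mul, map_mul] at this
    exact this

/-- The values of a homomorphism on the generators. -/
def genMap {G : Type*} (T : Fin (t.rank + 1) → G) (X : t.V → G) : DAGen t → G
  | .T i => T i
  | .X β => X β

theorem lift_genMap {G : Type*} [Group G] {T : Fin (t.rank + 1) → G} {X : t.V → G}
    (h : IsDoubleAffine T X) : ∀ r ∈ {r | DARel t r}, FreeGroup.lift (genMap T X) r = 1 := by
  rintro _ (⟨i, j, hij⟩ | ⟨β, γ⟩ | g | ⟨i, β, hc⟩ | ⟨i, hd, β, γ, hc, hγ⟩)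
  · rw [map_mul, map_inv, mul_inv_eq_one, map_alternating, map_alternating]
    simpa [genMap] using h.braided i j hij
  · rw [map_mul, map_inv, mul_inv_eq_one]
    simpa [genMap] using (h.add β β.2 γ γ.2).symm
  · rw [map_mul, map_inv, mul_inv_eq_one, map_mul, map_mul, FreeGroup.lift_apply_of]
    exact (h.central _).eq
  · rw [map_mul, map_inv, mul_inv_eq_one]
    simpa [genMap] using (h.comm i β β.2 hc).eq
  · rw [map_mul, map_inv, mul_inv_eq_one]
    simp only [map_mul, FreeGroup.lift_apply_of, genMap]
    rw [h.refl i hd β β.2 hc, hγ]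
    rfl

end DoubleAffineArtin

namespace TripleGen

open AffineType

variable {t : AffineType}

/-- The generators associated with the nodes, `a` being used for the affine node. -/
def atNode (a : TripleGen t) : Fin (t.rank + 1) → TripleGen t := Fin.cons a T

theorem node_atNode {a : TripleGen t} (ha : a.node = 0) (i : Fin (t.rank + 1)) :
    (atNode a i).node = i := by
  refine Fin.cases ?_ (fun i => ?_) i
  · exact ha
  · rfl

theorem lift_central {G : Type*} [Group G] (f : TripleGen t → G) (w : List (Fin t.rank)) :
    FreeGroup.lift f (central w) = f T01 * f T02 * f T03 * (w.map fun i => f (T i)).prod := by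
  rw [central, map_mul, map_mul, map_mul, map_list_prod, List.map_map]
  simp only [FreeGroup.lift_apply_of]
  congr 2
  refine congrArg (fun g => List.map g w) (funext fun i => ?_)
  simp

theorem prod_eq_weylLift {G : Type*} [Group G] {T' : Fin (t.rank + 1) → G} (hT : t.IsBraided T')
    {w : List (Fin t.rank)} (hw : t.IsReducedTheta w) :
    (w.map fun i => T' i.succ).prod = weylLift T' t.sTheta := by
  obtain ⟨h1, h2⟩ := hw.red
  rw [← h2, weylLift_wordProd hT h1, List.map_map]
  rfl

theorem isTriple {G : Type*} [Group G] {f : TripleGen t → G}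
    (hf : ∀ r, TripleRel t r → FreeGroup.lift f r = 1) {w : List (Fin t.rank)}
    (hw : t.IsReducedTheta w) (hc : ∀ x, Commute (FreeGroup.lift f (central w)) x) :
    IsTriple t (fun i => f (atNode T01 i)) (fun i => f (atNode T02 i))
      (fun i => f (atNode T03 i)) := by
  have hb : ∀ a : TripleGen t, a.node = 0 → t.IsBraided fun i => f (atNode a i) := by
    intro a ha i j hij
    have hn : (atNode a i).node ≠ (atNode a j).node := by
      rwa [node_atNode ha, node_atNode ha]
    have := hf _ (TripleRel.braid _ _ hn)
    rw [map_mul, map_inv, mul_inv_eq_one, map_alternating, map_alternating, node_atNode ha,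
      node_atNode ha] at this
    simpa using this
  have he : ∀ (a : TripleGen t) i, i ≠ 0 → f (atNode a i) = f (atNode T01 i) := by
    intro a i hi
    obtain ⟨j, rfl⟩ := Fin.exists_succ_eq.2 hi
    rfl
  refine ⟨hb _ rfl, hb _ rfl, hb _ rfl, he _, he _, fun i hi hl => ?_, fun x => ?_⟩
  · obtain ⟨j, rfl⟩ := Fin.exists_succ_eq.2 hi
    have := hf _ (TripleRel.double j hl)
    rw [map_mul, map_inv, mul_inv_eq_one] at this
    simp only [map_mul, map_inv, FreeGroup.lift_apply_of] at this
    change f T01 * ((f (T j))⁻¹ * f T03 * f (T j)) = (f (T j))⁻¹ * f T03 * f (T j) * f T01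
    rw [← this]
    simp only [mul_assoc]
  · have h1 := prod_eq_weylLift (hb T01 rfl) hw
    rw [← h1]
    have := hc x
    rw [lift_central] at this
    exact this

/-- The values of a homomorphism on the generators. -/
def genMap {G : Type*} (T₁ T₂ T₃ : Fin (t.rank + 1) → G) : TripleGen t → G
  | T i => T₁ i.succ
  | T01 => T₁ 0
  | T02 => T₂ 0
  | T03 => T₃ 0

theorem lift_genMap {G : Type*} [Group G] {T₁ T₂ T₃ : Fin (t.rank + 1) → G}
    (h : IsTriple t T₁ T₂ T₃) {w : List (Fin t.rank)} (hw : t.IsReducedTheta w) :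
    ∀ r ∈ doubleRels t w, FreeGroup.lift (genMap T₁ T₂ T₃) r = 1 := by
  have hb2 : ∀ i : Fin t.rank, alternating (t.braidLength 0 i.succ) (T₂ 0) (T₁ i.succ) =
      alternating (t.braidLength 0 i.succ) (T₁ i.succ) (T₂ 0) := fun i => by
    rw [← h.eq₂ _ (Fin.succ_ne_zero i)]; exact h.braided₂ _ _ (Fin.succ_ne_zero i).symm
  have hb3 : ∀ i : Fin t.rank, alternating (t.braidLength 0 i.succ) (T₃ 0) (T₁ i.succ) =
      alternating (t.braidLength 0 i.succ) (T₁ i.succ) (T₃ 0) := fun i => by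
    rw [← h.eq₃ _ (Fin.succ_ne_zero i)]; exact h.braided₃ _ _ (Fin.succ_ne_zero i).symm
  rintro r ((⟨a, b, hab⟩ | ⟨i, hl⟩) | ⟨g, hg⟩)
  · rw [map_mul, map_inv, mul_inv_eq_one, map_alternating, map_alternating,
      FreeGroup.lift_apply_of, FreeGroup.lift_apply_of]
    cases a <;> cases b <;> try exact absurd rfl hab
    · exact h.braided₁ _ _ hab
    · exact h.braided₁ _ _ hab
    · simp only [node, genMap]; rw [braidLength_comm]; exact (hb2 _).symm
    · simp only [node, genMap]; rw [braidLength_comm]; exact (hb3 _).symm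
    · exact h.braided₁ _ _ hab
    · exact hb2 _
    · exact hb3 _
  · rw [map_mul, map_inv, mul_inv_eq_one]
    simp only [map_mul, map_inv, FreeGroup.lift_apply_of, genMap]
    have := (h.double i.succ (Fin.succ_ne_zero i) hl).eq
    rw [← this]
    simp only [mul_assoc]
  · rw [hg, map_mul, map_inv, mul_inv_eq_one, map_mul, map_mul, lift_central]
    have := prod_eq_weylLift h.braided₁ hw
    simp only [genMap]
    rw [this]
    exact (h.central _).eq

end TripleGen

theorem commute_of_commute_of {α : Type*} {rels : Set (FreeGroup α)} {x : PresentedGroup rels}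
    (h : ∀ g, Commute x (PresentedGroup.of g)) (y : PresentedGroup rels) : Commute x y :=
  (Subgroup.mem_centralizer_singleton_iff.1
    (PresentedGroup.generated_by rels (Subgroup.centralizer {x})
      (fun g => Subgroup.mem_centralizer_singleton_iff.2 (h g).symm.eq) y)).symm

theorem lift_of_eq_mk {α : Type*} (rels : Set (FreeGroup α)) (r : FreeGroup α) :
    FreeGroup.lift (PresentedGroup.of (rels := rels)) r = PresentedGroup.mk rels r :=
  DFunLike.congr_fun (FreeGroup.ext_hom (FreeGroup.lift PresentedGroup.of) (PresentedGroup.mk rels)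
    fun _ => FreeGroup.lift_apply_of) r

theorem toGroup_mk {α G : Type*} [Group G] {rels : Set (FreeGroup α)} {f : α → G}
    (h : ∀ r ∈ rels, FreeGroup.lift f r = 1) (r : FreeGroup α) :
    PresentedGroup.toGroup h (PresentedGroup.mk rels r) = FreeGroup.lift f r := rfl

open AffineType DoubleAffineArtin in
theorem exists_doubleAffine_equiv (t : AffineType) {w : List (Fin t.rank)} (hw : t.IsReducedTheta w) :
    ∃ φ : PresentedGroup (doubleRels t w) ≃* DoubleAffineArtin t,
      (∀ i : Fin t.rank, φ (PresentedGroup.of (.T i)) = T t i.succ) ∧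
      φ (PresentedGroup.of .T01) = T t 0 ∧
      φ (PresentedGroup.of .T02) = (T t 0)⁻¹ * X t t.xAlphaZero ∧
      φ (PresentedGroup.of .T03) = X t t.xTheta * (Tword t w)⁻¹ ∧
      φ (PresentedGroup.mk (doubleRels t w) (TripleGen.central w)) = X t t.xDelta := by
  have hD := isDoubleAffine t
  have hD3 := hD.isTriple
  have hP := TripleGen.isTriple (t := t) (w := w) (f := PresentedGroup.of (rels := doubleRels t w))
    (fun r hr => by
      rw [lift_of_eq_mk]
      exact PresentedGroup.one_of_mem (Or.inl hr)) hw (by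
      rw [lift_of_eq_mk]
      refine commute_of_commute_of fun g => ?_
      have := PresentedGroup.one_of_mem (rels := doubleRels t w) (Or.inr ⟨g, rfl⟩)
      rw [map_mul, map_inv, mul_inv_eq_one, map_mul, map_mul] at this
      exact this)
  have hPD := hP.isDoubleAffine
  have hword : Tword t w = weylLift (T t) t.sTheta := TripleGen.prod_eq_weylLift hD.braided hw
  set Φ : PresentedGroup (doubleRels t w) →* DoubleAffineArtin t :=
    PresentedGroup.toGroup (TripleGen.lift_genMap hD3 hw) with hΦ
  set Ψ : DoubleAffineArtin t →* PresentedGroup (doubleRels t w) :=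
    PresentedGroup.toGroup (DoubleAffineArtin.lift_genMap hPD) with hΨ
  have eT : ∀ i : Fin t.rank, Φ (PresentedGroup.of (.T i)) = T t i.succ := fun i =>
    PresentedGroup.toGroup.of _
  have e1 : Φ (PresentedGroup.of .T01) = T t 0 := PresentedGroup.toGroup.of _
  have e2 : Φ (PresentedGroup.of .T02) = (T t 0)⁻¹ * X t t.xAlphaZero := by
    refine (PresentedGroup.toGroup.of _).trans ?_
    simp only [TripleGen.genMap, Function.update_self]
    rw [← X'_coe]
    rfl
  have e3 : Φ (PresentedGroup.of .T03) = X t t.xTheta * (Tword t w)⁻¹ := by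
    refine (PresentedGroup.toGroup.of _).trans ?_
    simp only [TripleGen.genMap, Function.update_self]
    rw [hword, ← X'_coe]
    rfl
  have hXδ : X t t.xDelta = X' t t.dl := (X'_coe _).symm
  have hXθ : X t t.xTheta = X' t t.th := (X'_coe _).symm
  have hXα : X t t.xAlphaZero = X' t (t.simpleRoot 0) := (X'_coe _).symm
  have e4 : Φ (PresentedGroup.mk (doubleRels t w) (TripleGen.central w)) = X t t.xDelta := by
    rw [hΦ, toGroup_mk, TripleGen.lift_central]
    simp only [TripleGen.genMap, Function.update_self]
    rw [TripleGen.prod_eq_weylLift hD.braided hw, hXδ, dl_eq, hD.add _ (simpleRoot_mem_xLattice 0) _ th_mem']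
    group
  have fT : ∀ i, Ψ (T t i) = PresentedGroup.of (TripleGen.atNode .T01 i) := fun i =>
    PresentedGroup.toGroup.of _
  have fX : ∀ v ∈ t.xLattice, Ψ (X' t v) = xMap (fun i => PresentedGroup.of (TripleGen.atNode .T01 i))
      (fun i => PresentedGroup.of (TripleGen.atNode .T02 i))
      (fun i => PresentedGroup.of (TripleGen.atNode .T03 i)) v := fun v hv => by
    rw [X'_of_mem hv]; exact PresentedGroup.toGroup.of _
  have gT : ∀ i, Φ (Ψ (T t i)) = T t i := fun i => by
    rw [fT]
    refine Fin.cases ?_ (fun j => ?_) i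
    · exact e1
    · exact eT j
  have hpw := TripleGen.prod_eq_weylLift hP.braided₁ hw
  have hΦword : Φ (weylLift (fun i => PresentedGroup.of (TripleGen.atNode .T01 i)) t.sTheta) =
      Tword t w := by
    rw [← hpw, map_list_prod, List.map_map]
    exact congrArg (fun g => (List.map g w).prod) (funext eT)
  have hΨword : Ψ (Tword t w) =
      weylLift (fun i => PresentedGroup.of (TripleGen.atNode .T01 i)) t.sTheta := by
    rw [← hpw, Tword, map_list_prod, List.map_map]
    exact congrArg (fun g => (List.map g w).prod) (funext fun i => fT i.succ)
  have h1 : Φ.comp Ψ = MonoidHom.id _ := by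
    refine PresentedGroup.ext fun g => ?_
    cases g with
    | T i => exact gT i
    | X β =>
      have := hPD.map_eq hD Φ (fun i _ => by rw [← fT, gT]) ?_ ?_ β.2
      · rw [MonoidHom.comp_apply, MonoidHom.id_apply]
        rw [← fX _ β.2, X'_coe] at this
        exact this
      · rw [xMap_of_mem t.th_mem, bernstein_th hP.braided₃, map_mul, hP.weylLift_eq t.sTheta_mem_F,
          hΦword, ← hXθ]
        refine (congrArg (· * Tword t w) e3).trans ?_
        group
      · rw [hP.xMap_dl, ← hXδ, ← e4, ← lift_of_eq_mk, TripleGen.lift_central]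
        congr 2
        exact hpw.symm
  have h2 : Ψ.comp Φ = MonoidHom.id _ := by
    refine PresentedGroup.ext fun g => ?_
    rw [MonoidHom.comp_apply, MonoidHom.id_apply]
    cases g with
    | T i => rw [eT, fT]; rfl
    | T01 => rw [e1, fT]; rfl
    | T02 =>
      rw [e2, map_mul, map_inv, hXα, fX _ (simpleRoot_mem_xLattice 0), hP.xMap_simpleRoot_zero, fT]
      exact inv_mul_cancel_left _ _
    | T03 =>
      rw [e3, map_mul, map_inv, hXθ, fX _ th_mem', xMap_of_mem t.th_mem, bernstein_th hP.braided₃,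
        hP.weylLift_eq t.sTheta_mem_F, hΨword]
      exact mul_inv_cancel_right _ _
  exact ⟨MonoidHom.toMulEquiv Φ Ψ h2 h1, eT, e1, e2, e3, e4⟩

theorem exists_elliptic_equiv (t : AffineType) (w : List (Fin t.rank))
    (φ : PresentedGroup (doubleRels t w) ≃* DoubleAffineArtin t)
    (hφ : φ (PresentedGroup.mk (doubleRels t w) (TripleGen.central w)) =
      DoubleAffineArtin.X t t.xDelta) :
    ∃ ψ : PresentedGroup (ellipticRels t w) ≃* EllipticArtin t,
      ∀ g, ψ (PresentedGroup.of g) = QuotientGroup.mk (φ (PresentedGroup.of g)) := by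
  let π : PresentedGroup (doubleRels t w) →* EllipticArtin t :=
    (QuotientGroup.mk' _).comp φ.toMonoidHom
  have hπ : ∀ r, FreeGroup.lift (fun g => π (PresentedGroup.of g)) r = π (PresentedGroup.mk _ r) :=
    fun r => DFunLike.congr_fun (FreeGroup.ext_hom (FreeGroup.lift fun g => π (PresentedGroup.of g))
      (π.comp (PresentedGroup.mk _)) fun _ => FreeGroup.lift_apply_of) r
  have h1 : ∀ r ∈ ellipticRels t w, FreeGroup.lift (fun g => π (PresentedGroup.of g)) r = 1 := by
    rintro r (hr | rfl)
    · rw [hπ, PresentedGroup.one_of_mem (rels := doubleRels t w) (Or.inl hr), map_one]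
    · rw [hπ]
      change QuotientGroup.mk (φ _) = _
      rw [hφ, QuotientGroup.eq_one_iff]
      exact Subgroup.mem_zpowers _
  have hc : PresentedGroup.mk (ellipticRels t w) (TripleGen.central w) = 1 :=
    PresentedGroup.one_of_mem (Or.inr rfl)
  have h2 : ∀ r ∈ doubleRels t w,
      FreeGroup.lift (PresentedGroup.of (rels := ellipticRels t w)) r = 1 := by
    rintro r (hr | ⟨g, rfl⟩) <;> rw [lift_of_eq_mk]
    · exact PresentedGroup.one_of_mem (Or.inl hr)
    · rw [map_mul, map_inv, mul_inv_eq_one, map_mul, map_mul, hc, one_mul, mul_one]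
  let q : PresentedGroup (doubleRels t w) →* PresentedGroup (ellipticRels t w) :=
    PresentedGroup.toGroup h2
  have hq : ∀ g, q (PresentedGroup.of g) = PresentedGroup.of g := fun g => PresentedGroup.toGroup.of _
  have h3 : ∀ x ∈ Subgroup.zpowers (DoubleAffineArtin.X t t.xDelta),
      q.comp φ.symm.toMonoidHom x = 1 := by
    intro x hx
    obtain ⟨k, rfl⟩ := Subgroup.mem_zpowers_iff.1 hx
    have h4 : q (φ.symm (DoubleAffineArtin.X t t.xDelta)) = 1 := by
      rw [← hφ, MulEquiv.symm_apply_apply, ← hc]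
      exact (toGroup_mk h2 _).trans (lift_of_eq_mk _ _)
    rw [map_zpow]
    change q (φ.symm (DoubleAffineArtin.X t t.xDelta)) ^ k = 1
    rw [h4, one_zpow]
  let A : PresentedGroup (ellipticRels t w) →* EllipticArtin t := PresentedGroup.toGroup h1
  let B : EllipticArtin t →* PresentedGroup (ellipticRels t w) :=
    QuotientGroup.lift _ (q.comp φ.symm.toMonoidHom) h3
  have hA : ∀ g, A (PresentedGroup.of g) = QuotientGroup.mk (φ (PresentedGroup.of g)) := fun g =>
    PresentedGroup.toGroup.of _
  have hB : ∀ x, B (QuotientGroup.mk x) = q (φ.symm x) := fun x => rfl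
  have hBA : B.comp A = MonoidHom.id _ := by
    refine PresentedGroup.ext fun g => ?_
    rw [MonoidHom.comp_apply, hA, hB, MulEquiv.symm_apply_apply, hq, MonoidHom.id_apply]
  have hAq : A.comp q = π := by
    refine PresentedGroup.ext fun g => ?_
    rw [MonoidHom.comp_apply, hq, hA]
    rfl
  have hAB : A.comp B = MonoidHom.id _ := by
    refine MonoidHom.ext fun x => ?_
    obtain ⟨y, rfl⟩ := QuotientGroup.mk_surjective x
    rw [MonoidHom.comp_apply, hB, ← MonoidHom.comp_apply, hAq]
    change QuotientGroup.mk (φ (φ.symm y)) = _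
    rw [MulEquiv.apply_symm_apply]
    rfl
  exact ⟨MonoidHom.toMulEquiv A B hBA hAB, hA⟩

end TripleArtin

theorem mainTheorem2 (t : TripleArtin.AffineType) :
    (∃ w : List (Fin t.rank), t.IsReducedTheta w) ∧
    ∀ w : List (Fin t.rank), t.IsReducedTheta w →
      (∃ φ : PresentedGroup (TripleArtin.doubleRels t w) ≃* TripleArtin.DoubleAffineArtin t,
        (∀ i : Fin t.rank, φ (PresentedGroup.of (.T i)) =
          TripleArtin.DoubleAffineArtin.T t i.succ) ∧
        φ (PresentedGroup.of .T01) = TripleArtin.DoubleAffineArtin.T t 0 ∧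
        φ (PresentedGroup.of .T02) =
          (TripleArtin.DoubleAffineArtin.T t 0)⁻¹ *
            TripleArtin.DoubleAffineArtin.X t t.xAlphaZero ∧
        φ (PresentedGroup.of .T03) =
          TripleArtin.DoubleAffineArtin.X t t.xTheta *
            (TripleArtin.DoubleAffineArtin.Tword t w)⁻¹ ∧
        φ (PresentedGroup.mk (TripleArtin.doubleRels t w) (TripleArtin.TripleGen.central w)) =
          TripleArtin.DoubleAffineArtin.X t t.xDelta) ∧
      (∃ ψ : PresentedGroup (TripleArtin.ellipticRels t w) ≃* TripleArtin.EllipticArtin t,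
        (∀ i : Fin t.rank, ψ (PresentedGroup.of (.T i)) =
          QuotientGroup.mk (TripleArtin.DoubleAffineArtin.T t i.succ)) ∧
        ψ (PresentedGroup.of .T01) =
          QuotientGroup.mk (TripleArtin.DoubleAffineArtin.T t 0) ∧
        ψ (PresentedGroup.of .T02) =
          QuotientGroup.mk ((TripleArtin.DoubleAffineArtin.T t 0)⁻¹ *
            TripleArtin.DoubleAffineArtin.X t t.xAlphaZero) ∧
        ψ (PresentedGroup.of .T03) =
          QuotientGroup.mk (TripleArtin.DoubleAffineArtin.X t t.xTheta *
            (TripleArtin.DoubleAffineArtin.Tword t w)⁻¹)) := by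
  refine ⟨t.exists_isReducedTheta, fun w hw => ?_⟩
  obtain ⟨φ, h1, h2, h3, h4, h5⟩ := TripleArtin.exists_doubleAffine_equiv t hw
  obtain ⟨ψ, hψ⟩ := TripleArtin.exists_elliptic_equiv t w φ h5
  exact ⟨⟨φ, h1, h2, h3, h4, h5⟩,
    ⟨ψ, fun i => by rw [hψ, h1], by rw [hψ, h2], by rw [hψ, h3], by rw [hψ, h4]⟩⟩
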